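/- There exist absolute constants $C,c>0$ with the following property. Let $\mathcal J$ be a finite index set with $n=|\mathcal J|$, let $\{X_i : i\in\mathcal J\}$ be random variables on a common probability space with $\mathbb E X_i=0$ and finite variances, and suppose that $W=\sum_{i\in\mathcal J}X_i$ satisfies $\operatorname{Var}(W)=1$. For $S\subset\mathcal J$ write $X_S=\{X_j : j\in S\}$ and $S^c=\mathcal J\setminus S$. Suppose that for each $i\in\mathcal J$ there are sets $A_i\subset B_i\subset\mathcal J$ such that (LD1) $X_i$ is independent of $X_{A_i^c}$, and (LD2) $X_{A_i}$ is independent of $X_{B_i^c}$. Let $N_i=\{j\in\mathcal J : B_i\cap B_j\neq\emptyset\}$ and $\kappa=\max_{i\in\mathcal J}|N_i|$. Suppose that $a_n\ge 1$ and $b\ge 1$ are real numbers such that, for all $i\in\mathcal J$, $$\mathbb E\exp\Bigl(a_n\sum_{j\in B_i}|X_j|\Bigr)\le b .$$ Put $\theta_n=b^{1/2}n^{1/2}a_n^{-1}$ and $\delta_n=\kappa^2a_n^{-1}(1+\theta_n^6)$, and let $\Phi$ be the standard normal distribution function. Then $$\left|\frac{\mathbb P(W>z)}{1-\Phi(z)}-1\right|\le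 C\,\delta_n\,(1+z^3)$$ for all $0\le z\le c\,a_n^{1/3}\min\{1,\ \kappa^{-1/3}(1+\theta_n)^{-2/3}\}$. -/

import Mathlib

open MeasureTheory ProbabilityTheory

noncomputable section

namespace LocalDep

variable {Ω J : Type*}

/-- The subfamily `X_S = (X_j)_{j ∈ S}` as one random vector. -/
def sub (X : J → Ω → ℝ) (S : Set J) : Ω → S → ℝ :=
  fun ω j => X j ω

/-- (LD1) with neighbourhoods `A i`: `X_i` is independent of `X_{A_i^c}`. -/
def LD1 [MeasurableSpace Ω] (P : Measure Ω) (X : J → Ω → ℝ) (A : J → Finset J) : Prop :=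
  ∀ i, IndepFun (X i) (sub X ((A i : Set J)ᶜ)) P

/-- (LD2) with neighbourhoods `A i ⊆ B i`: `X_{A_i}` is independent of `X_{B_i^c}`. -/
def LD2 [MeasurableSpace Ω] (P : Measure Ω) (X : J → Ω → ℝ) (A B : J → Finset J) : Prop :=
  ∀ i, A i ⊆ B i ∧ IndepFun (sub X (A i : Set J)) (sub X ((B i : Set J)ᶜ)) P

variable [Fintype J]

/-- `W = ∑_{i ∈ J} X_i`. -/
def W (X : J → Ω → ℝ) : Ω → ℝ := fun ω => ∑ i, X i ω

open Classical in
/-- `N_i = {j : B_i ∩ B_j ≠ ∅}`. -/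
def N (B : J → Finset J) (i : J) : Finset J :=
  Finset.univ.filter fun j => (B i ∩ B j).Nonempty

/-- `κ = max_i |N_i|`. -/
def kappa (B : J → Finset J) : ℕ :=
  Finset.univ.sup fun i => (N B i).card

/-- `θ_n = b^{1/2} n^{1/2} a_n^{-1}`. -/
def theta (n : ℕ) (a b : ℝ) : ℝ :=
  b ^ (1 / 2 : ℝ) * (n : ℝ) ^ (1 / 2 : ℝ) * a⁻¹

/-- `δ_n = κ² a_n^{-1} (1 + θ_n⁶)`. -/
def delta (n κ : ℕ) (a b : ℝ) : ℝ :=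
  (κ : ℝ) ^ 2 * a⁻¹ * (1 + theta n a b ^ 6)

/-- The standard normal distribution function. -/
def Phi (z : ℝ) : ℝ := cdf (gaussianReal 0 1) z

end LocalDep

end

/-! Stein's method for a half line, run under exponentially growing weights. Let ℓ = max(1, z), ν =
θ² and ε = κν/a, and let f solve f'(w) - w f(w) = (1 - Φ(z)) - 1{w ≥ z}. Then P(W ≥ z) - (1 - Φ(z))
= E W f(W) - E f'(W). With Y_i the sum of X_j over A_i, (LD1) gives E X_i f(W - Y_i) = 0, and a
Taylor expansion turns the difference into E f'(W) (∑ X_i Y_i - 1) plus a second-order remainder,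
where ∑ E X_i Y_i = Var W = 1.

Both errors must be small compared with 1 - Φ(z), and f' is of size ℓ (1 - Φ(z)) exp(c²/2), with c
the value of w clamped to [0, z], plus the indicator of [z, ∞). Unweighted moments are therefore
useless. Three estimates replace them.

(1) Decoupling. For a log-Lipschitz function g ≥ 1, replacing W by its part outside B_i costs a
constant factor unless the local sum is large, and that event is paid for by the exponential moment.
With (LD2) this gives `integral_mul_test_le` and a variance bound under the weight g(W),
`integral_sq_sum_mul_test_le`, so that ∑ (X_i Y_i - E X_i Y_i) is of order ℓε in weighted L¹.

(2) Exponential moments. Stein's identity applied to exp(t · softMin) gives a differential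
inequality in t, whence E exp(t · softMin(W)) ≤ 6 exp(t²/2) for 0 ≤ t ≤ ℓ
(`one_add_integral_tilt_le`). Summing over integers t bounds the Gaussian weight by a multiple of ℓ.

(3) Concentration. Since f' jumps at z, the mass of W near z at scale ν/a is needed; Stein's
identity for the antiderivative of a logistic bump shows that it is of order ℓ ε exp(-z²/2)
(`integral_bump_le`).

Together these give a relative error of order ℓ³ ε ν, that is ℓ³ κ θ⁴ / a, whenever ε ℓ³ ≤ 10⁻⁸. If
that smallness fails, the allowed range forces z ≤ 1 and δ_n is bounded below, so the claim is
trivial. -/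

namespace LocalDep

/-! ### Local sums, exponential weights and generated σ-algebras -/

section Basic

variable {Ω J : Type*}

/-- The sum of `|X_j|` over a finite set of indices. -/
noncomputable def absSum (X : J → Ω → ℝ) (s : Finset J) (ω : Ω) : ℝ := ∑ j ∈ s, |X j ω|

/-- The exponential weight `exp (a ∑_{j ∈ s} |X_j| / 16)`. -/
noncomputable def wt (X : J → Ω → ℝ) (a : ℝ) (s : Finset J) (ω : Ω) : ℝ :=
  Real.exp (a * absSum X s ω / 16)

/-- The σ-algebra generated by the subfamily `X_S`. -/
@[reducible] def sig (X : J → Ω → ℝ) (S : Set J) : MeasurableSpace Ω :=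
  MeasurableSpace.comap (sub X S) inferInstance

/-- The part of `W` outside `B_i`. -/
noncomputable def far [Fintype J] (X : J → Ω → ℝ) (B : J → Finset J) (i : J) (ω : Ω) : ℝ :=
  W X ω - ∑ j ∈ B i, X j ω

lemma absSum_nonneg (X : J → Ω → ℝ) (s : Finset J) (ω : Ω) : 0 ≤ absSum X s ω :=
  Finset.sum_nonneg fun _ _ => abs_nonneg _

lemma absSum_mono (X : J → Ω → ℝ) {s t : Finset J} (h : s ⊆ t) (ω : Ω) :
    absSum X s ω ≤ absSum X t ω :=
  Finset.sum_le_sum_of_subset_of_nonneg h fun _ _ _ => abs_nonneg _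

lemma abs_sum_le_absSum (X : J → Ω → ℝ) (s : Finset J) (ω : Ω) :
    |∑ j ∈ s, X j ω| ≤ absSum X s ω := Finset.abs_sum_le_sum_abs _ _

lemma wt_pos (X : J → Ω → ℝ) (a : ℝ) (s : Finset J) (ω : Ω) : 0 < wt X a s ω := Real.exp_pos _

lemma one_le_wt (X : J → Ω → ℝ) {a : ℝ} (ha : 0 ≤ a) (s : Finset J) (ω : Ω) :
    1 ≤ wt X a s ω := by
  have := absSum_nonneg X s ω
  exact Real.one_le_exp (by positivity)

lemma wt_mono (X : J → Ω → ℝ) {a : ℝ} (ha : 0 ≤ a) {s t : Finset J} (h : s ⊆ t) (ω : Ω) :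
    wt X a s ω ≤ wt X a t ω := by
  have := absSum_mono X h ω
  unfold wt
  gcongr

lemma wt_pow (X : J → Ω → ℝ) (a : ℝ) (s : Finset J) (ω : Ω) (k : ℕ) :
    wt X a s ω ^ k = Real.exp (k * (a * absSum X s ω / 16)) := by
  rw [wt, ← Real.exp_nat_mul]

/-- The divisor 16 in the weight provides room: products of up to sixteen weights are controlled by
the exponential moment hypothesis, and no estimate below needs a higher total degree. -/
lemma wt_pow_sixteen (X : J → Ω → ℝ) (a : ℝ) (s : Finset J) (ω : Ω) :
    wt X a s ω ^ 16 = Real.exp (a * absSum X s ω) := by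
  rw [wt_pow]; congr 1; push_cast; ring

lemma measurable_sig (X : J → Ω → ℝ) {S : Set J} {j : J} (hj : j ∈ S) :
    Measurable[sig X S] (X j) := by
  have h : X j = (fun v : S → ℝ => v ⟨j, hj⟩) ∘ sub X S := rfl
  rw [h]
  exact (measurable_pi_apply _).comp (comap_measurable _)

lemma sig_mono (X : J → Ω → ℝ) {S T : Set J} (h : S ⊆ T) : sig X S ≤ sig X T := by
  refine Measurable.comap_le ?_
  refine @measurable_pi_lambda _ _ _ (sig X T) _ _ fun j => ?_
  exact measurable_sig X (h j.2)

lemma sig_le [m : MeasurableSpace Ω] {X : J → Ω → ℝ} (hX : ∀ i, Measurable (X i)) (S : Set J) :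
    sig X S ≤ m :=
  Measurable.comap_le (measurable_pi_lambda _ fun j => hX j)

lemma absSum_measurable_sig (X : J → Ω → ℝ) {S : Set J} {s : Finset J} (h : ↑s ⊆ S) :
    Measurable[sig X S] (absSum X s) := by
  refine Finset.measurable_fun_sum _ fun j hj => ?_
  exact continuous_abs.measurable.comp (measurable_sig X (h hj))

lemma wt_measurable_sig (X : J → Ω → ℝ) (a : ℝ) {S : Set J} {s : Finset J} (h : ↑s ⊆ S) :
    Measurable[sig X S] (wt X a s) :=
  Real.measurable_exp.comp (((absSum_measurable_sig X h).const_mul a).div_const 16)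

lemma far_eq [Fintype J] [DecidableEq J] (X : J → Ω → ℝ) (B : J → Finset J) (i : J) :
    far X B i = fun ω => ∑ j ∈ (B i)ᶜ, X j ω := by
  funext ω
  rw [far, W, ← Finset.sum_add_sum_compl (B i)]
  ring

lemma far_measurable_sig [Fintype J] (X : J → Ω → ℝ) (B : J → Finset J) (i : J) :
    Measurable[sig X ((B i : Set J)ᶜ)] (far X B i) := by
  classical
  rw [far_eq]
  refine Finset.measurable_fun_sum _ fun j hj => ?_
  exact measurable_sig X (by simpa using hj)

lemma W_sub_far [Fintype J] (X : J → Ω → ℝ) (B : J → Finset J) (i : J) (ω : Ω) :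
    |W X ω - far X B i ω| ≤ absSum X (B i) ω := by
  rw [far, sub_sub_cancel]
  exact abs_sum_le_absSum X _ ω

end Basic

/-! ### Reduced local systems and integrability bookkeeping -/

/-- A locally dependent system in which `X_i` vanishes unless `i ∈ A_i`. -/
structure IsLocalSystem {Ω J : Type*} [MeasurableSpace Ω] [Fintype J] (P : Measure Ω)
    (X : J → Ω → ℝ) (A B : J → Finset J) (a b : ℝ) : Prop where
  meas : ∀ i, Measurable (X i)
  memLp : ∀ i, MemLp (X i) 2 P
  mean : ∀ i, ∫ ω, X i ω ∂P = 0
  var : variance (W X) P = 1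
  ld1 : LD1 P X A
  ld2 : LD2 P X A B
  one_le_a : 1 ≤ a
  one_le_b : 1 ≤ b
  integrable_exp : ∀ i, Integrable (fun ω => Real.exp (a * absSum X (B i) ω)) P
  integral_exp_le : ∀ i, ∫ ω, Real.exp (a * absSum X (B i) ω) ∂P ≤ b
  eq_zero : ∀ i, i ∉ A i → ∀ ω, X i ω = 0

/-- The envelope `1 + ∑_i exp (a T_i / 16)`, which lies in `L^16`. -/
noncomputable def envelope {Ω J : Type*} [Fintype J] (X : J → Ω → ℝ) (B : J → Finset J) (a : ℝ)
    (ω : Ω) : ℝ := 1 + ∑ i, wt X a (B i) ω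

lemma one_le_envelope {Ω J : Type*} [Fintype J] (X : J → Ω → ℝ) (B : J → Finset J) (a : ℝ) (ω : Ω) :
    1 ≤ envelope X B a ω :=
  le_add_of_nonneg_right (Finset.sum_nonneg fun _ _ => (wt_pos _ _ _ _).le)

lemma wt_le_envelope {Ω J : Type*} [Fintype J] (X : J → Ω → ℝ) (B : J → Finset J) (a : ℝ) (i : J) (ω : Ω) :
    wt X a (B i) ω ≤ envelope X B a ω := by
  have h := Finset.single_le_sum (f := fun i => wt X a (B i) ω)
    (fun _ _ => (wt_pos _ _ _ _).le) (Finset.mem_univ i)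
  simp only [envelope]
  linarith

/-- Measurable functions of growth at most the `k`-th power of the envelope. -/
def Controlled {Ω J : Type*} [MeasurableSpace Ω] [Fintype J] (X : J → Ω → ℝ) (B : J → Finset J)
    (a : ℝ) (k : ℕ) (F : Ω → ℝ) : Prop :=
  Measurable F ∧ ∃ K : ℝ, ∀ ω, |F ω| ≤ K * envelope X B a ω ^ k

section Controlled

variable {Ω J : Type*} [MeasurableSpace Ω] [Fintype J] {X : J → Ω → ℝ} {B : J → Finset J} {a : ℝ}
  {k l : ℕ} {F G : Ω → ℝ}

namespace Controlled

lemma measurable (h : Controlled X B a k F) : Measurable F := h.1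

lemma bound (h : Controlled X B a k F) :
    ∃ K : ℝ, 0 ≤ K ∧ ∀ ω, |F ω| ≤ K * envelope X B a ω ^ k := by
  obtain ⟨_, K, hK⟩ := h
  refine ⟨|K|, abs_nonneg _, fun ω => (hK ω).trans ?_⟩
  have := one_le_envelope X B a ω
  gcongr
  exact le_abs_self K

lemma mono (h : Controlled X B a k F) (hkl : k ≤ l) : Controlled X B a l F := by
  obtain ⟨K, hK0, hK⟩ := h.bound
  refine ⟨h.1, K, fun ω => (hK ω).trans ?_⟩
  have := one_le_envelope X B a ω
  gcongr

lemma mul (hF : Controlled X B a k F) (hG : Controlled X B a l G) :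
    Controlled X B a (k + l) (fun ω => F ω * G ω) := by
  obtain ⟨K, hK0, hK⟩ := hF.bound
  obtain ⟨L, hL0, hL⟩ := hG.bound
  refine ⟨hF.1.mul hG.1, K * L, fun ω => ?_⟩
  have := one_le_envelope X B a ω
  calc |F ω * G ω| = |F ω| * |G ω| := abs_mul _ _
    _ ≤ (K * envelope X B a ω ^ k) * (L * envelope X B a ω ^ l) := by
        gcongr
        exacts [hK ω, hL ω]
    _ = _ := by ring

lemma add (hF : Controlled X B a k F) (hG : Controlled X B a l G) :
    Controlled X B a (max k l) (fun ω => F ω + G ω) := by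
  obtain ⟨K, hK⟩ := (hF.mono (le_max_left k l)).2
  obtain ⟨L, hL⟩ := (hG.mono (le_max_right k l)).2
  refine ⟨hF.1.add hG.1, K + L, fun ω => (abs_add_le _ _).trans ?_⟩
  rw [add_mul]
  exact add_le_add (hK ω) (hL ω)

lemma neg (hF : Controlled X B a k F) : Controlled X B a k (fun ω => -F ω) := by
  obtain ⟨K, hK⟩ := hF.2
  exact ⟨hF.1.neg, K, fun ω => by rw [abs_neg]; exact hK ω⟩

lemma sub (hF : Controlled X B a k F) (hG : Controlled X B a l G) :
    Controlled X B a (max k l) (fun ω => F ω - G ω) := by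
  simpa only [sub_eq_add_neg] using hF.add hG.neg

lemma abs (hF : Controlled X B a k F) : Controlled X B a k (fun ω => |F ω|) := by
  obtain ⟨K, hK⟩ := hF.2
  exact ⟨hF.1.abs, K, fun ω => by rw [abs_abs]; exact hK ω⟩

lemma of_bounded (hF : Measurable F) (K : ℝ) (hK : ∀ ω, |F ω| ≤ K) : Controlled X B a 0 F :=
  ⟨hF, K, fun ω => by simpa using hK ω⟩

lemma const (c : ℝ) : Controlled X B a 0 (fun _ => c) := of_bounded measurable_const |c| fun _ => le_rfl

lemma const_mul (c : ℝ) (hF : Controlled X B a k F) : Controlled X B a k (fun ω => c * F ω) := by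
  simpa using (const c).mul hF

lemma pow (hF : Controlled X B a k F) (m : ℕ) : Controlled X B a (k * m) (fun ω => F ω ^ m) := by
  obtain ⟨K, hK⟩ := hF.2
  refine ⟨hF.1.pow_const m, K ^ m, fun ω => ?_⟩
  rw [abs_pow, pow_mul, ← mul_pow]
  exact pow_le_pow_left₀ (abs_nonneg _) (hK ω) m

lemma of_le (hF : Measurable F) (hG : Controlled X B a k G) (h : ∀ ω, |F ω| ≤ G ω) :
    Controlled X B a k F := by
  obtain ⟨K, hK⟩ := hG.2
  exact ⟨hF, K, fun ω => (h ω).trans ((le_abs_self _).trans (hK ω))⟩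

lemma sum {ι : Type*} (s : Finset ι) {F : ι → Ω → ℝ} (h : ∀ i ∈ s, Controlled X B a k (F i)) :
    Controlled X B a k (fun ω => ∑ i ∈ s, F i ω) := by
  classical
  induction s using Finset.induction_on with
  | empty => simpa using (const (X := X) (B := B) (a := a) 0).mono (Nat.zero_le k)
  | insert i s hi ih =>
    simp only [Finset.sum_insert hi]
    simpa using (h i (Finset.mem_insert_self i s)).add
      (ih fun j hj => h j (Finset.mem_insert_of_mem hj))

end Controlled

end Controlled

namespace IsLocalSystem

variable {Ω J : Type*} [MeasurableSpace Ω] [Fintype J] {P : Measure Ω}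
  {X : J → Ω → ℝ} {A B : J → Finset J} {a b : ℝ}

lemma a_pos (h : IsLocalSystem P X A B a b) : 0 < a := one_pos.trans_le h.one_le_a

lemma subset (h : IsLocalSystem P X A B a b) (i : J) : A i ⊆ B i := (h.ld2 i).1

lemma measurable_absSum (h : IsLocalSystem P X A B a b) (s : Finset J) :
    Measurable (absSum X s) :=
  Finset.measurable_fun_sum _ fun j _ => (h.meas j).abs

lemma measurable_wt (h : IsLocalSystem P X A B a b) (s : Finset J) : Measurable (wt X a s) :=
  Real.measurable_exp.comp (((h.measurable_absSum s).const_mul a).div_const 16)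

lemma measurable_W (h : IsLocalSystem P X A B a b) : Measurable (W X) :=
  Finset.measurable_fun_sum _ fun j _ => h.meas j

lemma measurable_far (h : IsLocalSystem P X A B a b) (i : J) : Measurable (far X B i) :=
  h.measurable_W.sub (Finset.measurable_fun_sum _ fun j _ => h.meas j)

lemma controlled_wt (h : IsLocalSystem P X A B a b) (i : J) : Controlled X B a 1 (wt X a (B i)) :=
  ⟨h.measurable_wt _, 1, fun ω => by
    rw [abs_of_pos (wt_pos _ _ _ _), pow_one, one_mul]; exact wt_le_envelope X B a i ω⟩

/-- The reduction `eq_zero` is what makes this hold for every `i`: if `i ∉ A i`, the right side need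
not contain the term |X_i|, but then X_i vanishes. -/
lemma abs_le_absSum (h : IsLocalSystem P X A B a b) (i : J) (ω : Ω) :
    |X i ω| ≤ absSum X (A i) ω := by
  by_cases hi : i ∈ A i
  · exact Finset.single_le_sum (f := fun j => |X j ω|) (fun _ _ => abs_nonneg _) hi
  · rw [h.eq_zero i hi ω, abs_zero]
    exact absSum_nonneg _ _ _

lemma absSum_le_wt (h : IsLocalSystem P X A B a b) (s : Finset J) (ω : Ω) :
    absSum X s ω ≤ 16 / a * wt X a s ω := by
  have ha := h.a_pos
  have h1 := Real.add_one_le_exp (a * absSum X s ω / 16)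
  rw [div_mul_eq_mul_div, le_div_iff₀ ha, wt]
  linarith

lemma controlled_absSum (h : IsLocalSystem P X A B a b) (i : J) :
    Controlled X B a 1 (absSum X (B i)) :=
  Controlled.of_le (h.measurable_absSum _) ((h.controlled_wt i).const_mul (16 / a)) fun ω => by
    rw [abs_of_nonneg (absSum_nonneg _ _ _)]
    exact h.absSum_le_wt _ ω

lemma controlled_absSum' (h : IsLocalSystem P X A B a b) (i : J) :
    Controlled X B a 1 (absSum X (A i)) :=
  Controlled.of_le (h.measurable_absSum _) (h.controlled_absSum i) fun ω => by
    rw [abs_of_nonneg (absSum_nonneg _ _ _)]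
    exact absSum_mono X (h.subset i) ω

lemma controlled_wt' (h : IsLocalSystem P X A B a b) (i : J) :
    Controlled X B a 1 (wt X a (A i)) :=
  Controlled.of_le (h.measurable_wt _) (h.controlled_wt i) fun ω => by
    rw [abs_of_pos (wt_pos _ _ _ _)]
    exact wt_mono X h.a_pos.le (h.subset i) ω

lemma controlled_X (h : IsLocalSystem P X A B a b) (i : J) : Controlled X B a 1 (X i) :=
  Controlled.of_le (h.meas i) (h.controlled_absSum' i) (h.abs_le_absSum i)

lemma controlled_W (h : IsLocalSystem P X A B a b) : Controlled X B a 1 (W X) :=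
  Controlled.sum _ fun i _ => h.controlled_X i

lemma memLp_wt (h : IsLocalSystem P X A B a b) (i : J) : MemLp (wt X a (B i)) 16 P := by
  have h1 := (integrable_norm_rpow_iff (p := 16) (f := wt X a (B i)) (μ := P)
    (h.measurable_wt _).aestronglyMeasurable (by norm_num) (by norm_num)).1
  apply h1
  refine (h.integrable_exp i).congr (Filter.Eventually.of_forall fun ω => ?_)
  simp only [ENNReal.toReal_ofNat]
  rw [← wt_pow_sixteen, Real.norm_of_nonneg (wt_pos _ _ _ _).le]
  norm_cast

lemma memLp_envelope [IsProbabilityMeasure P] (h : IsLocalSystem P X A B a b) :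
    MemLp (envelope X B a) 16 P := by
  have h1 : MemLp (fun _ : Ω => (1 : ℝ)) 16 P := memLp_const 1
  exact h1.add (memLp_finsetSum _ fun i _ => h.memLp_wt i)

/-- The envelope lies in L¹⁶, so integrability of any expression below reduces to counting its
degree in the weights; the default argument discharges that count. -/
lemma integrable [IsProbabilityMeasure P] (h : IsLocalSystem P X A B a b) {k : ℕ} {F : Ω → ℝ}
    (hF : Controlled X B a k F) (hk : k ≤ 16 := by norm_num) : Integrable F P := by
  obtain ⟨K, hK⟩ := (hF.mono hk).2
  have h1 : Integrable (fun ω => envelope X B a ω ^ 16) P := by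
    refine ((h.memLp_envelope).integrable_norm_pow (p := 16) (by norm_num)).congr
      (Filter.Eventually.of_forall fun ω => ?_)
    simp only
    rw [Real.norm_of_nonneg (zero_le_one.trans (one_le_envelope X B a ω))]
  exact (h1.const_mul K).mono' hF.1.aestronglyMeasurable (Filter.Eventually.of_forall hK)

lemma indep (h : IsLocalSystem P X A B a b) (i : J) :
    Indep (sig X (A i)) (sig X ((B i : Set J)ᶜ)) P := (h.ld2 i).2

/-- A function of `X_{A_i}` and a function of `X_{B_i^c}` have factorizing expectation. -/
lemma integral_mul (h : IsLocalSystem P X A B a b) (i : J) {F G : Ω → ℝ}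
    (hF : Measurable[sig X (A i)] F) (hG : Measurable[sig X ((B i : Set J)ᶜ)] G) :
    ∫ ω, F ω * G ω ∂P = (∫ ω, F ω ∂P) * ∫ ω, G ω ∂P := by
  have hind : IndepFun F G P := by
    rw [IndepFun_iff_Indep]
    exact indep_of_indep_of_le (h.indep i) hF.comap_le hG.comap_le
  exact hind.integral_fun_mul_eq_mul_integral
    (hF.mono (sig_le h.meas _) le_rfl).aestronglyMeasurable
    (hG.mono (sig_le h.meas _) le_rfl).aestronglyMeasurable

/-- (LD1) alone suffices, since the factor E X_i vanishes. Integrability of `G` plays no role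
because the product formula for independent functions needs only measurability. -/
lemma integral_mul' (h : IsLocalSystem P X A B a b) (i : J) {G : Ω → ℝ}
    (hG : Measurable[sig X ((A i : Set J)ᶜ)] G) : ∫ ω, X i ω * G ω ∂P = 0 := by
  have hind : IndepFun (X i) G P := by
    have h1 := h.ld1 i
    rw [IndepFun_iff_Indep] at h1 ⊢
    exact indep_of_indep_of_le_right h1 hG.comap_le
  rw [hind.integral_fun_mul_eq_mul_integral (h.meas i).aestronglyMeasurable
    (hG.mono (sig_le h.meas _) le_rfl).aestronglyMeasurable, h.mean i, zero_mul]

end IsLocalSystem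

end LocalDep

/-! ### Log-Lipschitz test functions and one-index decoupling -/

namespace LocalDep

/-- Test functions with values in `[1, M]` whose logarithm is `ℓ`-Lipschitz. -/
structure IsTest (ℓ M : ℝ) (g : ℝ → ℝ) : Prop where
  meas : Measurable g
  one_le : ∀ w, 1 ≤ g w
  le : ∀ w, g w ≤ M
  lip : ∀ w v, g (w + v) ≤ Real.exp (ℓ * |v|) * g w

namespace IsTest

variable {ℓ M : ℝ} {g : ℝ → ℝ}

lemma pos (hg : IsTest ℓ M g) (w : ℝ) : 0 < g w := one_pos.trans_le (hg.one_le w)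

lemma one_le_M (hg : IsTest ℓ M g) : 1 ≤ M := (hg.one_le 0).trans (hg.le 0)

lemma lip' (hg : IsTest ℓ M g) (w w' : ℝ) : g w' ≤ Real.exp (ℓ * |w' - w|) * g w := by
  simpa using hg.lip w (w' - w)

/-- Once T > 1/ℓ, the exponent aT/2 exceeds a/(2ℓ), so the crude bound M is charged to the
exponential moment of the local sum at the price of the small factor exp(-a/(2ℓ)). -/
lemma le_exp_tail (hg : IsTest ℓ M g) (hℓ : 0 < ℓ) {a T : ℝ} (ha : 0 ≤ a) (hT : 1 < ℓ * T) :
    M ≤ M * Real.exp (-(a / (2 * ℓ))) * Real.exp (a * T / 2) := by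
  have hM := hg.one_le_M
  rw [mul_assoc, ← Real.exp_add]
  refine le_mul_of_one_le_right (by linarith) (Real.one_le_exp ?_)
  have h1 : a / (2 * ℓ) ≤ a * T / 2 := by
    rw [div_le_div_iff₀ (by positivity) (by norm_num)]
    nlinarith
  linarith

/-- Two regimes: if ℓT ≤ 1 the log-Lipschitz bound costs at most e < 3; otherwise g ≤ M and the tail
term takes over. -/
lemma shift (hg : IsTest ℓ M g) (hℓ : 0 < ℓ) {a T w w' : ℝ} (ha : 0 ≤ a) (h : |w' - w| ≤ T) :
    g w' ≤ 3 * g w + M * Real.exp (-(a / (2 * ℓ))) * Real.exp (a * T / 2) := by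
  have hM := hg.one_le_M
  have hw := hg.pos w
  rcases le_or_gt (ℓ * T) 1 with hT | hT
  · have h1 : Real.exp (ℓ * |w' - w|) ≤ 3 := by
      have : ℓ * |w' - w| ≤ 1 := (mul_le_mul_of_nonneg_left h hℓ.le).trans hT
      exact (Real.exp_le_exp.2 this).trans (by linarith [Real.exp_one_lt_d9])
    have h2 := hg.lip' w w'
    have : 0 ≤ M * Real.exp (-(a / (2 * ℓ))) * Real.exp (a * T / 2) := by positivity
    nlinarith
  · have := hg.le_exp_tail hℓ ha hT
    have := hg.le w'
    linarith

/-- Same two regimes as for `shift`, but the increment keeps the factor ℓT, which provides the gain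
in the variance bound; when ℓT > 1 that factor is harmless. -/
lemma abs_sub_le (hg : IsTest ℓ M g) (hℓ : 0 < ℓ) {a T w w' : ℝ} (ha : 0 ≤ a)
    (h : |w' - w| ≤ T) :
    |g w' - g w| ≤ ℓ * T * (2 * g w + M * Real.exp (-(a / (2 * ℓ))) * Real.exp (a * T / 2)) := by
  have hM := hg.one_le_M
  have hw := hg.pos w
  have hw' := hg.pos w'
  have hT0 : 0 ≤ T := (abs_nonneg _).trans h
  have hη : 0 ≤ M * Real.exp (-(a / (2 * ℓ))) * Real.exp (a * T / 2) := by positivity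
  rcases le_or_gt (ℓ * T) 1 with hT | hT
  · have hlT : 0 ≤ ℓ * T := by positivity
    have h0 : ℓ * |w' - w| ≤ ℓ * T := mul_le_mul_of_nonneg_left h hℓ.le
    have hexp : Real.exp (ℓ * |w' - w|) ≤ 1 + 2 * (ℓ * T) := by
      have h1 := Real.exp_le_exp.2 h0
      have h2 := (abs_le.1 (Real.abs_exp_sub_one_le (x := ℓ * T) (by rwa [abs_of_nonneg hlT]))).2
      rw [abs_of_nonneg hlT] at h2
      linarith
    have hexp' : 1 - ℓ * T ≤ Real.exp (-(ℓ * |w' - w|)) := by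
      have := Real.add_one_le_exp (-(ℓ * |w' - w|))
      linarith
    have h3 := hg.lip' w w'
    have h4 := hg.lip' w' w
    rw [abs_sub_comm] at h4
    have h5 : Real.exp (-(ℓ * |w' - w|)) * g w ≤ g w' := by
      rw [Real.exp_neg, inv_mul_le_iff₀ (Real.exp_pos _)]
      exact h4
    rw [abs_le]
    constructor <;> nlinarith [mul_nonneg hlT hη, mul_nonneg hlT hw.le]
  · have h1 := hg.le_exp_tail hℓ ha hT
    have h2 : |g w' - g w| ≤ M := by
      rw [abs_le]; constructor <;> linarith [hg.le w', hg.le w]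
    nlinarith

end IsTest

/-- Everything is compared with t^m for t = max(1, x, y). This elementary inequality replaces Hölder
for mixed moments of two weights. -/
lemma pow_mul_pow_le_one_add {x y : ℝ} (hx : 0 ≤ x) (hy : 0 ≤ y) {k l m : ℕ} (h : k + l ≤ m) :
    x ^ k * y ^ l ≤ 1 + x ^ m + y ^ m := by
  set t := max 1 (max x y)
  have hxt : x ≤ t := (le_max_left _ _).trans (le_max_right _ _)
  have hyt : y ≤ t := (le_max_right _ _).trans (le_max_right _ _)
  have ht : 1 ≤ t := le_max_left _ _
  have h1 : x ^ k * y ^ l ≤ t ^ m :=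
    calc x ^ k * y ^ l ≤ t ^ k * t ^ l := by gcongr
      _ = t ^ (k + l) := (pow_add _ _ _).symm
      _ ≤ t ^ m := pow_le_pow_right₀ ht h
  have hxm : 0 ≤ x ^ m := by positivity
  have hym : 0 ≤ y ^ m := by positivity
  refine h1.trans ?_
  rcases max_choice 1 (max x y) with h | h <;> rcases max_choice x y with h' | h' <;>
    simp only [t, h, h', one_pow] <;> linarith

lemma exp_half {Ω J : Type*} (X : J → Ω → ℝ) (a : ℝ) (s : Finset J) (ω : Ω) :
    Real.exp (a * absSum X s ω / 2) = wt X a s ω ^ 8 := by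
  rw [wt_pow]; congr 1; push_cast; ring

lemma test_W_le {Ω J : Type*} [Fintype J] {X : J → Ω → ℝ} {B : J → Finset J} {a ℓ M : ℝ}
    {g : ℝ → ℝ} (hg : IsTest ℓ M g) (hℓ : 0 < ℓ) (ha : 0 ≤ a) (i : J) (ω : Ω) :
    g (W X ω) ≤ 3 * g (far X B i ω) + M * Real.exp (-(a / (2 * ℓ))) * wt X a (B i) ω ^ 8 := by
  rw [← exp_half]
  exact hg.shift hℓ ha (W_sub_far X B i ω)

lemma test_far_le {Ω J : Type*} [Fintype J] {X : J → Ω → ℝ} {B : J → Finset J} {a ℓ M : ℝ}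
    {g : ℝ → ℝ} (hg : IsTest ℓ M g) (hℓ : 0 < ℓ) (ha : 0 ≤ a) (i : J) (ω : Ω) :
    g (far X B i ω) ≤ 3 * g (W X ω) + M * Real.exp (-(a / (2 * ℓ))) * wt X a (B i) ω ^ 8 := by
  rw [← exp_half]
  exact hg.shift hℓ ha (by rw [abs_sub_comm]; exact W_sub_far X B i ω)

lemma abs_test_sub_le {Ω J : Type*} [Fintype J] {X : J → Ω → ℝ} {B : J → Finset J} {a ℓ M : ℝ}
    {g : ℝ → ℝ} (hg : IsTest ℓ M g) (hℓ : 0 < ℓ) (ha : 0 ≤ a) (i : J) (ω : Ω) :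
    |g (W X ω) - g (far X B i ω)| ≤ ℓ * absSum X (B i) ω *
      (2 * g (W X ω) + M * Real.exp (-(a / (2 * ℓ))) * wt X a (B i) ω ^ 8) := by
  rw [← exp_half, abs_sub_comm]
  exact hg.abs_sub_le hℓ ha (by rw [abs_sub_comm]; exact W_sub_far X B i ω)

namespace IsLocalSystem

variable {Ω J : Type*} [MeasurableSpace Ω] [Fintype J] {P : Measure Ω}
  {X : J → Ω → ℝ} {A B : J → Finset J} {a b β ℓ M : ℝ} {g : ℝ → ℝ}

/-- Dividing each weight by β = b^{1/16} normalises its sixteenth moment to at most 1; the three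
terms of `pow_mul_pow_le_one_add` then give the factor 3. -/
lemma integral_wt_pow_mul_le [IsProbabilityMeasure P] (h : IsLocalSystem P X A B a b) (hβ : 1 ≤ β) (hb : β ^ 16 = b)
    (i j : J) {k l : ℕ} (hkl : k + l ≤ 16) :
    ∫ ω, wt X a (B i) ω ^ k * wt X a (B j) ω ^ l ∂P ≤ 3 * β ^ (k + l) := by
  have hβ0 : 0 < β := by linarith
  have hint : ∀ i, Integrable (fun ω => Real.exp (a * absSum X (B i) ω)) P := h.integrable_exp
  have hpt : ∀ ω, wt X a (B i) ω ^ k * wt X a (B j) ω ^ l ≤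
      β ^ (k + l) * (1 + b⁻¹ * Real.exp (a * absSum X (B i) ω) +
        b⁻¹ * Real.exp (a * absSum X (B j) ω)) := by
    intro ω
    have h1 := pow_mul_pow_le_one_add (x := wt X a (B i) ω / β) (y := wt X a (B j) ω / β)
      (div_nonneg (wt_pos _ _ _ _).le hβ0.le) (div_nonneg (wt_pos _ _ _ _).le hβ0.le) hkl
    rw [div_pow, div_pow, div_pow, div_pow, hb, wt_pow_sixteen, wt_pow_sixteen,
      div_mul_div_comm, ← pow_add, div_le_iff₀ (by positivity)] at h1
    refine h1.trans (le_of_eq ?_)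
    ring
  have hi := ((hint i).const_mul b⁻¹)
  have hj := ((hint j).const_mul b⁻¹)
  have hb0 : 0 < b := by linarith [h.one_le_b]
  calc ∫ ω, wt X a (B i) ω ^ k * wt X a (B j) ω ^ l ∂P
      ≤ ∫ ω, β ^ (k + l) * (1 + b⁻¹ * Real.exp (a * absSum X (B i) ω) +
        b⁻¹ * Real.exp (a * absSum X (B j) ω)) ∂P := by
        refine integral_mono (h.integrable (((h.controlled_wt i).pow k).mul
          ((h.controlled_wt j).pow l)) (by omega)) ?_ hpt
        exact ((((integrable_const 1).add hi).add hj).const_mul _)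
    _ = β ^ (k + l) * (1 + b⁻¹ * ∫ ω, Real.exp (a * absSum X (B i) ω) ∂P +
        b⁻¹ * ∫ ω, Real.exp (a * absSum X (B j) ω) ∂P) := by
        have h1 : Integrable (fun ω => 1 + b⁻¹ * Real.exp (a * absSum X (B i) ω)) P :=
          (integrable_const 1).add hi
        rw [integral_const_mul, integral_add h1 hj, integral_add (integrable_const 1) hi,
          integral_const_mul, integral_const_mul]
        simp
    _ ≤ β ^ (k + l) * (1 + b⁻¹ * b + b⁻¹ * b) := by
        gcongr
        exacts [h.integral_exp_le i, h.integral_exp_le j]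
    _ = 3 * β ^ (k + l) := by
        rw [inv_mul_cancel₀ hb0.ne']; ring

lemma integral_wt_pow_le [IsProbabilityMeasure P] (h : IsLocalSystem P X A B a b) (hβ : 1 ≤ β) (hb : β ^ 16 = b)
    (i : J) {k : ℕ} (hk : k ≤ 16) : ∫ ω, wt X a (B i) ω ^ k ∂P ≤ 3 * β ^ k := by
  simpa using h.integral_wt_pow_mul_le hβ hb i i (k := k) (l := 0) (by omega)

lemma controlled_test (h : IsLocalSystem P X A B a b) (hg : IsTest ℓ M g) :
    Controlled X B a 0 (fun ω => g (W X ω)) :=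
  Controlled.of_bounded (hg.meas.comp h.measurable_W) M fun ω => by
    rw [abs_of_pos (hg.pos _)]; exact hg.le _

lemma controlled_test_far (h : IsLocalSystem P X A B a b) (hg : IsTest ℓ M g) (i : J) :
    Controlled X B a 0 (fun ω => g (far X B i ω)) :=
  Controlled.of_bounded (hg.meas.comp (h.measurable_far i)) M fun ω => by
    rw [abs_of_pos (hg.pos _)]; exact hg.le _

/-- The lower bound g ≥ 1 is imposed for this: tail terms carry no factor g(W), and they are
absorbed by multiplying them by E g(W). -/
lemma one_le_integral_test [IsProbabilityMeasure P] (h : IsLocalSystem P X A B a b) (hg : IsTest ℓ M g) :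
    1 ≤ ∫ ω, g (W X ω) ∂P := by
  have := integral_mono (μ := P) (integrable_const (1 : ℝ)) (h.integrable (h.controlled_test hg))
    (fun ω => hg.one_le (W X ω))
  simpa using this

/-- Decoupling of a nonnegative local weight from a test function of `W`. -/
lemma integral_mul_test_le [IsProbabilityMeasure P] (h : IsLocalSystem P X A B a b) (hβ : 1 ≤ β) (hb : β ^ 16 = b)
    (hg : IsTest ℓ M g) (hℓ : 0 < ℓ) (hη : M * Real.exp (-(a / (2 * ℓ))) ≤ 1)
    (i : J) {p : Ω → ℝ} {D : ℝ} (hp : Measurable[sig X (A i)] p) (hp0 : ∀ ω, 0 ≤ p ω)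
    (hpD : ∀ ω, p ω ≤ D * wt X a (B i) ω ^ 4) :
    ∫ ω, p ω * g (W X ω) ∂P ≤ 57 * D * β ^ 12 * ∫ ω, g (W X ω) ∂P := by
  set η := M * Real.exp (-(a / (2 * ℓ))) with hηdef
  have hη0 : 0 ≤ η := by have := hg.one_le_M; positivity
  have hG := h.one_le_integral_test hg
  set G := ∫ ω, g (W X ω) ∂P
  have ha := h.a_pos.le
  have hpm : Measurable p := hp.mono (sig_le h.meas _) le_rfl
  have he := h.controlled_wt i
  have hpc : Controlled X B a 4 p := Controlled.of_le hpm ((he.pow 4).const_mul D)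
    fun ω => by rw [abs_of_nonneg (hp0 ω)]; exact hpD ω
  have hgW := h.controlled_test hg
  have hgV := h.controlled_test_far hg i
  have hne : Nonempty Ω := nonempty_of_isProbabilityMeasure P
  have hD : 0 ≤ D := by
    obtain ⟨ω⟩ := hne
    have h1 := (hp0 ω).trans (hpD ω)
    exact nonneg_of_mul_nonneg_left h1 (pow_pos (wt_pos _ _ _ _) 4)
  have hβ0 : 0 ≤ β := by linarith
  have hEp : ∫ ω, p ω ∂P ≤ D * (3 * β ^ 4) :=
    calc ∫ ω, p ω ∂P ≤ ∫ ω, D * wt X a (B i) ω ^ 4 ∂P :=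
          integral_mono (h.integrable hpc) (h.integrable ((he.pow 4).const_mul D)) hpD
      _ = D * ∫ ω, wt X a (B i) ω ^ 4 ∂P := integral_const_mul _ _
      _ ≤ _ := by gcongr; exact h.integral_wt_pow_le hβ hb i (by norm_num)
  have hEp0 : 0 ≤ ∫ ω, p ω ∂P := integral_nonneg hp0
  have hEV : ∫ ω, g (far X B i ω) ∂P ≤ 3 * G + η * (3 * β ^ 8) :=
    calc ∫ ω, g (far X B i ω) ∂P
        ≤ ∫ ω, (3 * g (W X ω) + η * wt X a (B i) ω ^ 8) ∂P :=
          integral_mono (h.integrable hgV)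
            (h.integrable ((hgW.const_mul 3).add ((he.pow 8).const_mul η)))
            (fun ω => test_far_le hg hℓ ha i ω)
      _ = 3 * G + η * ∫ ω, wt X a (B i) ω ^ 8 ∂P := by
          rw [integral_add (h.integrable (hgW.const_mul 3))
            (h.integrable ((he.pow 8).const_mul η)), integral_const_mul, integral_const_mul]
      _ ≤ _ := by gcongr; exact h.integral_wt_pow_le hβ hb i (by norm_num)
  -- W is replaced by its part outside B_i, after which (LD2) factorises the expectation; `hEV` then
  -- returns from the far part to W.
  have hmain : ∫ ω, p ω * g (W X ω) ∂P ≤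
      3 * ((∫ ω, p ω ∂P) * ∫ ω, g (far X B i ω) ∂P) + η * (D * (3 * β ^ 12)) :=
    calc ∫ ω, p ω * g (W X ω) ∂P
        ≤ ∫ ω, (3 * (p ω * g (far X B i ω)) + η * (D * wt X a (B i) ω ^ 12)) ∂P := by
          refine integral_mono (h.integrable (hpc.mul hgW))
            (h.integrable (((hpc.mul hgV).const_mul 3).add
              (((he.pow 12).const_mul D).const_mul η))) fun ω => ?_
          have h1 := mul_le_mul_of_nonneg_left (test_W_le (X := X) (B := B) hg hℓ ha i ω) (hp0 ω)
          have h2 : p ω * (η * wt X a (B i) ω ^ 8) ≤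
              D * wt X a (B i) ω ^ 4 * (η * wt X a (B i) ω ^ 8) := by
            have := (wt_pos X a (B i) ω).le
            gcongr
            exact hpD ω
          simp only
          calc p ω * g (W X ω) ≤ _ := h1
            _ = 3 * (p ω * g (far X B i ω)) + p ω * (η * wt X a (B i) ω ^ 8) := by ring
            _ ≤ 3 * (p ω * g (far X B i ω)) + D * wt X a (B i) ω ^ 4 * (η * wt X a (B i) ω ^ 8) := by
                linarith
            _ = _ := by ring
      _ = 3 * (∫ ω, p ω * g (far X B i ω) ∂P) + η * (D * ∫ ω, wt X a (B i) ω ^ 12 ∂P) := by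
          rw [integral_add (h.integrable ((hpc.mul hgV).const_mul 3))
            (h.integrable (((he.pow 12).const_mul D).const_mul η)), integral_const_mul,
            integral_const_mul, integral_const_mul]
      _ ≤ _ := by
          have h1 := h.integral_mul i hp (hg.meas.comp (far_measurable_sig X B i))
          simp only [Function.comp_apply] at h1
          rw [h1]
          gcongr
          exact h.integral_wt_pow_le hβ hb i (by norm_num)
  have hV0 : 0 ≤ ∫ ω, g (far X B i ω) ∂P := integral_nonneg fun ω => (hg.pos _).le
  calc ∫ ω, p ω * g (W X ω) ∂P ≤ _ := hmain
    _ ≤ 3 * ((D * (3 * β ^ 4)) * (3 * G + η * (3 * β ^ 8))) + η * (D * (3 * β ^ 12)) := by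
        gcongr
    -- All terms are raised to the common size D β¹² G using η ≤ 1 and G ≥ 1; the constant is 3 · 3
    -- · (3 + 3) + 3 = 57.
    _ ≤ 3 * ((D * (3 * β ^ 4)) * (3 * (β ^ 8 * G) + 1 * (3 * (β ^ 8 * G)))) +
        1 * (D * (3 * (β ^ 12 * G))) := by
        gcongr
        · exact le_mul_of_one_le_left (by linarith) (one_le_pow₀ hβ)
        · exact le_mul_of_one_le_right (by positivity) hG
        · exact le_mul_of_one_le_right (by positivity) hG
    _ = _ := by ring

end IsLocalSystem

end LocalDep

/-! ### Two-index decoupling -/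

namespace LocalDep

namespace IsLocalSystem

variable {Ω J : Type*} [MeasurableSpace Ω] [Fintype J] {P : Measure Ω}
  {X : J → Ω → ℝ} {A B : J → Finset J} {a b β ℓ M : ℝ} {g : ℝ → ℝ}

/-- For j outside N_i the sets B_i and B_j are disjoint, and A_j ⊆ B_j, so A_j avoids B_i. -/
lemma sig_le_of_notMem (h : IsLocalSystem P X A B a b) {i j : J} (hij : j ∉ N B i) :
    sig X (A j) ≤ sig X ((B i : Set J)ᶜ) := by
  classical
  refine sig_mono X fun k hk hki => hij ?_
  simp only [N, Finset.mem_filter, Finset.mem_univ, true_and]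
  exact ⟨k, by simpa using ⟨hki, h.subset j hk⟩⟩

/-- An index j ∈ B_i need not belong to B_j, so B_i ⊆ N_i can fail. It fails only where j ∉ A_j, and
there X_j = 0. Hence κ, which counts N_i, also controls sums over B_i. -/
lemma absSum_le_absSum_N (h : IsLocalSystem P X A B a b) (i : J) (ω : Ω) :
    absSum X (B i) ω ≤ absSum X (N B i) ω := by
  classical
  unfold absSum
  rw [← Finset.sum_filter_add_sum_filter_not (B i) (fun j => j ∈ A j)]
  have h0 : ∑ j ∈ (B i).filter (fun j => ¬ j ∈ A j), |X j ω| = 0 :=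
    Finset.sum_eq_zero fun j hj => by
      rw [h.eq_zero j (Finset.mem_filter.1 hj).2 ω, abs_zero]
  rw [h0, add_zero]
  refine Finset.sum_le_sum_of_subset_of_nonneg (fun j hj => ?_) fun _ _ _ => abs_nonneg _
  obtain ⟨h1, h2⟩ := Finset.mem_filter.1 hj
  simp only [N, Finset.mem_filter, Finset.mem_univ, true_and]
  exact ⟨j, by simpa using ⟨h1, h.subset j h2⟩⟩

/-- For neighbours, ρ_i ρ_j ≤ ρ_i² + ρ_j² reduces to one index. Otherwise ρ_j and the far part of W
are both functions of X_{B_i^c}, so ρ_i splits off by (LD2), and ρ_j is then decoupled from g(W) in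
turn. -/
lemma integral_mul_mul_test_le [IsProbabilityMeasure P] (h : IsLocalSystem P X A B a b)
    (hβ : 1 ≤ β) (hb : β ^ 16 = b)
    (hg : IsTest ℓ M g) (hℓ : 0 < ℓ) (hη : M * Real.exp (-(a / (2 * ℓ))) ≤ 1)
    {ρ : J → Ω → ℝ} {D : ℝ} (hD : 0 ≤ D) (hρ : ∀ i, Measurable[sig X (A i)] (ρ i))
    (hρ0 : ∀ i ω, 0 ≤ ρ i ω) (hρD : ∀ i ω, ρ i ω ≤ D * wt X a (B i) ω ^ 2) (i j : J) :
    ∫ ω, ρ i ω * ρ j ω * g (W X ω) ∂P ≤ 1600 * D ^ 2 * β ^ 14 * ∫ ω, g (W X ω) ∂P := by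
  have hG := h.one_le_integral_test hg
  have hβ0 : 0 ≤ β := by linarith
  have ha := h.a_pos.le
  have he := h.controlled_wt
  have hgW := h.controlled_test hg
  have hρm : ∀ i, Measurable (ρ i) := fun i => (hρ i).mono (sig_le h.meas _) le_rfl
  have hρc : ∀ i, Controlled X B a 2 (ρ i) := fun i =>
    Controlled.of_le (hρm i) (((he i).pow 2).const_mul D) fun ω => by
      rw [abs_of_nonneg (hρ0 i ω)]; exact hρD i ω
  by_cases hij : j ∈ N B i
  · have hsq : ∀ i, ∫ ω, ρ i ω ^ 2 * g (W X ω) ∂P ≤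
        57 * D ^ 2 * β ^ 12 * ∫ ω, g (W X ω) ∂P := fun i => by
      refine h.integral_mul_test_le hβ hb hg hℓ hη i ((hρ i).pow_const 2)
        (fun ω => sq_nonneg _) fun ω => ?_
      calc ρ i ω ^ 2 ≤ (D * wt X a (B i) ω ^ 2) ^ 2 := pow_le_pow_left₀ (hρ0 i ω) (hρD i ω) 2
        _ = _ := by ring
    calc ∫ ω, ρ i ω * ρ j ω * g (W X ω) ∂P
        ≤ ∫ ω, (ρ i ω ^ 2 * g (W X ω) + ρ j ω ^ 2 * g (W X ω)) ∂P := by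
          refine integral_mono (h.integrable (((hρc i).mul (hρc j)).mul hgW))
            (h.integrable ((((hρc i).pow 2).mul hgW).add (((hρc j).pow 2).mul hgW))) fun ω => ?_
          simp only
          rw [← add_mul]
          gcongr
          · exact (hg.pos _).le
          · nlinarith [sq_nonneg (ρ i ω - ρ j ω), hρ0 i ω, hρ0 j ω]
      _ = ∫ ω, ρ i ω ^ 2 * g (W X ω) ∂P + ∫ ω, ρ j ω ^ 2 * g (W X ω) ∂P :=
          integral_add (h.integrable (((hρc i).pow 2).mul hgW))
            (h.integrable (((hρc j).pow 2).mul hgW))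
      _ ≤ 114 * D ^ 2 * β ^ 12 * ∫ ω, g (W X ω) ∂P := by linarith [hsq i, hsq j]
      _ ≤ _ := by gcongr <;> norm_num
  · have hgV := h.controlled_test_far hg i
    set η := M * Real.exp (-(a / (2 * ℓ))) with hηdef
    have hη0 : 0 ≤ η := by have := hg.one_le_M; positivity
    set G := ∫ ω, g (W X ω) ∂P
    have hE : ∫ ω, ρ i ω ∂P ≤ D * (3 * β ^ 2) :=
      calc ∫ ω, ρ i ω ∂P ≤ ∫ ω, D * wt X a (B i) ω ^ 2 ∂P :=
            integral_mono (h.integrable (hρc i)) (h.integrable (((he i).pow 2).const_mul D))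
              (hρD i)
        _ = D * ∫ ω, wt X a (B i) ω ^ 2 ∂P := integral_const_mul _ _
        _ ≤ _ := by gcongr; exact h.integral_wt_pow_le hβ hb i (by norm_num)
    have h1 : ∫ ω, ρ j ω * g (W X ω) ∂P ≤ 57 * D * β ^ 12 * G :=
      h.integral_mul_test_le hβ hb hg hℓ hη j (hρ j) (hρ0 j) fun ω => (hρD j ω).trans (by
        have := one_le_wt X ha (B j) ω
        gcongr; norm_num)
    have h2 : ∫ ω, ρ j ω * g (far X B i ω) ∂P ≤ 3 * (57 * D * β ^ 12 * G) +
        η * (D * (3 * β ^ (2 + 8))) :=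
      calc ∫ ω, ρ j ω * g (far X B i ω) ∂P
          ≤ ∫ ω, (3 * (ρ j ω * g (W X ω)) +
            η * (D * (wt X a (B j) ω ^ 2 * wt X a (B i) ω ^ 8))) ∂P := by
            refine integral_mono (h.integrable ((hρc j).mul hgV)) (h.integrable
              ((((hρc j).mul hgW).const_mul 3).add
              (((((he j).pow 2).mul ((he i).pow 8)).const_mul D).const_mul η))) fun ω => ?_
            have h3 := mul_le_mul_of_nonneg_left
              (test_far_le (X := X) (B := B) hg hℓ ha i ω) (hρ0 j ω)
            have h4 : ρ j ω * (η * wt X a (B i) ω ^ 8) ≤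
                D * wt X a (B j) ω ^ 2 * (η * wt X a (B i) ω ^ 8) := by
              have := (wt_pos X a (B i) ω).le
              gcongr
              exact hρD j ω
            simp only
            rw [← hηdef] at h3
            linarith
        _ = 3 * (∫ ω, ρ j ω * g (W X ω) ∂P) +
            η * (D * ∫ ω, wt X a (B j) ω ^ 2 * wt X a (B i) ω ^ 8 ∂P) := by
            rw [integral_add (h.integrable (((hρc j).mul hgW).const_mul 3)) (h.integrable
              (((((he j).pow 2).mul ((he i).pow 8)).const_mul D).const_mul η)),
              integral_const_mul, integral_const_mul, integral_const_mul]
        _ ≤ _ := by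
            gcongr
            exact h.integral_wt_pow_mul_le hβ hb j i (by norm_num)
    have hm2 : Measurable[sig X ((B i : Set J)ᶜ)] (fun ω => ρ j ω * g (far X B i ω)) :=
      ((hρ j).mono (h.sig_le_of_notMem hij) le_rfl).mul
        (hg.meas.comp (far_measurable_sig X B i))
    have h3 : ∫ ω, ρ i ω * ρ j ω * g (W X ω) ∂P ≤
        3 * ((∫ ω, ρ i ω ∂P) * ∫ ω, ρ j ω * g (far X B i ω) ∂P) +
          η * (D ^ 2 * (3 * β ^ (10 + 2))) :=
      calc ∫ ω, ρ i ω * ρ j ω * g (W X ω) ∂P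
          ≤ ∫ ω, (3 * (ρ i ω * (ρ j ω * g (far X B i ω))) +
            η * (D ^ 2 * (wt X a (B i) ω ^ 10 * wt X a (B j) ω ^ 2))) ∂P := by
            refine integral_mono (h.integrable (((hρc i).mul (hρc j)).mul hgW)) (h.integrable
              ((((hρc i).mul ((hρc j).mul hgV)).const_mul 3).add
              (((((he i).pow 10).mul ((he j).pow 2)).const_mul (D ^ 2)).const_mul η))) fun ω => ?_
            have h3 := mul_le_mul_of_nonneg_left
              (test_W_le (X := X) (B := B) hg hℓ ha i ω) (mul_nonneg (hρ0 i ω) (hρ0 j ω))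
            have h4 : ρ i ω * ρ j ω * (η * wt X a (B i) ω ^ 8) ≤
                (D * wt X a (B i) ω ^ 2) * (D * wt X a (B j) ω ^ 2) *
                  (η * wt X a (B i) ω ^ 8) := by
              have := (wt_pos X a (B i) ω).le
              gcongr
              exacts [hρ0 j ω, hρD i ω, hρD j ω]
            simp only
            rw [← hηdef] at h3
            linarith
        _ = 3 * (∫ ω, ρ i ω * (ρ j ω * g (far X B i ω)) ∂P) +
            η * (D ^ 2 * ∫ ω, wt X a (B i) ω ^ 10 * wt X a (B j) ω ^ 2 ∂P) := by
            rw [integral_add (h.integrable (((hρc i).mul ((hρc j).mul hgV)).const_mul 3))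
              (h.integrable
              (((((he i).pow 10).mul ((he j).pow 2)).const_mul (D ^ 2)).const_mul η)),
              integral_const_mul, integral_const_mul, integral_const_mul]
        _ ≤ _ := by
            rw [h.integral_mul i (hρ i) hm2]
            gcongr
            exact h.integral_wt_pow_mul_le hβ hb i j (by norm_num)
    have hV0 : 0 ≤ ∫ ω, ρ j ω * g (far X B i ω) ∂P :=
      integral_nonneg fun ω => mul_nonneg (hρ0 j ω) (hg.pos _).le
    calc ∫ ω, ρ i ω * ρ j ω * g (W X ω) ∂P ≤ _ := h3
      _ ≤ 3 * ((D * (3 * β ^ 2)) * (3 * (57 * D * β ^ 12 * G) + 1 * (D * (3 * (β ^ 12 * G))))) +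
          1 * (D ^ 2 * (3 * (β ^ 14 * G))) := by
          have hx : β ^ (2 + 8) ≤ β ^ 12 * G :=
            (pow_le_pow_right₀ hβ (by norm_num)).trans
              (le_mul_of_one_le_right (by positivity) hG)
          have hy : β ^ (10 + 2) ≤ β ^ 14 * G :=
            (pow_le_pow_right₀ hβ (by norm_num)).trans
              (le_mul_of_one_le_right (by positivity) hG)
          gcongr
          refine h2.trans ?_
          gcongr
      _ = 1569 * (D ^ 2 * β ^ 14 * G) := by ring
      _ ≤ 1600 * (D ^ 2 * β ^ 14 * G) := by
          have : 0 ≤ D ^ 2 * β ^ 14 * G := by positivity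
          linarith
      _ = _ := by ring

lemma integral_sum_sq_mul_test_le [IsProbabilityMeasure P] (h : IsLocalSystem P X A B a b)
    (hβ : 1 ≤ β) (hb : β ^ 16 = b)
    (hg : IsTest ℓ M g) (hℓ : 0 < ℓ) (hη : M * Real.exp (-(a / (2 * ℓ))) ≤ 1)
    {ρ : J → Ω → ℝ} {D : ℝ} (hD : 0 ≤ D) (hρ : ∀ i, Measurable[sig X (A i)] (ρ i))
    (hρ0 : ∀ i ω, 0 ≤ ρ i ω) (hρD : ∀ i ω, ρ i ω ≤ D * wt X a (B i) ω ^ 2) :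
    ∫ ω, (∑ i, ρ i ω) ^ 2 * g (W X ω) ∂P ≤
      1600 * D ^ 2 * β ^ 14 * (Fintype.card J : ℝ) ^ 2 * ∫ ω, g (W X ω) ∂P := by
  have he := h.controlled_wt
  have hgW := h.controlled_test hg
  have hρc : ∀ i, Controlled X B a 2 (ρ i) := fun i =>
    Controlled.of_le ((hρ i).mono (sig_le h.meas _) le_rfl) (((he i).pow 2).const_mul D)
      fun ω => by rw [abs_of_nonneg (hρ0 i ω)]; exact hρD i ω
  have h1 : ∀ ω, (∑ i, ρ i ω) ^ 2 * g (W X ω) = ∑ i, ∑ j, ρ i ω * ρ j ω * g (W X ω) := fun ω => by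
    rw [sq, Finset.sum_mul_sum, Finset.sum_mul]
    exact Finset.sum_congr rfl fun i _ => Finset.sum_mul _ _ _
  simp only [h1]
  have hint : ∀ i j, Integrable (fun ω => ρ i ω * ρ j ω * g (W X ω)) P := fun i j =>
    h.integrable (((hρc i).mul (hρc j)).mul hgW)
  rw [integral_finsetSum _ fun i _ => integrable_finsetSum _ fun j _ => hint i j]
  simp only [integral_finsetSum _ fun j _ => hint _ j]
  calc ∑ i, ∑ j, ∫ ω, ρ i ω * ρ j ω * g (W X ω) ∂P
      ≤ ∑ _i : J, ∑ _j : J, 1600 * D ^ 2 * β ^ 14 * ∫ ω, g (W X ω) ∂P :=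
        Finset.sum_le_sum fun i _ => Finset.sum_le_sum fun j _ =>
          h.integral_mul_mul_test_le hβ hb hg hℓ hη hD hρ hρ0 hρD i j
    _ = _ := by
        simp only [Finset.sum_const, Finset.card_univ, nsmul_eq_mul]
        ring

end IsLocalSystem

end LocalDep

/-! ### Variance bound under a test-function weight -/

namespace LocalDep

lemma mem_N_comm {J : Type*} [Fintype J] {B : J → Finset J} {i j : J} :
    j ∈ N B i ↔ i ∈ N B j := by
  classical
  simp [N, Finset.inter_comm]

lemma card_N_le {J : Type*} [Fintype J] (B : J → Finset J) (i : J) :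
    ((N B i).card : ℝ) ≤ kappa B := by
  exact_mod_cast Finset.le_sup (f := fun i => (N B i).card) (Finset.mem_univ i)

namespace IsLocalSystem

variable {Ω J : Type*} [MeasurableSpace Ω] [Fintype J] {P : Measure Ω}
  {X : J → Ω → ℝ} {A B : J → Finset J} {a b β ℓ M : ℝ} {g : ℝ → ℝ}

lemma measurable_X_sig (h : IsLocalSystem P X A B a b) (i : J) :
    Measurable[sig X (A i)] (X i) := by
  by_cases hi : i ∈ A i
  · exact measurable_sig X hi
  · rw [show X i = fun _ => 0 from funext (h.eq_zero i hi)]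
    exact measurable_const

/-- By AM-GM, a |c_i| |X_j| ≤ (c_i² + a² X_j²)/2 for j ∈ N_i. The relation j ∈ N_i is symmetric, so
in the double sum each index occurs at most κ times in either role, and a single sum remains. -/
lemma sum_mul_absSum_le (h : IsLocalSystem P X A B a b) (c : J → ℝ) (ω : Ω) :
    ∑ i, |c i| * absSum X (B i) ω ≤
      kappa B / a * ∑ i, (c i ^ 2 + a ^ 2 * X i ω ^ 2) / 2 := by
  have ha := h.a_pos
  have h1 : ∀ i, a * (|c i| * absSum X (B i) ω) ≤
      ∑ j ∈ N B i, (c i ^ 2 / 2 + a ^ 2 * X j ω ^ 2 / 2) := fun i => by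
    calc a * (|c i| * absSum X (B i) ω) ≤ a * (|c i| * absSum X (N B i) ω) := by
          gcongr
          exact h.absSum_le_absSum_N i ω
      _ = ∑ j ∈ N B i, a * (|c i| * |X j ω|) := by
          rw [absSum, Finset.mul_sum, Finset.mul_sum]
      _ ≤ _ := Finset.sum_le_sum fun j _ => by
          have := sq_nonneg (|c i| - a * |X j ω|)
          nlinarith [sq_abs (c i), sq_abs (X j ω)]
  have h2 : ∑ i, ∑ j ∈ N B i, (c i ^ 2 / 2 + a ^ 2 * X j ω ^ 2 / 2) ≤
      (kappa B : ℝ) * ∑ i, (c i ^ 2 + a ^ 2 * X i ω ^ 2) / 2 := by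
    simp only [Finset.sum_add_distrib]
    rw [Finset.sum_comm' (s' := fun j => N B j) (t' := Finset.univ)
      (f := fun _ j => a ^ 2 * X j ω ^ 2 / 2) (by simp [mem_N_comm])]
    simp only [Finset.sum_const, nsmul_eq_mul, add_div, Finset.sum_add_distrib, mul_add,
      Finset.mul_sum]
    refine add_le_add (Finset.sum_le_sum fun i _ => ?_) (Finset.sum_le_sum fun i _ => ?_) <;>
    · have := card_N_le B i
      gcongr
  rw [div_mul_eq_mul_div, le_div_iff₀ ha, mul_comm, Finset.mul_sum]
  exact (Finset.sum_le_sum fun i _ => h1 i).trans h2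

lemma integral_mul_far_eq_zero (h : IsLocalSystem P X A B a b) (hg : IsTest ℓ M g)
    {c : J → Ω → ℝ} (hc : ∀ i, Measurable[sig X (A i)] (c i)) (hc0 : ∀ i, ∫ ω, c i ω ∂P = 0)
    (i : J) {s : Finset J} (hs : ∀ j ∈ s, j ∉ N B i) :
    ∫ ω, c i ω * ((∑ j ∈ s, c j ω) * g (far X B i ω)) ∂P = 0 := by
  have hm : Measurable[sig X ((B i : Set J)ᶜ)] (fun ω => (∑ j ∈ s, c j ω) * g (far X B i ω)) := by
    refine Measurable.mul (Finset.measurable_fun_sum _ fun j hj => ?_)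
      (hg.meas.comp (far_measurable_sig X B i))
    exact (hc j).mono (h.sig_le_of_notMem (hs j hj)) le_rfl
  rw [h.integral_mul i (hc i) hm, hc0 i, zero_mul]

/-- Pointwise domination behind the weighted variance bound. -/
lemma sq_sum_mul_test_le (h : IsLocalSystem P X A B a b) [DecidableEq J]
    (hβ : 1 ≤ β) (hg : IsTest ℓ M g) (hℓ : 0 < ℓ) {c : J → Ω → ℝ}
    (hcβ : ∀ i ω, |c i ω| ≤ 4 * β * wt X a (B i) ω) (ω : Ω) :
    (∑ i, c i ω) ^ 2 * g (W X ω) ≤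
      2 * (∑ i, c i ω * ((∑ j ∈ (N B i)ᶜ, c j ω) * g (far X B i ω))) +
      4 * ℓ ^ 2 * (kappa B / a) ^ 2 *
        ((∑ i, (c i ω ^ 2 + a ^ 2 * X i ω ^ 2) / 2) ^ 2 * g (W X ω)) +
      512 * β ^ 2 * (M * Real.exp (-(a / (2 * ℓ)))) * ℓ / a *
        (∑ i, ∑ j, wt X a (B i) ω ^ 10 * wt X a (B j) ω ^ 1) +
      ∑ i, ∑ j ∈ N B i, (3 * (c i ω ^ 2 * g (W X ω)) + 3 * (c j ω ^ 2 * g (W X ω)) +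
        32 * β ^ 2 * (M * Real.exp (-(a / (2 * ℓ)))) *
          (wt X a (B i) ω ^ 9 * wt X a (B j) ω ^ 1)) := by
  set η := M * Real.exp (-(a / (2 * ℓ))) with hηdef
  have hη0 : 0 ≤ η := by have := hg.one_le_M; positivity
  have ha := h.a_pos
  have hg0 := (hg.pos (W X ω)).le
  set Ξ := ∑ i, c i ω with hΞ
  set e : J → ℝ := fun i => wt X a (B i) ω with he
  have he0 : ∀ i, 0 < e i := fun i => wt_pos _ _ _ _
  -- Three parts: pairs with j ∉ N_i tested at the far part, which have mean zero; the error of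
  -- replacing g(W) by g at the far part; and neighbouring pairs.
  have hsplit : Ξ ^ 2 * g (W X ω) =
      (∑ i, c i ω * ((∑ j ∈ (N B i)ᶜ, c j ω) * g (far X B i ω))) +
      (∑ i, c i ω * Ξ * (g (W X ω) - g (far X B i ω))) +
      ∑ i, ∑ j ∈ N B i, c i ω * c j ω * g (far X B i ω) := by
    rw [← Finset.sum_add_distrib, ← Finset.sum_add_distrib, sq, hΞ, Finset.sum_mul, Finset.sum_mul]
    refine Finset.sum_congr rfl fun i _ => ?_
    rw [← hΞ]
    have h1 : ∑ j ∈ N B i, c i ω * c j ω * g (far X B i ω) =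
        c i ω * ((∑ j ∈ N B i, c j ω) * g (far X B i ω)) := by
      rw [Finset.sum_mul, Finset.mul_sum]
      exact Finset.sum_congr rfl fun j _ => by ring
    have h2 : Ξ = ∑ j ∈ N B i, c j ω + ∑ j ∈ (N B i)ᶜ, c j ω :=
      (Finset.sum_add_sum_compl _ _).symm
    rw [h1]
    linear_combination (c i ω * g (far X B i ω)) * h2
  have hnear : ∑ i, ∑ j ∈ N B i, c i ω * c j ω * g (far X B i ω) ≤
      ∑ i, ∑ j ∈ N B i, (3 / 2 * (c i ω ^ 2 * g (W X ω)) + 3 / 2 * (c j ω ^ 2 * g (W X ω)) +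
        16 * β ^ 2 * η * (e i ^ 9 * e j ^ 1)) := by
    refine Finset.sum_le_sum fun i _ => Finset.sum_le_sum fun j _ => ?_
    have h1 := test_far_le (X := X) (B := B) hg hℓ ha.le i ω
    have hgf := (hg.pos (far X B i ω)).le
    have h2 : c i ω * c j ω ≤ |c i ω| * |c j ω| := by
      rw [← abs_mul]; exact le_abs_self _
    calc c i ω * c j ω * g (far X B i ω)
        ≤ |c i ω| * |c j ω| * (3 * g (W X ω) + η * e i ^ 8) := by gcongr
      _ = 3 * (|c i ω| * |c j ω|) * g (W X ω) + |c i ω| * |c j ω| * (η * e i ^ 8) := by ring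
      _ ≤ 3 * ((c i ω ^ 2 + c j ω ^ 2) / 2) * g (W X ω) +
          (4 * β * e i) * (4 * β * e j) * (η * e i ^ 8) := by
          have h3 : |c i ω| * |c j ω| ≤ (c i ω ^ 2 + c j ω ^ 2) / 2 := by
            nlinarith [sq_nonneg (|c i ω| - |c j ω|), sq_abs (c i ω), sq_abs (c j ω)]
          have := he0 i
          gcongr
          exacts [hcβ i ω, hcβ j ω]
      _ = _ := by ring
  -- AM-GM produces half of Ξ² g(W) on the right. It is absorbed into the left side at the end,
  -- which doubles all the other constants.
  have hmid : ∑ i, c i ω * Ξ * (g (W X ω) - g (far X B i ω)) ≤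
      1 / 2 * (Ξ ^ 2 * g (W X ω)) + 2 * ℓ ^ 2 * (kappa B / a) ^ 2 *
        ((∑ i, (c i ω ^ 2 + a ^ 2 * X i ω ^ 2) / 2) ^ 2 * g (W X ω)) +
      256 * β ^ 2 * η * ℓ / a * (∑ i, ∑ j, e i ^ 10 * e j ^ 1) := by
    have h1 : ∑ i, c i ω * Ξ * (g (W X ω) - g (far X B i ω)) ≤
        ∑ i, |c i ω| * |Ξ| * (ℓ * absSum X (B i) ω * (2 * g (W X ω) + η * e i ^ 8)) := by
      refine Finset.sum_le_sum fun i _ => (le_abs_self _).trans ?_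
      rw [abs_mul, abs_mul]
      gcongr
      exact abs_test_sub_le hg hℓ ha.le i ω
    have h2 : ∑ i, |c i ω| * |Ξ| * (ℓ * absSum X (B i) ω * (2 * g (W X ω) + η * e i ^ 8)) =
        2 * ℓ * |Ξ| * (∑ i, |c i ω| * absSum X (B i) ω) * g (W X ω) +
        ∑ i, |c i ω| * |Ξ| * (ℓ * absSum X (B i) ω * (η * e i ^ 8)) := by
      rw [Finset.mul_sum, Finset.sum_mul, ← Finset.sum_add_distrib]
      exact Finset.sum_congr rfl fun i _ => by ring
    -- In the tail term Ξ is bounded crudely by the sum of all weights. This costs an extra factor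
    -- n, later paid for by η n ≤ 1.
    have h3 : ∑ i, |c i ω| * |Ξ| * (ℓ * absSum X (B i) ω * (η * e i ^ 8)) ≤
        256 * β ^ 2 * η * ℓ / a * (∑ i, ∑ j, e i ^ 10 * e j ^ 1) := by
      rw [Finset.mul_sum]
      refine Finset.sum_le_sum fun i _ => ?_
      have hΞ' : |Ξ| ≤ ∑ j, 4 * β * e j :=
        (Finset.abs_sum_le_sum_abs _ _).trans (Finset.sum_le_sum fun j _ => hcβ j ω)
      have := he0 i
      have hT := h.absSum_le_wt (B i) ω
      have hT0 := absSum_nonneg X (B i) ω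
      calc |c i ω| * |Ξ| * (ℓ * absSum X (B i) ω * (η * e i ^ 8))
          ≤ (4 * β * e i) * (∑ j, 4 * β * e j) * (ℓ * (16 / a * e i) * (η * e i ^ 8)) := by
            have hβ0 : 0 ≤ β := by linarith
            have hs : 0 ≤ ∑ j, 4 * β * e j :=
              Finset.sum_nonneg fun j _ => by have := he0 j; positivity
            gcongr
            exact hcβ i ω
        _ = _ := by
            rw [← Finset.mul_sum, ← Finset.mul_sum]
            simp only [pow_one]
            field_simp
            ring
    set ρ := ∑ i, (c i ω ^ 2 + a ^ 2 * X i ω ^ 2) / 2 with hρ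
    have h4 := h.sum_mul_absSum_le (fun i => c i ω) ω
    simp only [← hρ] at h4
    have hρ0 : 0 ≤ ρ := Finset.sum_nonneg fun i _ => by positivity
    have h5 : 2 * ℓ * |Ξ| * (∑ i, |c i ω| * absSum X (B i) ω) * g (W X ω) ≤
        1 / 2 * (Ξ ^ 2 * g (W X ω)) + 2 * ℓ ^ 2 * (kappa B / a) ^ 2 * (ρ ^ 2 * g (W X ω)) := by
      calc 2 * ℓ * |Ξ| * (∑ i, |c i ω| * absSum X (B i) ω) * g (W X ω)
          ≤ 2 * ℓ * |Ξ| * (kappa B / a * ρ) * g (W X ω) := by gcongr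
        _ ≤ (1 / 2 * Ξ ^ 2 + 2 * ℓ ^ 2 * (kappa B / a) ^ 2 * ρ ^ 2) * g (W X ω) := by
            gcongr
            nlinarith [sq_nonneg (|Ξ| - 2 * ℓ * (kappa B / a * ρ)), sq_abs Ξ]
        _ = _ := by ring
    linarith
  have hnear2 : ∑ i, ∑ j ∈ N B i, (3 * (c i ω ^ 2 * g (W X ω)) + 3 * (c j ω ^ 2 * g (W X ω)) +
        32 * β ^ 2 * η * (e i ^ 9 * e j ^ 1)) =
      2 * ∑ i, ∑ j ∈ N B i, (3 / 2 * (c i ω ^ 2 * g (W X ω)) + 3 / 2 * (c j ω ^ 2 * g (W X ω)) +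
        16 * β ^ 2 * η * (e i ^ 9 * e j ^ 1)) := by
    simp only [Finset.mul_sum]
    exact Finset.sum_congr rfl fun i _ => Finset.sum_congr rfl fun j _ => by ring
  rw [hnear2]
  have h6 : 512 * β ^ 2 * η * ℓ / a * (∑ i, ∑ j, e i ^ 10 * e j ^ 1) =
      2 * (256 * β ^ 2 * η * ℓ / a * (∑ i, ∑ j, e i ^ 10 * e j ^ 1)) := by ring
  rw [h6]
  linarith

set_option maxHeartbeats 800000 in
/-- Weighted variance bound for sums of centered local variables. -/
lemma integral_sq_sum_mul_test_le [IsProbabilityMeasure P] (h : IsLocalSystem P X A B a b)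
    (hβ : 1 ≤ β) (hb : β ^ 16 = b) (hg : IsTest ℓ M g) (hℓ : 0 < ℓ) (hℓa : ℓ ≤ a)
    (hη : M * Real.exp (-(a / (2 * ℓ))) ≤ 1)
    (hηn : M * Real.exp (-(a / (2 * ℓ))) * Fintype.card J ≤ 1) (hκ : (1 : ℝ) ≤ kappa B)
    {c : J → Ω → ℝ} (hc : ∀ i, Measurable[sig X (A i)] (c i)) (hc0 : ∀ i, ∫ ω, c i ω ∂P = 0)
    (hcβ : ∀ i ω, |c i ω| ≤ 4 * β * wt X a (B i) ω) :
    ∫ ω, (∑ i, c i ω) ^ 2 * g (W X ω) ∂P ≤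
      (7200 * (kappa B * Fintype.card J * b) +
        118400000 * (ℓ * kappa B * (Fintype.card J * b) / a) ^ 2) * ∫ ω, g (W X ω) ∂P := by
  classical
  have hpt := h.sq_sum_mul_test_le hβ hg hℓ hcβ
  set η := M * Real.exp (-(a / (2 * ℓ))) with hηdef
  have hη0 : 0 ≤ η := by have := hg.one_le_M; positivity
  have ha := h.a_pos
  have hβ0 : 0 ≤ β := by linarith
  have hG := h.one_le_integral_test hg
  have he := h.controlled_wt
  have hgW := h.controlled_test hg
  have hcc : ∀ i, Controlled X B a 1 (c i) := fun i =>
    Controlled.of_le ((hc i).mono (sig_le h.meas _) le_rfl) ((he i).const_mul (4 * β)) (hcβ i)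
  have hsq : ∀ i, ∫ ω, c i ω ^ 2 * g (W X ω) ∂P ≤ 912 * b * ∫ ω, g (W X ω) ∂P := fun i => by
    have h1 := h.integral_mul_test_le hβ hb hg hℓ hη i (D := 16 * β ^ 2) ((hc i).pow_const 2)
      (fun ω => sq_nonneg _) fun ω => by
        calc c i ω ^ 2 = |c i ω| ^ 2 := (sq_abs _).symm
          _ ≤ (4 * β * wt X a (B i) ω) ^ 2 := pow_le_pow_left₀ (abs_nonneg _) (hcβ i ω) 2
          _ = 16 * β ^ 2 * wt X a (B i) ω ^ 2 := by ring
          _ ≤ _ := by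
            have := one_le_wt X ha.le (B i) ω
            gcongr; norm_num
    refine h1.trans ?_
    rw [← hb]
    calc 57 * (16 * β ^ 2) * β ^ 12 * ∫ ω, g (W X ω) ∂P
        = 912 * β ^ 14 * ∫ ω, g (W X ω) ∂P := by ring
      _ ≤ _ := by gcongr; norm_num
  -- Here c_i² ≤ 16 β² wt² and a² X_i² ≤ 256 wt², so half their sum has constant (16 + 256)/2 = 136.
  have hρ := h.integral_sum_sq_mul_test_le hβ hb hg hℓ hη (D := 136 * β ^ 2) (by positivity)
    (ρ := fun i ω => (c i ω ^ 2 + a ^ 2 * X i ω ^ 2) / 2)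
    (fun i => (((hc i).pow_const 2).add
      (((h.measurable_X_sig i).pow_const 2).const_mul (a ^ 2))).div_const 2)
    (fun i ω => by positivity)
    (fun i ω => by
      have h1 : c i ω ^ 2 ≤ (4 * β * wt X a (B i) ω) ^ 2 := by
        rw [← sq_abs]; exact pow_le_pow_left₀ (abs_nonneg _) (hcβ i ω) 2
      have h2 : a * |X i ω| ≤ 16 * wt X a (B i) ω := by
        have h3 := (h.abs_le_absSum i ω).trans ((absSum_mono X (h.subset i) ω).trans
          (h.absSum_le_wt (B i) ω))
        calc a * |X i ω| ≤ a * (16 / a * wt X a (B i) ω) := by gcongr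
          _ = _ := by field_simp
      have h4 : a ^ 2 * X i ω ^ 2 ≤ (16 * wt X a (B i) ω) ^ 2 := by
        rw [← sq_abs (X i ω), ← mul_pow]
        exact pow_le_pow_left₀ (by positivity) h2 2
      have h5 : wt X a (B i) ω ^ 2 ≤ β ^ 2 * wt X a (B i) ω ^ 2 :=
        le_mul_of_one_le_left (by positivity) (one_le_pow₀ hβ)
      nlinarith)
  set G := ∫ ω, g (W X ω) ∂P
  set n : ℝ := (Fintype.card J : ℝ) with hn
  have hn0 : 0 ≤ n := by positivity
  set F1 : Ω → ℝ := fun ω => ∑ i, c i ω * ((∑ j ∈ (N B i)ᶜ, c j ω) * g (far X B i ω)) with hF1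
  set F2 : Ω → ℝ := fun ω => (∑ i, (c i ω ^ 2 + a ^ 2 * X i ω ^ 2) / 2) ^ 2 * g (W X ω) with hF2
  set F3 : Ω → ℝ := fun ω => ∑ i, ∑ j, wt X a (B i) ω ^ 10 * wt X a (B j) ω ^ 1 with hF3
  set F4 : Ω → ℝ := fun ω => ∑ i, ∑ j ∈ N B i, (3 * (c i ω ^ 2 * g (W X ω)) +
    3 * (c j ω ^ 2 * g (W X ω)) + 32 * β ^ 2 * η * (wt X a (B i) ω ^ 9 * wt X a (B j) ω ^ 1)) with hF4
  have i1t : ∀ i, Integrable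
      (fun ω => c i ω * ((∑ j ∈ (N B i)ᶜ, c j ω) * g (far X B i ω))) P := fun i =>
    h.integrable ((hcc i).mul ((Controlled.sum _ fun j _ => hcc j).mul (h.controlled_test_far hg i)))
  have i1 : Integrable F1 P := integrable_finsetSum _ fun i _ => i1t i
  have i2 : Integrable F2 P := by
    refine h.integrable (k := 4) (((Controlled.sum (k := 2) _ fun i _ => ?_).pow 2).mul hgW)
    have := (((hcc i).pow 2).add (((h.controlled_X i).pow 2).const_mul (a ^ 2))).const_mul (1 / 2)
    simpa [div_eq_inv_mul] using this
  have i3t : ∀ i j, Integrable (fun ω => wt X a (B i) ω ^ 10 * wt X a (B j) ω ^ 1) P := fun i j =>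
    h.integrable (((he i).pow 10).mul ((he j).pow 1))
  have i3 : Integrable F3 P := integrable_finsetSum _ fun i _ => integrable_finsetSum _ fun j _ =>
    i3t i j
  have icg : ∀ i, Integrable (fun ω => c i ω ^ 2 * g (W X ω)) P := fun i =>
    h.integrable (((hcc i).pow 2).mul hgW)
  have i9 : ∀ i j, Integrable (fun ω => wt X a (B i) ω ^ 9 * wt X a (B j) ω ^ 1) P := fun i j =>
    h.integrable (((he i).pow 9).mul ((he j).pow 1))
  have i4s : ∀ i j, Integrable (fun ω => 3 * (c i ω ^ 2 * g (W X ω)) +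
      3 * (c j ω ^ 2 * g (W X ω))) P := fun i j => ((icg i).const_mul 3).add ((icg j).const_mul 3)
  have i4t : ∀ i j, Integrable (fun ω => 3 * (c i ω ^ 2 * g (W X ω)) +
      3 * (c j ω ^ 2 * g (W X ω)) + 32 * β ^ 2 * η *
        (wt X a (B i) ω ^ 9 * wt X a (B j) ω ^ 1)) P := fun i j =>
    (i4s i j).add ((i9 i j).const_mul _)
  have i4 : Integrable F4 P := integrable_finsetSum _ fun i _ => integrable_finsetSum _ fun j _ =>
    i4t i j
  have e1 : ∫ ω, F1 ω ∂P = 0 := by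
    rw [hF1, integral_finsetSum _ fun i _ => i1t i]
    exact Finset.sum_eq_zero fun i _ => h.integral_mul_far_eq_zero hg hc hc0 i fun j hj => by
      simpa using hj
  have e3 : ∫ ω, F3 ω ∂P ≤ n ^ 2 * (3 * β ^ 11) := by
    rw [hF3, integral_finsetSum _ fun i _ => integrable_finsetSum _ fun j _ => i3t i j]
    simp only [integral_finsetSum _ fun j _ => i3t _ j]
    calc _ ≤ ∑ _i : J, ∑ _j : J, 3 * β ^ 11 := Finset.sum_le_sum fun i _ =>
          Finset.sum_le_sum fun j _ => h.integral_wt_pow_mul_le hβ hb i j (by norm_num)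
      _ = _ := by simp only [Finset.sum_const, Finset.card_univ, nsmul_eq_mul]; ring
  have hb1 : ∀ k ≤ 16, β ^ k ≤ b := fun k hk => by
    rw [← hb]; exact pow_le_pow_right₀ hβ hk
  have hb0 : 0 ≤ b := by linarith [h.one_le_b]
  have i9e : ∀ i j, 32 * β ^ 2 * η * ∫ ω, wt X a (B i) ω ^ 9 * wt X a (B j) ω ^ 1 ∂P ≤
      96 * b * G := fun i j => by
    have h0 : 0 ≤ ∫ ω, wt X a (B i) ω ^ 9 * wt X a (B j) ω ^ 1 ∂P :=
      integral_nonneg fun ω => mul_nonneg (pow_nonneg (wt_pos _ _ _ _).le _)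
        (pow_nonneg (wt_pos _ _ _ _).le _)
    have h2 := h.integral_wt_pow_mul_le hβ hb i j (k := 9) (l := 1) (by norm_num)
    calc 32 * β ^ 2 * η * ∫ ω, wt X a (B i) ω ^ 9 * wt X a (B j) ω ^ 1 ∂P
        ≤ 32 * β ^ 2 * 1 * (3 * β ^ (9 + 1)) :=
          mul_le_mul (mul_le_mul_of_nonneg_left hη (by positivity)) h2 h0 (by positivity)
      _ = 96 * β ^ 12 := by ring
      _ ≤ 96 * b := by linarith [hb1 12 (by norm_num)]
      _ ≤ 96 * b * G := le_mul_of_one_le_right (by positivity) hG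
  -- Neighbouring pairs number at most nκ, each contributing at most 6 · 912 + 96 ≤ 5600 times bG.
  have e4 : ∫ ω, F4 ω ∂P ≤ n * (kappa B * (5600 * b * G)) := by
    rw [hF4, integral_finsetSum _ fun i _ => integrable_finsetSum _ fun j _ => i4t i j]
    simp only [integral_finsetSum _ fun j _ => i4t _ j]
    calc _ ≤ ∑ i : J, ∑ _j ∈ N B i, 5600 * b * G := by
          refine Finset.sum_le_sum fun i _ => Finset.sum_le_sum fun j _ => ?_
          rw [integral_add (i4s i j) ((i9 i j).const_mul _), integral_add ((icg i).const_mul 3)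
            ((icg j).const_mul 3), integral_const_mul, integral_const_mul, integral_const_mul]
          have hbG : 0 ≤ b * G := by positivity
          linarith [hsq i, hsq j, i9e i j]
      _ ≤ ∑ _i : J, kappa B * (5600 * b * G) := by
          refine Finset.sum_le_sum fun i _ => ?_
          rw [Finset.sum_const, nsmul_eq_mul]
          gcongr
          exact_mod_cast card_N_le B i
      _ = _ := by simp only [Finset.sum_const, Finset.card_univ, nsmul_eq_mul]; rfl
  have hkey : ∫ ω, (∑ i, c i ω) ^ 2 * g (W X ω) ∂P ≤ 2 * ∫ ω, F1 ω ∂P +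
      4 * ℓ ^ 2 * (kappa B / a) ^ 2 * ∫ ω, F2 ω ∂P +
      512 * β ^ 2 * η * ℓ / a * ∫ ω, F3 ω ∂P + ∫ ω, F4 ω ∂P := by
    have j2 : Integrable (fun ω => 2 * F1 ω + 4 * ℓ ^ 2 * (kappa B / a) ^ 2 * F2 ω) P :=
      (i1.const_mul _).add (i2.const_mul _)
    have j3 : Integrable (fun ω => 2 * F1 ω + 4 * ℓ ^ 2 * (kappa B / a) ^ 2 * F2 ω +
        512 * β ^ 2 * η * ℓ / a * F3 ω) P := j2.add (i3.const_mul _)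
    rw [← integral_const_mul, ← integral_const_mul, ← integral_const_mul,
      ← integral_add (i1.const_mul _) (i2.const_mul _), ← integral_add j2 (i3.const_mul _),
      ← integral_add j3 i4]
    exact integral_mono (h.integrable (((Controlled.sum _ fun i _ => hcc i).pow 2).mul hgW))
      (j3.add i4) hpt
  have hG0 : 0 ≤ G := by linarith
  have t2 : 4 * ℓ ^ 2 * (kappa B / a) ^ 2 * ∫ ω, F2 ω ∂P ≤
      118400000 * (ℓ * kappa B * (n * b) / a) ^ 2 * G := by
    calc _ ≤ 4 * ℓ ^ 2 * (kappa B / a) ^ 2 * (1600 * (136 * β ^ 2) ^ 2 * β ^ 14 * n ^ 2 * G) := by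
          gcongr
      _ = 118374400 * (ℓ ^ 2 * (kappa B / a) ^ 2 * n ^ 2 * G) * β ^ 18 := by ring
      _ ≤ 118400000 * (ℓ ^ 2 * (kappa B / a) ^ 2 * n ^ 2 * G) * β ^ 32 := by
          gcongr <;> norm_num
      _ = _ := by
          rw [← hb]; ring
  have t3 : 512 * β ^ 2 * η * ℓ / a * ∫ ω, F3 ω ∂P ≤ 1600 * (kappa B * n * b) * G := by
    have h1 : ℓ / a ≤ 1 := (div_le_one ha).2 hℓa
    calc 512 * β ^ 2 * η * ℓ / a * ∫ ω, F3 ω ∂P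
        ≤ 512 * β ^ 2 * η * ℓ / a * (n ^ 2 * (3 * β ^ 11)) := by gcongr
      _ = 1536 * (n * β ^ 13) * (η * n) * (ℓ / a) := by ring
      _ ≤ 1600 * (n * b) * 1 * 1 := by
          gcongr
          · norm_num
          · exact hb1 13 (by norm_num)
      _ = 1600 * (1 * n * b) * 1 := by ring
      _ ≤ _ := by gcongr
  rw [e1] at hkey
  rw [add_mul]
  have h9 : 7200 * (kappa B * n * b) * G =
      1600 * (kappa B * n * b) * G + n * (kappa B * (5600 * b * G)) := by ring
  rw [h9]
  linarith

end IsLocalSystem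

end LocalDep

/-! ### Fluctuations of local sums and Stein's identity -/

namespace LocalDep

/-- The fluctuation `∑_i (p_i - E p_i)`. -/
noncomputable def fluct {Ω J : Type*} [MeasurableSpace Ω] [Fintype J] (P : Measure Ω)
    (p : J → Ω → ℝ) (ω : Ω) : ℝ := ∑ i, (p i ω - ∫ ω', p i ω' ∂P)

/-- The local products `X_i Y_i`, where `Y_i = ∑_{j ∈ A_i} X_j`. -/
noncomputable def localProd {Ω J : Type*} (X : J → Ω → ℝ) (A : J → Finset J) (i : J) (ω : Ω) : ℝ :=
  X i ω * ∑ j ∈ A i, X j ω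

lemma sq_le_two_mul_exp {x : ℝ} (hx : 0 ≤ x) : x ^ 2 ≤ 2 * Real.exp x := by
  have := Real.quadratic_le_exp_of_nonneg hx
  nlinarith

lemma W_sub_far_A {Ω J : Type*} [Fintype J] {X : J → Ω → ℝ} (A : J → Finset J) (i : J) (ω : Ω) :
    W X ω - far X A i ω = ∑ j ∈ A i, X j ω := by
  rw [far, sub_sub_cancel]

lemma controlled_fluct {Ω J : Type*} [MeasurableSpace Ω] [Fintype J] {P : Measure Ω}
    {X : J → Ω → ℝ} {B : J → Finset J} {a : ℝ} {p : J → Ω → ℝ} {k : ℕ}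
    (hp : ∀ i, Controlled X B a k (p i)) : Controlled X B a k (fluct P p) :=
  Controlled.sum _ fun i _ => by
    simpa using (hp i).sub (Controlled.const (∫ ω', p i ω' ∂P))

namespace IsLocalSystem

variable {Ω J : Type*} [MeasurableSpace Ω] [Fintype J] {P : Measure Ω}
  {X : J → Ω → ℝ} {A B : J → Finset J} {a b β ℓ M ν : ℝ} {g : ℝ → ℝ}

lemma controlled_localProd (h : IsLocalSystem P X A B a b) (i : J) :
    Controlled X B a 2 (localProd X A i) :=
  (h.controlled_X i).mul (Controlled.sum _ fun j _ => h.controlled_X j)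

lemma measurable_localProd_sig (h : IsLocalSystem P X A B a b) (i : J) :
    Measurable[sig X (A i)] (localProd X A i) :=
  (h.measurable_X_sig i).mul (Finset.measurable_fun_sum _ fun _ hj => measurable_sig X hj)

lemma abs_localProd_le (h : IsLocalSystem P X A B a b) (i : J) (ω : Ω) :
    |localProd X A i ω| ≤ absSum X (A i) ω ^ 2 := by
  rw [localProd, abs_mul, sq]
  exact mul_le_mul (h.abs_le_absSum i ω) (abs_sum_le_absSum X _ ω) (abs_nonneg _)
    (absSum_nonneg _ _ _)

variable [IsProbabilityMeasure P]

lemma integral_W_sq (h : IsLocalSystem P X A B a b) : ∫ ω, W X ω ^ 2 ∂P = 1 := by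
  have h0 : ∫ ω, W X ω ∂P = 0 := by
    simp only [W]
    rw [integral_finsetSum _ fun i _ => h.integrable (h.controlled_X i)]
    exact Finset.sum_eq_zero fun i _ => h.mean i
  rw [← h.var, variance_of_integral_eq_zero h.measurable_W.aemeasurable h0]

lemma integral_abs_W_le (h : IsLocalSystem P X A B a b) : ∫ ω, |W X ω| ∂P ≤ 1 := by
  have h1 : ∫ ω, |W X ω| ∂P ≤ ∫ ω, (1 / 2 + 1 / 2 * W X ω ^ 2) ∂P := by
    refine integral_mono (h.integrable h.controlled_W.abs) (h.integrable
      ((Controlled.const _).add ((h.controlled_W.pow 2).const_mul _))) fun ω => ?_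
    simp only
    nlinarith [sq_nonneg (|W X ω| - 1), sq_abs (W X ω)]
  rw [integral_add (integrable_const _) (h.integrable ((h.controlled_W.pow 2).const_mul _)),
    integral_const_mul, h.integral_W_sq] at h1
  simp at h1
  linarith

/-- Expand W² = ∑ X_i W: by (LD1) only the part of W inside A_i contributes. The unit variance thus
becomes the exact leading coefficient in Stein's identity. -/
lemma sum_integral_localProd (h : IsLocalSystem P X A B a b) :
    ∑ i, ∫ ω, localProd X A i ω ∂P = 1 := by
  rw [← h.integral_W_sq]
  have h1 : ∀ ω, W X ω ^ 2 = ∑ i, (localProd X A i ω + X i ω * far X A i ω) := fun ω => by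
    calc W X ω ^ 2 = (∑ i, X i ω) * W X ω := by rw [sq]; rfl
      _ = _ := by
        rw [Finset.sum_mul]
        refine Finset.sum_congr rfl fun i _ => ?_
        rw [localProd, ← W_sub_far_A A i ω]
        ring
  have hfar : ∀ i, Controlled X B a 1 (far X A i) := fun i =>
    h.controlled_W.sub (Controlled.sum _ fun j _ => h.controlled_X j)
  have i1 : ∀ i, Integrable (localProd X A i) P := fun i => h.integrable (h.controlled_localProd i)
  have i2 : ∀ i, Integrable (fun ω => X i ω * far X A i ω) P := fun i =>
    h.integrable ((h.controlled_X i).mul (hfar i))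
  simp only [h1]
  have i3 : ∀ i, Integrable (fun ω => localProd X A i ω + X i ω * far X A i ω) P := fun i =>
    (i1 i).add (i2 i)
  rw [integral_finsetSum _ fun i _ => i3 i]
  refine Finset.sum_congr rfl fun i _ => ?_
  rw [integral_add (i1 i) (i2 i), h.integral_mul' i (far_measurable_sig X A i), add_zero]

/-- Unit variance keeps the X_i from being too small: 1 = ∑ E X_i Y_i, and each term is at most
2b/a² because x² ≤ 2eˣ. The bound lets ν replace constants in later estimates. -/
lemma half_le (h : IsLocalSystem P X A B a b) (hν : Fintype.card J * b = ν * a ^ 2) :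
    1 / 2 ≤ ν := by
  have ha := h.a_pos
  have h1 : ∀ i, ∫ ω, localProd X A i ω ∂P ≤ 2 / a ^ 2 * b := fun i => by
    calc ∫ ω, localProd X A i ω ∂P
        ≤ ∫ ω, 2 / a ^ 2 * Real.exp (a * absSum X (B i) ω) ∂P := by
          refine integral_mono (h.integrable (h.controlled_localProd i))
            ((h.integrable_exp i).const_mul _) fun ω => ?_
          have h2 := (le_abs_self _).trans (h.abs_localProd_le i ω)
          have h3 := absSum_nonneg X (B i) ω
          have h4 := sq_le_two_mul_exp (mul_nonneg ha.le h3)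
          have h5 := pow_le_pow_left₀ (absSum_nonneg X (A i) ω) (absSum_mono X (h.subset i) ω) 2
          simp only
          rw [div_mul_eq_mul_div, le_div_iff₀ (by positivity)]
          nlinarith
      _ = 2 / a ^ 2 * ∫ ω, Real.exp (a * absSum X (B i) ω) ∂P := integral_const_mul _ _
      _ ≤ _ := by gcongr; exact h.integral_exp_le i
  have h2 : (1 : ℝ) ≤ ∑ _i : J, 2 / a ^ 2 * b := by
    rw [← h.sum_integral_localProd]
    exact Finset.sum_le_sum fun i _ => h1 i
  rw [Finset.sum_const, Finset.card_univ, nsmul_eq_mul] at h2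
  have h3 : (Fintype.card J : ℝ) * (2 / a ^ 2 * b) = 2 * ν := by
    calc (Fintype.card J : ℝ) * (2 / a ^ 2 * b) = 2 / a ^ 2 * (Fintype.card J * b) := by ring
      _ = 2 * ν := by rw [hν]; field_simp
  linarith

/-- If no `i` belonged to `A i`, every X_i would vanish, against unit variance. A surviving index
lies in its own N_i. -/
lemma one_le_kappa (h : IsLocalSystem P X A B a b) : (1 : ℝ) ≤ kappa B := by
  classical
  have h1 : ∃ i, i ∈ A i := by
    by_contra! hne
    have h2 := h.sum_integral_localProd
    have h3 : ∀ i, ∫ ω, localProd X A i ω ∂P = 0 := fun i => by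
      simp [localProd, h.eq_zero i (hne i)]
    simp [h3] at h2
  obtain ⟨i, hi⟩ := h1
  have h2 : i ∈ N B i := by
    simp only [N, Finset.mem_filter, Finset.mem_univ, true_and, Finset.inter_self]
    exact ⟨i, h.subset i hi⟩
  refine le_trans ?_ (card_N_le B i)
  exact_mod_cast Finset.card_pos.2 ⟨i, h2⟩

/-- First-moment bound for fluctuations of local weights, weighted by a test function. -/
lemma integral_abs_fluct_mul_test_le (h : IsLocalSystem P X A B a b)
    (hν : Fintype.card J * b = ν * a ^ 2) (hg : IsTest ℓ M g) (hℓ : 1 ≤ ℓ) (hℓa : ℓ ≤ a)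
    (hη : M * Real.exp (-(a / (2 * ℓ))) ≤ 1)
    (hηn : M * Real.exp (-(a / (2 * ℓ))) * Fintype.card J ≤ 1)
    {p : J → Ω → ℝ} (hp : ∀ i, Measurable[sig X (A i)] (p i))
    (hpw : ∀ i ω, |p i ω| ≤ wt X a (A i) ω) :
    ∫ ω, |fluct P p ω| * g (W X ω) ∂P ≤
      11000 * (a * ℓ * kappa B * ν) * ∫ ω, g (W X ω) ∂P := by
  have ha := h.a_pos
  have hb1 := h.one_le_b
  have hν2 := h.half_le hν
  have hκ := h.one_le_kappa
  set β := b ^ (1 / 16 : ℝ) with hβdef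
  have hβ : 1 ≤ β := Real.one_le_rpow hb1 (by norm_num)
  have hb : β ^ 16 = b := by
    rw [hβdef, ← Real.rpow_natCast, ← Real.rpow_mul (by linarith)]; norm_num
  have hpw' : ∀ i ω, |p i ω| ≤ wt X a (B i) ω := fun i ω =>
    (hpw i ω).trans (wt_mono X ha.le (h.subset i) ω)
  have hpc : ∀ i, Controlled X B a 1 (p i) := fun i =>
    Controlled.of_le ((hp i).mono (sig_le h.meas _) le_rfl) (h.controlled_wt i) (hpw' i)
  have hmean : ∀ i, |∫ ω, p i ω ∂P| ≤ 3 * β := fun i => by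
    calc |∫ ω, p i ω ∂P| ≤ ∫ ω, |p i ω| ∂P := abs_integral_le_integral_abs
      _ ≤ ∫ ω, wt X a (B i) ω ^ 1 ∂P :=
        integral_mono (h.integrable (hpc i).abs) (h.integrable ((h.controlled_wt i).pow 1))
          fun ω => by simpa using hpw' i ω
      _ ≤ 3 * β ^ 1 := h.integral_wt_pow_le hβ hb i (by norm_num)
      _ = _ := by rw [pow_one]
  have hQ := h.integral_sq_sum_mul_test_le hβ hb hg (by linarith) hℓa hη hηn hκ
    (c := fun i ω => p i ω - ∫ ω', p i ω' ∂P) (fun i => (hp i).sub measurable_const)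
    (fun i => by
      rw [integral_sub (h.integrable (hpc i)) (integrable_const _)]; simp)
    (fun i ω => by
      have h1 := one_le_wt X ha.le (B i) ω
      have h2 := hpw' i ω
      have h3 := hmean i
      calc |p i ω - ∫ ω', p i ω' ∂P| ≤ |p i ω| + |∫ ω', p i ω' ∂P| := abs_sub _ _
        _ ≤ wt X a (B i) ω + 3 * β := add_le_add h2 h3
        _ ≤ _ := by nlinarith)
  change ∫ ω, fluct P p ω ^ 2 * g (W X ω) ∂P ≤ _ at hQ
  have hG := h.one_le_integral_test hg
  set G := ∫ ω, g (W X ω) ∂P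
  have hfc : Controlled X B a 1 (fluct P p) := controlled_fluct hpc
  have hgW := h.controlled_test hg
  -- Chosen so that its square dominates the variance bound: with n b = ν a², κ, ℓ ≥ 1 and ν ≥ 1/2,
  -- both terms there are multiples of (aℓκν)², and 2 · 7200 + 118400000 ≤ 11000².
  set lam := 11000 * (a * ℓ * kappa B * ν) with hlam
  have hlam0 : 0 < lam := by positivity
  have hQ' : ∫ ω, fluct P p ω ^ 2 * g (W X ω) ∂P ≤ lam ^ 2 * G := by
    refine hQ.trans (mul_le_mul_of_nonneg_right ?_ (by linarith))
    rw [mul_assoc, hν]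
    have h1 : ℓ * kappa B * (ν * a ^ 2) / a = a * ℓ * kappa B * ν := by field_simp
    rw [h1, hlam]
    have h2 : (kappa B : ℝ) * (ν * a ^ 2) ≤ 2 * (a * ℓ * kappa B * ν) ^ 2 := by
      calc (kappa B : ℝ) * (ν * a ^ 2) = 1 * 1 * (kappa B * a ^ 2 * ν) := by ring
        _ ≤ (ℓ ^ 2 * kappa B) * (2 * ν) * (kappa B * a ^ 2 * ν) := by
          gcongr
          · nlinarith [one_le_pow₀ (n := 2) hℓ]
          · linarith
        _ = _ := by ring
    nlinarith [sq_nonneg (a * ℓ * kappa B * ν)]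
  -- Cauchy-Schwarz in the form |x| ≤ x²/(2λ) + λ/2.
  calc ∫ ω, |fluct P p ω| * g (W X ω) ∂P
      ≤ ∫ ω, (1 / (2 * lam) * (fluct P p ω ^ 2 * g (W X ω)) + lam / 2 * g (W X ω)) ∂P := by
        refine integral_mono (h.integrable (hfc.abs.mul hgW)) (h.integrable
          ((((hfc.pow 2).mul hgW).const_mul _).add (hgW.const_mul _))) fun ω => ?_
        simp only
        rw [← mul_assoc, ← add_mul]
        refine mul_le_mul_of_nonneg_right ?_ (hg.pos _).le
        have h1 := sq_nonneg (|fluct P p ω| - lam)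
        rw [sub_sq, sq_abs] at h1
        have h2 : 1 / (2 * lam) * fluct P p ω ^ 2 + lam / 2 =
            (fluct P p ω ^ 2 + lam ^ 2) / (2 * lam) := by field_simp
        rw [h2, le_div_iff₀ (by positivity)]
        linarith
    _ = 1 / (2 * lam) * ∫ ω, fluct P p ω ^ 2 * g (W X ω) ∂P + lam / 2 * G := by
        rw [integral_add (h.integrable (((hfc.pow 2).mul hgW).const_mul _))
          (h.integrable (hgW.const_mul _)), integral_const_mul, integral_const_mul]
    _ ≤ 1 / (2 * lam) * (lam ^ 2 * G) + lam / 2 * G := by gcongr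
    _ = _ := by field_simp; ring

/-- Stein's identity for locally dependent sums, with remainder. -/
lemma abs_integral_stein_le (h : IsLocalSystem P X A B a b) {f D : ℝ → ℝ} {Kf KD : ℝ}
    (hf : Measurable f) (hfK : ∀ w, |f w| ≤ Kf) (hD : Measurable D) (hDK : ∀ w, |D w| ≤ KD)
    {r : J → Ω → ℝ} (hr : ∀ i, Integrable (r i) P)
    (hrem : ∀ i ω, absSum X (A i) ω *
      |f (W X ω) - f (far X A i ω) - (W X ω - far X A i ω) * D (W X ω)| ≤ r i ω) :
    |∫ ω, W X ω * f (W X ω) ∂P - ∫ ω, D (W X ω) ∂P| ≤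
      |∫ ω, D (W X ω) * fluct P (localProd X A) ω ∂P| + ∑ i, ∫ ω, r i ω ∂P := by
  have hfW : Controlled X B a 0 (fun ω => f (W X ω)) :=
    Controlled.of_bounded (hf.comp h.measurable_W) Kf fun _ => hfK _
  have hDW : Controlled X B a 0 (fun ω => D (W X ω)) :=
    Controlled.of_bounded (hD.comp h.measurable_W) KD fun _ => hDK _
  have hfarc : ∀ i, Controlled X B a 1 (far X A i) := fun i =>
    h.controlled_W.sub (Controlled.sum _ fun j _ => h.controlled_X j)
  have hff : ∀ i, Controlled X B a 0 (fun ω => f (far X A i ω)) := fun i =>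
    Controlled.of_bounded (hf.comp (hfarc i).measurable) Kf fun _ => hfK _
  set q : J → Ω → ℝ := fun i ω =>
    X i ω * (f (W X ω) - f (far X A i ω) - (W X ω - far X A i ω) * D (W X ω)) with hq
  have hqc : ∀ i, Controlled X B a 2 (q i) := fun i =>
    (h.controlled_X i).mul (((hfW.sub (hff i)).sub ((h.controlled_W.sub (hfarc i)).mul hDW)))
  have hfl : Controlled X B a 2 (fluct P (localProd X A)) :=
    controlled_fluct h.controlled_localProd
  -- Each f(W) is expanded about the part of W outside A_i. The linear terms add up to D(W) ∑ X_i
  -- Y_i, and ∑ X_i Y_i equals 1 plus its fluctuation.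
  have hpt : ∀ ω, W X ω * f (W X ω) = D (W X ω) + D (W X ω) * fluct P (localProd X A) ω +
      ∑ i, (q i ω + X i ω * f (far X A i ω)) := fun ω => by
    have h1 : fluct P (localProd X A) ω = ∑ i, localProd X A i ω - 1 := by
      rw [fluct, Finset.sum_sub_distrib, h.sum_integral_localProd]
    have h2 : W X ω * f (W X ω) = ∑ i, X i ω * f (W X ω) := by rw [← Finset.sum_mul]; rfl
    rw [h1, h2, mul_sub, mul_one, add_sub_cancel, Finset.mul_sum, ← Finset.sum_add_distrib]
    refine Finset.sum_congr rfl fun i _ => ?_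
    simp only [hq, localProd, ← W_sub_far_A A i ω]
    ring
  have i1 := h.integrable hDW
  have i2 := h.integrable (hDW.mul hfl)
  have i3 : ∀ i, Integrable (q i) P := fun i => h.integrable (hqc i)
  have i4 : ∀ i, Integrable (fun ω => X i ω * f (far X A i ω)) P := fun i =>
    h.integrable ((h.controlled_X i).mul (hff i))
  have i5 : ∀ i, Integrable (fun ω => q i ω + X i ω * f (far X A i ω)) P := fun i =>
    (i3 i).add (i4 i)
  have i12 : Integrable (fun ω => D (W X ω) + D (W X ω) * fluct P (localProd X A) ω) P := i1.add i2
  have h0 : ∀ i, ∫ ω, X i ω * f (far X A i ω) ∂P = 0 := fun i =>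
    h.integral_mul' i (hf.comp (far_measurable_sig X A i))
  have h1 : ∫ ω, W X ω * f (W X ω) ∂P = ∫ ω, D (W X ω) ∂P +
      ∫ ω, D (W X ω) * fluct P (localProd X A) ω ∂P + ∑ i, ∫ ω, q i ω ∂P := by
    simp only [hpt]
    rw [integral_add i12 (integrable_finsetSum _ fun i _ => i5 i), integral_add i1 i2,
      integral_finsetSum _ fun i _ => i5 i]
    congr 1
    refine Finset.sum_congr rfl fun i _ => ?_
    rw [integral_add (i3 i) (i4 i), h0 i, add_zero]
  rw [h1, add_assoc, add_sub_cancel_left]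
  refine (abs_add_le _ _).trans (add_le_add le_rfl ?_)
  refine (Finset.abs_sum_le_sum_abs _ _).trans (Finset.sum_le_sum fun i _ => ?_)
  refine abs_integral_le_integral_abs.trans (integral_mono (i3 i).abs (hr i) fun ω => ?_)
  simp only [hq, abs_mul]
  exact (mul_le_mul_of_nonneg_right (h.abs_le_absSum i ω) (abs_nonneg _)).trans (hrem i ω)

end IsLocalSystem

end LocalDep

/-! ### Smoothed truncation and weighted Taylor bounds -/

namespace LocalDep

section SoftMin

/-- A smooth version of `min w z` at scale `1 / ℓ`. -/
noncomputable def softMin (ℓ z w : ℝ) : ℝ := w - Real.log (1 + Real.exp (ℓ * (w - z))) / ℓ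

variable {ℓ z : ℝ}

lemma one_add_exp_pos (x : ℝ) : 0 < 1 + Real.exp x := by positivity

lemma softMin_le_left (hℓ : 0 < ℓ) (w : ℝ) : softMin ℓ z w ≤ w := by
  have h1 : 0 ≤ Real.log (1 + Real.exp (ℓ * (w - z))) :=
    Real.log_nonneg (by linarith [Real.exp_pos (ℓ * (w - z))])
  have : 0 ≤ Real.log (1 + Real.exp (ℓ * (w - z))) / ℓ := by positivity
  unfold softMin
  linarith

lemma softMin_le_right (hℓ : 0 < ℓ) (w : ℝ) : softMin ℓ z w ≤ z := by
  have h1 : ℓ * (w - z) ≤ Real.log (1 + Real.exp (ℓ * (w - z))) := by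
    rw [Real.le_log_iff_exp_le (one_add_exp_pos _)]
    linarith
  have : w - z ≤ Real.log (1 + Real.exp (ℓ * (w - z))) / ℓ := by
    rw [le_div_iff₀ hℓ]; linarith
  unfold softMin
  linarith

/-- The inequality used is 1 + eˣ ≤ e · exp(max(x, 0)), with loss 1 in the exponent, hence 1/ℓ after
rescaling. -/
lemma min_sub_le_softMin (hℓ : 0 < ℓ) (w : ℝ) : min w z - 1 / ℓ ≤ softMin ℓ z w := by
  have hkey : Real.log (1 + Real.exp (ℓ * (w - z))) ≤ 1 + ℓ * (w - min w z) := by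
    rw [Real.log_le_iff_le_exp (one_add_exp_pos _), Real.exp_add]
    have he : (2 : ℝ) ≤ Real.exp 1 := by linarith [Real.add_one_le_exp (1 : ℝ)]
    have h1 : 1 ≤ Real.exp (ℓ * (w - min w z)) :=
      Real.one_le_exp (mul_nonneg hℓ.le (by linarith [min_le_left w z]))
    have h2 : Real.exp (ℓ * (w - z)) ≤ Real.exp (ℓ * (w - min w z)) := by
      have := min_le_right w z
      gcongr
    nlinarith
  have h3 : Real.log (1 + Real.exp (ℓ * (w - z))) / ℓ ≤ 1 / ℓ + (w - min w z) := by
    rw [div_le_iff₀ hℓ]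
    calc _ ≤ _ := hkey
      _ = _ := by field_simp
  unfold softMin
  linarith

lemma hasDerivAt_softMin (hℓ : 0 < ℓ) (w : ℝ) :
    HasDerivAt (softMin ℓ z) (1 / (1 + Real.exp (ℓ * (w - z)))) w := by
  have h1 : HasDerivAt (fun w => ℓ * (w - z)) ℓ w := by
    simpa using ((hasDerivAt_id w).sub_const z).const_mul ℓ
  have h2 := ((h1.exp.const_add 1).log (one_add_exp_pos _).ne').div_const ℓ
  have h3 := (hasDerivAt_id w).sub h2
  refine h3.congr_deriv ?_
  have := one_add_exp_pos (ℓ * (w - z))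
  field_simp
  ring

lemma one_add_exp_le (x y : ℝ) : 1 + Real.exp x ≤ Real.exp |x - y| * (1 + Real.exp y) := by
  have h1 : 1 ≤ Real.exp |x - y| := Real.one_le_exp (abs_nonneg _)
  have h2 : Real.exp x ≤ Real.exp |x - y| * Real.exp y := by
    rw [← Real.exp_add]
    exact Real.exp_le_exp.2 (by linarith [le_abs_self (x - y)])
  linarith

/-- The symmetric form -ℓ⁻¹ log(e^{-ℓw} + e^{-ℓz}) exhibits the Lipschitz constant 1: a shift by v
changes the first exponential by a factor at most e^{ℓ|v|}. -/
lemma softMin_add_le (hℓ : 0 < ℓ) (w v : ℝ) : softMin ℓ z (w + v) ≤ softMin ℓ z w + |v| := by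
  have hconv : ∀ w, softMin ℓ z w = -(Real.log (Real.exp (-(ℓ * w)) + Real.exp (-(ℓ * z)))) / ℓ := by
    intro w
    have h1 : Real.exp (-(ℓ * w)) + Real.exp (-(ℓ * z)) =
        Real.exp (-(ℓ * w)) * (1 + Real.exp (ℓ * (w - z))) := by
      rw [mul_add, mul_one, ← Real.exp_add]; ring_nf
    rw [h1, Real.log_mul (Real.exp_pos _).ne' (one_add_exp_pos _).ne', Real.log_exp, softMin]
    field_simp
    ring
  rw [hconv, hconv, div_add' _ _ _ hℓ.ne']
  refine div_le_div_of_nonneg_right ?_ hℓ.le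
  have h2 : Real.log (Real.exp (-(ℓ * w)) + Real.exp (-(ℓ * z))) ≤
      ℓ * |v| + Real.log (Real.exp (-(ℓ * (w + v))) + Real.exp (-(ℓ * z))) := by
    rw [Real.log_le_iff_le_exp (by positivity), Real.exp_add, Real.exp_log (by positivity),
      mul_add, ← Real.exp_add, ← Real.exp_add]
    have := neg_abs_le v
    have := le_abs_self v
    gcongr <;> nlinarith [abs_nonneg v]
  linarith

lemma abs_softMin_le (hℓ : 1 ≤ ℓ) (hz : 0 ≤ z) (w : ℝ) : |softMin ℓ z w| ≤ |w| + 1 := by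
  have h1 := softMin_le_left (z := z) (by linarith : 0 < ℓ) w
  have h2 := min_sub_le_softMin (z := z) (by linarith : 0 < ℓ) w
  have h3 : 1 / ℓ ≤ 1 := by rw [div_le_one (by linarith)]; exact hℓ
  have h4 : -|w| ≤ min w z := le_min (neg_abs_le w) (by linarith [abs_nonneg w])
  rw [abs_le]
  constructor <;> linarith [le_abs_self w]

lemma continuous_softMin (hℓ : 0 < ℓ) : Continuous (softMin ℓ z) :=
  continuous_iff_continuousAt.2 fun w => (hasDerivAt_softMin hℓ w).continuousAt

/-- The function `exp (t · softMin)`. -/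
noncomputable def tilt (ℓ z t w : ℝ) : ℝ := Real.exp (t * softMin ℓ z w)

/-- The derivative of `tilt`. -/
noncomputable def tiltDeriv (ℓ z t w : ℝ) : ℝ := t * tilt ℓ z t w / (1 + Real.exp (ℓ * (w - z)))

variable {t : ℝ}

lemma tilt_pos (ℓ z t w : ℝ) : 0 < tilt ℓ z t w := Real.exp_pos _

lemma hasDerivAt_tilt (hℓ : 0 < ℓ) (w : ℝ) :
    HasDerivAt (tilt ℓ z t) (tiltDeriv ℓ z t w) w := by
  refine ((hasDerivAt_softMin (z := z) hℓ w).const_mul t).exp.congr_deriv ?_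
  simp only [tiltDeriv, tilt]
  ring

lemma continuous_tilt (hℓ : 0 < ℓ) : Continuous (tilt ℓ z t) :=
  Real.continuous_exp.comp ((continuous_softMin hℓ).const_mul t)

lemma continuous_tiltDeriv (hℓ : 0 < ℓ) : Continuous (tiltDeriv ℓ z t) := by
  unfold tiltDeriv
  refine ((continuous_tilt hℓ).const_mul t).div (by fun_prop) fun w => (one_add_exp_pos _).ne'

lemma tilt_le (hℓ : 0 < ℓ) (ht : 0 ≤ t) (w : ℝ) : tilt ℓ z t w ≤ Real.exp (t * z) :=
  Real.exp_le_exp.2 (mul_le_mul_of_nonneg_left (softMin_le_right hℓ w) ht)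

lemma tilt_add_le (hℓ : 0 < ℓ) (ht : 0 ≤ t) (w v : ℝ) :
    tilt ℓ z t (w + v) ≤ Real.exp (t * |v|) * tilt ℓ z t w := by
  rw [tilt, tilt, ← Real.exp_add]
  refine Real.exp_le_exp.2 ?_
  nlinarith [softMin_add_le (z := z) hℓ w v]

lemma tiltDeriv_nonneg (ht : 0 ≤ t) (w : ℝ) : 0 ≤ tiltDeriv ℓ z t w := by
  have := tilt_pos ℓ z t w
  unfold tiltDeriv; positivity

lemma tiltDeriv_le (ht : 0 ≤ t) (w : ℝ) : tiltDeriv ℓ z t w ≤ t * tilt ℓ z t w := by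
  have := tilt_pos ℓ z t w
  exact div_le_self (by positivity) (by linarith [Real.exp_pos (ℓ * (w - z))])

/-- The tilt contributes the rate t ≤ ℓ and the logistic denominator another ℓ. This is the reason
for a smooth minimum: the derivative of exp(t min(w, z)) drops to zero at z when t > 0 and is not
log-Lipschitz. -/
lemma tiltDeriv_add_le (hℓ : 0 < ℓ) (ht : 0 ≤ t) (htℓ : t ≤ ℓ) (w v : ℝ) :
    tiltDeriv ℓ z t (w + v) ≤ Real.exp (2 * ℓ * |v|) * tiltDeriv ℓ z t w := by
  have h0 := tilt_pos ℓ z t w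
  have h1 := tilt_add_le (z := z) hℓ ht w v
  have h2 := one_add_exp_le (ℓ * (w - z)) (ℓ * (w + v - z))
  rw [show ℓ * (w - z) - ℓ * (w + v - z) = -(ℓ * v) by ring, abs_neg, abs_mul, abs_of_pos hℓ] at h2
  have h3 : Real.exp (t * |v|) ≤ Real.exp (ℓ * |v|) := by gcongr
  unfold tiltDeriv
  rw [div_le_iff₀ (one_add_exp_pos _)]
  have hp := one_add_exp_pos (ℓ * (w - z))
  have hp' := one_add_exp_pos (ℓ * (w + v - z))
  have h4 : 1 ≤ Real.exp (ℓ * |v|) * (1 + Real.exp (ℓ * (w + v - z))) /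
      (1 + Real.exp (ℓ * (w - z))) := by rwa [le_div_iff₀ hp, one_mul]
  calc t * tilt ℓ z t (w + v) ≤ t * (Real.exp (ℓ * |v|) * tilt ℓ z t w) * 1 := by
        rw [mul_one]
        gcongr
        exact h1.trans (by gcongr)
    _ ≤ t * (Real.exp (ℓ * |v|) * tilt ℓ z t w) *
        (Real.exp (ℓ * |v|) * (1 + Real.exp (ℓ * (w + v - z))) / (1 + Real.exp (ℓ * (w - z)))) := by
        gcongr
    _ = _ := by
        rw [show 2 * ℓ * |v| = ℓ * |v| + ℓ * |v| by ring, Real.exp_add]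
        ring

end SoftMin

section MeanValue

lemma abs_sub_le_of_log_lipschitz {D : ℝ → ℝ} {lam : ℝ} (hlam : 0 ≤ lam) (hD : ∀ w, 0 ≤ D w)
    (hlip : ∀ w v, D (w + v) ≤ Real.exp (lam * |v|) * D w) {w y d : ℝ} (hy : |y - w| ≤ d) :
    |D y - D w| ≤ lam * d * Real.exp (lam * d) * D w := by
  have hd : 0 ≤ d := (abs_nonneg _).trans hy
  have hld : 0 ≤ lam * d := by positivity
  have hmono : Real.exp (lam * |y - w|) ≤ Real.exp (lam * d) := by gcongr
  have h1 : D y ≤ Real.exp (lam * d) * D w := by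
    have := hlip w (y - w)
    rw [add_sub_cancel] at this
    exact this.trans (mul_le_mul_of_nonneg_right hmono (hD w))
  have h2 : D w ≤ Real.exp (lam * d) * D y := by
    have := hlip y (w - y)
    rw [add_sub_cancel, abs_sub_comm] at this
    exact this.trans (mul_le_mul_of_nonneg_right hmono (hD y))
  have h3 : Real.exp (lam * d) - 1 ≤ lam * d * Real.exp (lam * d) := by
    have h4 := Real.add_one_le_exp (-(lam * d))
    have h5 : Real.exp (-(lam * d)) * Real.exp (lam * d) = 1 := by rw [← Real.exp_add]; simp
    nlinarith [Real.exp_pos (lam * d)]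
  have h4 : 1 ≤ Real.exp (lam * d) := Real.one_le_exp hld
  have h6 : (1 - lam * d) * D w ≤ D y := by
    have h5 : Real.exp (-(lam * d)) * D w ≤ D y := by
      rw [Real.exp_neg, inv_mul_le_iff₀ (Real.exp_pos _)]; exact h2
    have := Real.add_one_le_exp (-(lam * d))
    exact (mul_le_mul_of_nonneg_right (by linarith) (hD w)).trans h5
  have h7 : lam * d * D w ≤ lam * d * Real.exp (lam * d) * D w :=
    mul_le_mul_of_nonneg_right (le_mul_of_one_le_right hld h4) (hD w)
  rw [abs_le]
  constructor
  · nlinarith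
  · nlinarith [mul_le_mul_of_nonneg_right h3 (hD w)]

/-- The error is a multiple of `D w` rather than of a supremum, so the Stein remainder is integrated
against the same weight as the main term. -/
lemma taylor_le_of_log_lipschitz {f D : ℝ → ℝ} {lam : ℝ} (hlam : 0 ≤ lam) (hD : ∀ w, 0 ≤ D w)
    (hlip : ∀ w v, D (w + v) ≤ Real.exp (lam * |v|) * D w) (hf : ∀ w, HasDerivAt f (D w) w)
    (w w' : ℝ) :
    |f w - f w' - (w - w') * D w| ≤
      lam * |w - w'| ^ 2 * Real.exp (lam * |w - w'|) * D w := by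
  have h1 := (convex_uIcc w' w).norm_image_sub_le_of_norm_hasDerivWithin_le
    (f := fun y => f y - y * D w) (f' := fun y => D y - D w)
    (C := lam * |w - w'| * Real.exp (lam * |w - w'|) * D w)
    (fun y _ => by
      have := (hf y).sub ((hasDerivAt_id y).mul_const (D w))
      exact (this.congr_deriv (by simp)).hasDerivWithinAt)
    (fun y hy => abs_sub_le_of_log_lipschitz hlam hD hlip (by
      have := Set.abs_sub_right_of_mem_uIcc hy
      rw [abs_sub_comm]; exact this))
    Set.left_mem_uIcc Set.right_mem_uIcc
  simp only [Real.norm_eq_abs] at h1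
  calc |f w - f w' - (w - w') * D w| = |f w - w * D w - (f w' - w' * D w)| := by ring_nf
    _ ≤ _ := h1
    _ = _ := by ring

end MeanValue

end LocalDep

/-! ### Consequences of the moderate-deviation range -/

namespace LocalDep

/-- A local system together with a level `z` in the range of moderate deviations; here
`ν = θ²` and `ℓ = max 1 z`. -/
structure IsModerate {Ω J : Type*} [MeasurableSpace Ω] [Fintype J] (P : Measure Ω)
    (X : J → Ω → ℝ) (A B : J → Finset J) (a b ν ℓ z : ℝ) : Prop
    extends IsLocalSystem P X A B a b where
  card_mul : Fintype.card J * b = ν * a ^ 2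
  nonneg : 0 ≤ z
  eq_max : ℓ = max 1 z
  small : kappa B * ν / a * ℓ ^ 3 ≤ 1 / 10 ^ 8

lemma cube_le_mul_exp {x : ℝ} (hx : 0 ≤ x) : x ^ 3 ≤ 196608 * Real.exp (x / 32) := by
  have h := Real.pow_div_factorial_le_exp (x / 32) (by positivity) 3
  norm_num [Nat.factorial] at h
  linarith

lemma sq_le_mul_exp {x : ℝ} (hx : 0 ≤ x) : x ^ 2 ≤ 2048 * Real.exp (x / 32) := by
  have h := Real.pow_div_factorial_le_exp (x / 32) (by positivity) 2
  norm_num [Nat.factorial] at h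
  linarith

namespace IsModerate

variable {Ω J : Type*} [MeasurableSpace Ω] [Fintype J] {P : Measure Ω}
  {X : J → Ω → ℝ} {A B : J → Finset J} {a b ν ℓ z M : ℝ} {g : ℝ → ℝ}

lemma one_le_level (h : IsModerate P X A B a b ν ℓ z) : 1 ≤ ℓ := h.eq_max ▸ le_max_left _ _

lemma le_level (h : IsModerate P X A B a b ν ℓ z) : z ≤ ℓ := h.eq_max ▸ le_max_right _ _

lemma kappa_mul_nu_mul_le (h : IsModerate P X A B a b ν ℓ z) :
    kappa B * ν * ℓ ^ 3 ≤ a / 10 ^ 8 := by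
  have h1 := h.small
  have ha := h.a_pos
  rw [div_mul_eq_mul_div, div_le_iff₀ ha] at h1
  linarith

/-- The weight's exponent aS/16 is spent in two halves of aS/32: one absorbs the cube, with 196608 =
3! · 32³, and the other the factor exp(lam · S). -/
lemma cube_absSum_mul_exp_le (h : IsModerate P X A B a b ν ℓ z) {lam : ℝ} (hlam : lam ≤ a / 32)
    (s : Finset J) (ω : Ω) :
    absSum X s ω ^ 3 * Real.exp (lam * absSum X s ω) ≤ 196608 / a ^ 3 * wt X a s ω := by
  have ha := h.a_pos
  have hS := absSum_nonneg X s ω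
  have h1 := cube_le_mul_exp (x := a * absSum X s ω) (by positivity)
  have h2 : Real.exp (lam * absSum X s ω) ≤ Real.exp (a * absSum X s ω / 32) := by
    refine Real.exp_le_exp.2 ?_
    nlinarith
  have h3 : wt X a s ω =
      Real.exp (a * absSum X s ω / 32) * Real.exp (a * absSum X s ω / 32) := by
    rw [wt, ← Real.exp_add]; congr 1; ring
  rw [div_mul_eq_mul_div, le_div_iff₀ (by positivity), h3]
  calc absSum X s ω ^ 3 * Real.exp (lam * absSum X s ω) * a ^ 3
      = (a * absSum X s ω) ^ 3 * Real.exp (lam * absSum X s ω) := by ring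
    _ ≤ (196608 * Real.exp (a * absSum X s ω / 32)) * Real.exp (a * absSum X s ω / 32) := by
        gcongr
    _ = _ := by ring

variable [IsProbabilityMeasure P]

lemma half_le_nu (h : IsModerate P X A B a b ν ℓ z) : 1 / 2 ≤ ν := h.half_le h.card_mul

lemma level_cube_le (h : IsModerate P X A B a b ν ℓ z) : ℓ ^ 3 ≤ a / (5 * 10 ^ 7) := by
  have h1 := h.kappa_mul_nu_mul_le
  have h2 := h.one_le_kappa
  have h3 := h.half_le_nu
  have h4 := h.one_le_level
  have h5 : (1 : ℝ) / 2 ≤ kappa B * ν := by nlinarith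
  have h6 : 1 / 2 * ℓ ^ 3 ≤ kappa B * ν * ℓ ^ 3 := by gcongr
  linarith

lemma nu_le (h : IsModerate P X A B a b ν ℓ z) : ν ≤ a := by
  have h1 := h.kappa_mul_nu_mul_le
  have h2 := h.one_le_kappa
  have h3 := h.half_le_nu
  have h4 := one_le_pow₀ (n := 3) h.one_le_level
  have h5 : 1 * ν * 1 ≤ kappa B * ν * ℓ ^ 3 := by gcongr
  have := h.a_pos
  linarith

lemma level_le (h : IsModerate P X A B a b ν ℓ z) : ℓ ≤ a / (5 * 10 ^ 7) := by
  have h1 := h.level_cube_le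
  have h2 := h.one_le_level
  have : ℓ ≤ ℓ ^ 3 := le_self_pow₀ h2 (by norm_num)
  linarith

/-- Put y = a/ℓ. Smallness gives y ≥ 5 · 10⁷, ℓ² ≤ y/8 and a ≤ y², so the expression is at most 3 y⁶
exp(-3y/8) ≤ 1. The prefactor 3 exp(ℓ²) bounds every test function used below, and a³ is included
because it dominates n. -/
lemma exp_tail_le (h : IsModerate P X A B a b ν ℓ z) :
    3 * Real.exp (ℓ ^ 2) * Real.exp (-(a / (2 * ℓ))) * a ^ 3 ≤ 1 := by
  have hℓ := h.one_le_level
  have hℓ0 : 0 < ℓ := by linarith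
  have ha := h.a_pos
  have hc := h.level_cube_le
  set y := a / ℓ with hy
  have hay : a = y * ℓ := by rw [hy]; field_simp
  have hy1 : 5 * 10 ^ 7 ≤ y := by
    rw [hy, le_div_iff₀ hℓ0]; linarith [h.level_le]
  have h1 : ℓ ^ 2 ≤ y / 8 := by
    have : ℓ ^ 2 * ℓ ≤ y / 8 * ℓ := by nlinarith
    exact le_of_mul_le_mul_right this hℓ0
  have h2 : a / (2 * ℓ) = y / 2 := by rw [hy]; field_simp
  have h3 : a ^ 3 ≤ y ^ 6 := by
    have h4 : ℓ ≤ y := by nlinarith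
    have h5 : a ≤ y ^ 2 := by rw [hay]; nlinarith
    calc a ^ 3 ≤ (y ^ 2) ^ 3 := pow_le_pow_left₀ ha.le h5 3
      _ = _ := by ring
  have h6 : 3 * y ^ 6 ≤ Real.exp (3 * y / 8) := by
    have h7 := Real.pow_div_factorial_le_exp (3 * y / 8) (by positivity) 7
    norm_num [Nat.factorial] at h7
    refine le_trans ?_ h7
    have : (3 * y / 8) ^ 7 / 5040 = y ^ 6 * (y * (2187 / 10569646080)) := by ring
    rw [this]
    have hy6 : 0 ≤ y ^ 6 := by positivity
    nlinarith
  rw [h2]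
  calc 3 * Real.exp (ℓ ^ 2) * Real.exp (-(y / 2)) * a ^ 3
      ≤ 3 * Real.exp (y / 8) * Real.exp (-(y / 2)) * y ^ 6 := by gcongr
    _ = (3 * y ^ 6) * Real.exp (-(3 * y / 8)) := by
        rw [mul_assoc 3, ← Real.exp_add, show y / 8 + -(y / 2) = -(3 * y / 8) by ring]; ring
    _ ≤ Real.exp (3 * y / 8) * Real.exp (-(3 * y / 8)) := by gcongr
    _ = 1 := by rw [← Real.exp_add]; simp

lemma card_le (h : IsModerate P X A B a b ν ℓ z) : (Fintype.card J : ℝ) ≤ a ^ 3 := by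
  have h1 := h.card_mul
  have h2 := h.nu_le
  have hb := h.one_le_b
  have ha := h.a_pos
  have h3 : (Fintype.card J : ℝ) ≤ Fintype.card J * b :=
    le_mul_of_one_le_right (by positivity) hb
  calc (Fintype.card J : ℝ) ≤ ν * a ^ 2 := by rw [← h1]; exact h3
    _ ≤ a * a ^ 2 := by gcongr
    _ = _ := by ring

lemma eta_card_le (h : IsModerate P X A B a b ν ℓ z) :
    3 * Real.exp (ℓ ^ 2) * Real.exp (-(a / (2 * ℓ))) * Fintype.card J ≤ 1 :=
  (mul_le_mul_of_nonneg_left h.card_le (by positivity)).trans h.exp_tail_le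

lemma eta_le (h : IsModerate P X A B a b ν ℓ z) :
    3 * Real.exp (ℓ ^ 2) * Real.exp (-(a / (2 * ℓ))) ≤ 1 :=
  le_trans (le_mul_of_one_le_right (by positivity) (one_le_pow₀ h.one_le_a)) h.exp_tail_le

lemma integral_abs_fluct_le (h : IsModerate P X A B a b ν ℓ z)
    (hg : IsTest ℓ (3 * Real.exp (ℓ ^ 2)) g)
    {p : J → Ω → ℝ} (hp : ∀ i, Measurable[sig X (A i)] (p i))
    (hpw : ∀ i ω, |p i ω| ≤ wt X a (A i) ω) :
    ∫ ω, |fluct P p ω| * g (W X ω) ∂P ≤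
      11000 * (a * ℓ * kappa B * ν) * ∫ ω, g (W X ω) ∂P :=
  h.integral_abs_fluct_mul_test_le h.card_mul hg h.one_le_level
    (by have := h.level_le; have := h.a_pos; linarith) h.eta_le h.eta_card_le hp hpw

/-- From x²/2 ≤ eˣ at x = aS/16, the product X_i Y_i scaled by a²/512 lies below the weight, so the
general fluctuation bound applies; 512 · 11000 = 5632000. -/
lemma integral_abs_fluct_localProd_le (h : IsModerate P X A B a b ν ℓ z)
    (hg : IsTest ℓ (3 * Real.exp (ℓ ^ 2)) g) :
    ∫ ω, |fluct P (localProd X A) ω| * g (W X ω) ∂P ≤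
      6000000 * (ℓ * (kappa B * ν / a)) * ∫ ω, g (W X ω) ∂P := by
  have ha := h.a_pos
  have h1 := h.integral_abs_fluct_le hg (p := fun i ω => a ^ 2 / 512 * localProd X A i ω)
    (fun i => (h.measurable_localProd_sig i).const_mul _) (fun i ω => by
      have hS := absSum_nonneg X (A i) ω
      have h2 := Real.pow_div_factorial_le_exp (a * absSum X (A i) ω / 16) (by positivity) 2
      norm_num [Nat.factorial] at h2
      rw [abs_mul, abs_of_nonneg (by positivity)]
      calc a ^ 2 / 512 * |localProd X A i ω| ≤ a ^ 2 / 512 * absSum X (A i) ω ^ 2 := by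
            gcongr; exact h.abs_localProd_le i ω
        _ = (a * absSum X (A i) ω / 16) ^ 2 / 2 := by ring
        _ ≤ _ := h2)
  have h3 : ∀ ω, |fluct P (fun i ω => a ^ 2 / 512 * localProd X A i ω) ω| * g (W X ω) =
      a ^ 2 / 512 * (|fluct P (localProd X A) ω| * g (W X ω)) := fun ω => by
    simp only [fluct, integral_const_mul, ← mul_sub, ← Finset.mul_sum]
    rw [abs_mul, abs_of_nonneg (by positivity), mul_assoc]
  simp only [h3] at h1
  rw [integral_const_mul] at h1
  have hG : 0 ≤ ∫ ω, g (W X ω) ∂P := integral_nonneg fun ω => (hg.pos _).le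
  have hν := h.half_le_nu
  have hℓ := h.one_le_level
  calc ∫ ω, |fluct P (localProd X A) ω| * g (W X ω) ∂P
      = 512 / a ^ 2 * (a ^ 2 / 512 * ∫ ω, |fluct P (localProd X A) ω| * g (W X ω) ∂P) := by
        field_simp
    _ ≤ 512 / a ^ 2 * (11000 * (a * ℓ * kappa B * ν) * ∫ ω, g (W X ω) ∂P) := by gcongr
    _ = 5632000 * (ℓ * (kappa B * ν / a)) * ∫ ω, g (W X ω) ∂P := by field_simp; ring
    _ ≤ _ := by gcongr; norm_num

lemma integral_abs_fluct_wt_le (h : IsModerate P X A B a b ν ℓ z)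
    (hg : IsTest ℓ (3 * Real.exp (ℓ ^ 2)) g) :
    ∫ ω, |fluct P (fun i => wt X a (A i)) ω| * g (W X ω) ∂P ≤
      11000 * (a * ℓ * kappa B * ν) * ∫ ω, g (W X ω) ∂P :=
  h.integral_abs_fluct_le hg (fun _ => wt_measurable_sig X a le_rfl) fun i ω => by
    rw [abs_of_pos (wt_pos _ _ _ _)]

lemma integral_sum_wt_mul_le (h : IsModerate P X A B a b ν ℓ z)
    (hg : IsTest ℓ (3 * Real.exp (ℓ ^ 2)) g) :
    ∫ ω, (∑ i, wt X a (A i) ω) * g (W X ω) ∂P ≤ 57 * (ν * a ^ 2) * ∫ ω, g (W X ω) ∂P := by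
  have hb1 := h.one_le_b
  have ha := h.a_pos
  set β := b ^ (1 / 16 : ℝ) with hβdef
  have hβ : 1 ≤ β := Real.one_le_rpow hb1 (by norm_num)
  have hb : β ^ 16 = b := by
    rw [hβdef, ← Real.rpow_natCast, ← Real.rpow_mul (by linarith)]; norm_num
  have hG : 0 ≤ ∫ ω, g (W X ω) ∂P := integral_nonneg fun ω => (hg.pos _).le
  simp only [Finset.sum_mul]
  rw [integral_finsetSum _ fun i _ => h.integrable ((h.controlled_wt' i).mul (h.controlled_test hg))]
  calc ∑ i, ∫ ω, wt X a (A i) ω * g (W X ω) ∂P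
      ≤ ∑ _i : J, 57 * b * ∫ ω, g (W X ω) ∂P := by
        refine Finset.sum_le_sum fun i _ => ?_
        have h1 := h.integral_mul_test_le hβ hb hg (by linarith [h.one_le_level]) h.eta_le i
          (D := 1) (wt_measurable_sig X a le_rfl) (fun ω => (wt_pos _ _ _ _).le) (fun ω => by
            rw [one_mul]
            exact (wt_mono X ha.le (h.subset i) ω).trans
              (le_self_pow₀ (one_le_wt X ha.le _ ω) (by norm_num)))
        refine h1.trans (mul_le_mul_of_nonneg_right ?_ hG)
        have : β ^ 12 ≤ b := by rw [← hb]; exact pow_le_pow_right₀ hβ (by norm_num)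
        linarith
    _ = 57 * (Fintype.card J * b) * ∫ ω, g (W X ω) ∂P := by
        rw [Finset.sum_const, Finset.card_univ, nsmul_eq_mul]; ring
    _ = _ := by rw [h.card_mul]

/-- Separation of a local exponential weight from an arbitrary bounded nonnegative function. -/
lemma integral_sum_wt_mul_le_add (h : IsModerate P X A B a b ν ℓ z) {L : ℝ → ℝ} {K : ℝ}
    (hL : Measurable L) (hL0 : ∀ w, 0 ≤ L w) (hLK : ∀ w, L w ≤ K) :
    ∫ ω, (∑ i, wt X a (A i) ω) * L (W X ω) ∂P ≤ ν * a ^ 2 * ∫ ω, L (W X ω) ∂P +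
      ∫ ω, |fluct P (fun i => wt X a (A i)) ω| * L (W X ω) ∂P := by
  have hLW : Controlled X B a 0 (fun ω => L (W X ω)) :=
    Controlled.of_bounded (hL.comp h.measurable_W) K fun ω => by
      rw [abs_of_nonneg (hL0 _)]; exact hLK _
  have hfl : Controlled X B a 1 (fluct P (fun i => wt X a (A i))) :=
    controlled_fluct h.controlled_wt'
  have ha := h.a_pos
  have hmean : ∑ i, ∫ ω, wt X a (A i) ω ∂P ≤ ν * a ^ 2 := by
    rw [← h.card_mul]
    calc ∑ i, ∫ ω, wt X a (A i) ω ∂P ≤ ∑ _i : J, b := by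
          refine Finset.sum_le_sum fun i _ => le_trans ?_ (h.integral_exp_le i)
          refine integral_mono (h.integrable (h.controlled_wt' i)) (h.integrable_exp i) fun ω => ?_
          simp only [← wt_pow_sixteen]
          exact (wt_mono X ha.le (h.subset i) ω).trans
              (le_self_pow₀ (one_le_wt X ha.le _ ω) (by norm_num))
      _ = _ := by rw [Finset.sum_const, Finset.card_univ, nsmul_eq_mul]
  have hpt : ∀ ω, (∑ i, wt X a (A i) ω) * L (W X ω) ≤
      (∑ i, ∫ ω', wt X a (A i) ω' ∂P) * L (W X ω) +
        |fluct P (fun i => wt X a (A i)) ω| * L (W X ω) := fun ω => by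
    rw [← add_mul]
    refine mul_le_mul_of_nonneg_right ?_ (hL0 _)
    have h1 : fluct P (fun i => wt X a (A i)) ω =
        ∑ i, wt X a (A i) ω - ∑ i, ∫ ω', wt X a (A i) ω' ∂P := by
      rw [fluct, Finset.sum_sub_distrib]
    linarith [le_abs_self (fluct P (fun i => wt X a (A i)) ω)]
  have i1 := h.integrable (hLW.const_mul (∑ i, ∫ ω', wt X a (A i) ω' ∂P))
  have i2 := h.integrable (hfl.abs.mul hLW)
  calc ∫ ω, (∑ i, wt X a (A i) ω) * L (W X ω) ∂P
      ≤ ∫ ω, ((∑ i, ∫ ω', wt X a (A i) ω' ∂P) * L (W X ω) +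
        |fluct P (fun i => wt X a (A i)) ω| * L (W X ω)) ∂P :=
        integral_mono (h.integrable ((Controlled.sum _ fun i _ => h.controlled_wt' i).mul hLW))
          (i1.add i2) hpt
    _ = (∑ i, ∫ ω', wt X a (A i) ω' ∂P) * ∫ ω, L (W X ω) ∂P +
        ∫ ω, |fluct P (fun i => wt X a (A i)) ω| * L (W X ω) ∂P := by
        rw [integral_add i1 i2, integral_const_mul]
    _ ≤ _ := by
        have : 0 ≤ ∫ ω, L (W X ω) ∂P := integral_nonneg fun ω => hL0 _
        gcongr

/-- Stein's identity for test functions with log-Lipschitz derivative. -/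
lemma abs_integral_stein_le_of_log_lipschitz (h : IsModerate P X A B a b ν ℓ z) {f D : ℝ → ℝ}
    {Kf KD lam : ℝ} (hfK : ∀ w, |f w| ≤ Kf) (hD : Measurable D) (hD0 : ∀ w, 0 ≤ D w)
    (hDK : ∀ w, D w ≤ KD) (hlam : 0 ≤ lam) (hlama : lam ≤ a / 32)
    (hlip : ∀ w v, D (w + v) ≤ Real.exp (lam * |v|) * D w) (hf : ∀ w, HasDerivAt f (D w) w) :
    |∫ ω, W X ω * f (W X ω) ∂P - ∫ ω, D (W X ω) ∂P| ≤
      ∫ ω, |fluct P (localProd X A) ω| * D (W X ω) ∂P +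
        196608 * lam / a ^ 3 * ∫ ω, (∑ i, wt X a (A i) ω) * D (W X ω) ∂P := by
  have hDW : Controlled X B a 0 (fun ω => D (W X ω)) :=
    Controlled.of_bounded (hD.comp h.measurable_W) KD fun ω => by
      rw [abs_of_nonneg (hD0 _)]; exact hDK _
  have hfm : Measurable f := (continuous_iff_continuousAt.2 fun w => (hf w).continuousAt).measurable
  have ha := h.a_pos
  have hr : ∀ i, Controlled X B a 1
      (fun ω => 196608 * lam / a ^ 3 * (wt X a (A i) ω * D (W X ω))) := fun i =>
    ((h.controlled_wt' i).mul hDW).const_mul _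
  have h1 := h.abs_integral_stein_le hfm hfK hD (KD := KD)
    (fun w => by rw [abs_of_nonneg (hD0 _)]; exact hDK _) (fun i => h.integrable (hr i))
    (fun i ω => by
      have h2 := taylor_le_of_log_lipschitz hlam hD0 hlip hf (W X ω) (far X A i ω)
      have h3 := W_sub_far X A i ω
      have hS := absSum_nonneg X (A i) ω
      have h4 := h.cube_absSum_mul_exp_le hlama (A i) ω
      have hDp := hD0 (W X ω)
      calc absSum X (A i) ω *
            |f (W X ω) - f (far X A i ω) - (W X ω - far X A i ω) * D (W X ω)|
          ≤ absSum X (A i) ω * (lam * absSum X (A i) ω ^ 2 *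
            Real.exp (lam * absSum X (A i) ω) * D (W X ω)) := by
            refine mul_le_mul_of_nonneg_left (h2.trans ?_) hS
            gcongr
        _ = lam * (absSum X (A i) ω ^ 3 * Real.exp (lam * absSum X (A i) ω)) * D (W X ω) := by
            ring
        _ ≤ lam * (196608 / a ^ 3 * wt X a (A i) ω) * D (W X ω) := by gcongr
        _ = _ := by ring)
  refine h1.trans (add_le_add ?_ (le_of_eq ?_))
  · refine abs_integral_le_integral_abs.trans (le_of_eq (integral_congr_ae
      (Filter.Eventually.of_forall fun ω => ?_)))
    simp only [abs_mul, abs_of_nonneg (hD0 (W X ω))]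
    ring
  · simp only [integral_const_mul, ← Finset.mul_sum, Finset.sum_mul]
    rw [integral_finsetSum _ fun i _ => h.integrable ((h.controlled_wt' i).mul hDW)]

end IsModerate

end LocalDep

/-! ### Truncated exponential moments -/

namespace LocalDep

/-- The tilt alone has no lower bound by 1; adding 1 supplies it and preserves the log-Lipschitz
property. -/
lemma isTest_tilt {ℓ z t : ℝ} (hℓ : 1 ≤ ℓ) (hz : z ≤ ℓ) (ht : 0 ≤ t) (htℓ : t ≤ ℓ) :
    IsTest ℓ (3 * Real.exp (ℓ ^ 2)) (fun w => 1 + tilt ℓ z t w) where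
  meas := measurable_const.add (continuous_tilt (by linarith)).measurable
  one_le w := by linarith [tilt_pos ℓ z t w]
  le w := by
    have h1 := tilt_le (z := z) (by linarith : 0 < ℓ) ht w
    have h2 : Real.exp (t * z) ≤ Real.exp (ℓ ^ 2) := Real.exp_le_exp.2 (by nlinarith)
    have h3 : 1 ≤ Real.exp (ℓ ^ 2) := Real.one_le_exp (by positivity)
    linarith
  lip w v := by
    have h1 := tilt_add_le (z := z) (by linarith : 0 < ℓ) ht w v
    have h2 : Real.exp (t * |v|) ≤ Real.exp (ℓ * |v|) := by gcongr
    have h3 : 1 ≤ Real.exp (ℓ * |v|) := Real.one_le_exp (by positivity)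
    have h4 := tilt_pos ℓ z t w
    nlinarith

namespace IsModerate

variable {Ω J : Type*} [MeasurableSpace Ω] [Fintype J] {P : Measure Ω}
  {X : J → Ω → ℝ} {A B : J → Finset J} {a b ν ℓ z t : ℝ}

lemma level_pos (h : IsModerate P X A B a b ν ℓ z) : 0 < ℓ := by linarith [h.one_le_level]

lemma controlled_tilt (h : IsModerate P X A B a b ν ℓ z) (ht : 0 ≤ t) :
    Controlled X B a 0 (fun ω => tilt ℓ z t (W X ω)) :=
  Controlled.of_bounded ((continuous_tilt h.level_pos).measurable.comp h.measurable_W)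
    (Real.exp (t * z)) fun ω => by
      rw [abs_of_pos (tilt_pos _ _ _ _)]; exact tilt_le h.level_pos ht _

variable [IsProbabilityMeasure P]

lemma integral_one_add_tilt (h : IsModerate P X A B a b ν ℓ z) (ht : 0 ≤ t) :
    ∫ ω, (1 + tilt ℓ z t (W X ω)) ∂P = 1 + ∫ ω, tilt ℓ z t (W X ω) ∂P := by
  rw [integral_add (integrable_const _) (h.integrable (h.controlled_tilt ht))]
  simp

/-- Stein's identity for the tilt: its derivative is at most t times itself, giving the main term.
The two errors total at most 28500000 ℓ² ε (1 + φ), where φ is the mean tilt, and ε ℓ³ ≤ 10⁻⁸ brings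
this below (1 + φ)/ℓ, a perturbation whose integral over t ∈ [0, ℓ] stays bounded. -/
lemma integral_W_mul_tilt_le (h : IsModerate P X A B a b ν ℓ z) (ht : 0 ≤ t) (htℓ : t ≤ ℓ) :
    ∫ ω, W X ω * tilt ℓ z t (W X ω) ∂P ≤ t * ∫ ω, tilt ℓ z t (W X ω) ∂P +
      1 / ℓ * (1 + ∫ ω, tilt ℓ z t (W X ω) ∂P) := by
  have hℓ := h.one_le_level
  have hℓ0 := h.level_pos
  have ha := h.a_pos
  have hg := isTest_tilt hℓ h.le_level ht htℓ
  have hDm : Measurable (tiltDeriv ℓ z t) := (continuous_tiltDeriv hℓ0).measurable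
  have hDK : ∀ w, tiltDeriv ℓ z t w ≤ t * Real.exp (t * z) := fun w =>
    (tiltDeriv_le ht w).trans (mul_le_mul_of_nonneg_left (tilt_le hℓ0 ht w) ht)
  have h1 := h.abs_integral_stein_le_of_log_lipschitz (f := tilt ℓ z t) (D := tiltDeriv ℓ z t)
    (Kf := Real.exp (t * z)) (lam := 2 * ℓ)
    (fun w => by rw [abs_of_pos (tilt_pos _ _ _ _)]; exact tilt_le hℓ0 ht w)
    hDm (tiltDeriv_nonneg ht) hDK
    (by linarith) (by have := h.level_le; linarith) (tiltDeriv_add_le hℓ0 ht htℓ)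
    (hasDerivAt_tilt hℓ0)
  have h2 := (abs_le.1 h1).2
  have hDc : Controlled X B a 0 (fun ω => tiltDeriv ℓ z t (W X ω)) :=
    Controlled.of_bounded (hDm.comp h.measurable_W) (t * Real.exp (t * z)) fun ω => by
      rw [abs_of_nonneg (tiltDeriv_nonneg ht _)]; exact hDK _
  have hDg : ∀ w, tiltDeriv ℓ z t w ≤ ℓ * (1 + tilt ℓ z t w) := fun w => by
    have := tiltDeriv_le (ℓ := ℓ) (z := z) ht w
    have := tilt_pos ℓ z t w
    nlinarith
  have hgc := h.controlled_test hg
  have e1 : ∫ ω, tiltDeriv ℓ z t (W X ω) ∂P ≤ t * ∫ ω, tilt ℓ z t (W X ω) ∂P := by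
    rw [← integral_const_mul]
    exact integral_mono (h.integrable hDc) (h.integrable ((h.controlled_tilt ht).const_mul t))
      fun ω => tiltDeriv_le ht _
  have hfl : Controlled X B a 2 (fluct P (localProd X A)) := controlled_fluct h.controlled_localProd
  have e2 : ∫ ω, |fluct P (localProd X A) ω| * tiltDeriv ℓ z t (W X ω) ∂P ≤
      ℓ * ∫ ω, |fluct P (localProd X A) ω| * (1 + tilt ℓ z t (W X ω)) ∂P := by
    rw [← integral_const_mul]
    refine integral_mono (h.integrable (hfl.abs.mul hDc))
      (h.integrable ((hfl.abs.mul hgc).const_mul ℓ)) fun ω => ?_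
    have := mul_le_mul_of_nonneg_left (hDg (W X ω)) (abs_nonneg (fluct P (localProd X A) ω))
    simp only
    linarith
  have hwc : Controlled X B a 1 (fun ω => ∑ i, wt X a (A i) ω) :=
    Controlled.sum _ fun i _ => h.controlled_wt' i
  have e3 : ∫ ω, (∑ i, wt X a (A i) ω) * tiltDeriv ℓ z t (W X ω) ∂P ≤
      ℓ * ∫ ω, (∑ i, wt X a (A i) ω) * (1 + tilt ℓ z t (W X ω)) ∂P := by
    rw [← integral_const_mul]
    refine integral_mono (h.integrable (hwc.mul hDc))
      (h.integrable ((hwc.mul hgc).const_mul ℓ)) fun ω => ?_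
    have := mul_le_mul_of_nonneg_left (hDg (W X ω))
      (Finset.sum_nonneg fun i (_ : i ∈ Finset.univ) => (wt_pos X a (A i) ω).le)
    simp only
    linarith
  have f2 := h.integral_abs_fluct_localProd_le hg
  have f3 := h.integral_sum_wt_mul_le hg
  rw [h.integral_one_add_tilt ht] at f2 f3
  set φ := ∫ ω, tilt ℓ z t (W X ω) ∂P
  have hφ : 0 ≤ φ := integral_nonneg fun ω => (tilt_pos _ _ _ _).le
  have hκ := h.one_le_kappa
  have hν := h.half_le_nu
  have hs := h.small
  set ε := kappa B * ν / a with hε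
  have hνa : ν / a ≤ ε := by
    rw [hε]; gcongr
    exact le_mul_of_one_le_left (by linarith) hκ
  have g2 : ∫ ω, |fluct P (localProd X A) ω| * tiltDeriv ℓ z t (W X ω) ∂P ≤
      6000000 * (ℓ ^ 2 * ε) * (1 + φ) := by
    refine e2.trans ?_
    calc _ ≤ ℓ * (6000000 * (ℓ * ε) * (1 + φ)) := by gcongr
      _ = _ := by ring
  have g3 : 196608 * (2 * ℓ) / a ^ 3 * ∫ ω, (∑ i, wt X a (A i) ω) * tiltDeriv ℓ z t (W X ω) ∂P ≤
      22500000 * (ℓ ^ 2 * ε) * (1 + φ) := by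
    calc _ ≤ 196608 * (2 * ℓ) / a ^ 3 * (ℓ * (57 * (ν * a ^ 2) * (1 + φ))) := by
          gcongr
          exact e3.trans (by gcongr)
      _ = 22413312 * (ℓ ^ 2 * (ν / a)) * (1 + φ) := by field_simp; ring
      _ ≤ _ := by gcongr; norm_num
  have g4 : 28500000 * (ℓ ^ 2 * ε) ≤ 1 / ℓ := by
    rw [le_div_iff₀ hℓ0]
    nlinarith
  have g5 := mul_le_mul_of_nonneg_right g4 (by linarith : 0 ≤ 1 + φ)
  linarith

lemma continuousOn_integral_tilt (h : IsModerate P X A B a b ν ℓ z) :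
    ContinuousOn (fun t => ∫ ω, tilt ℓ z t (W X ω) ∂P) (Set.Icc 0 ℓ) := by
  have hℓ0 := h.level_pos
  refine continuousOn_of_dominated (bound := fun _ => Real.exp (ℓ * ℓ))
    (fun t ht => ((continuous_tilt hℓ0).measurable.comp h.measurable_W).aestronglyMeasurable)
    (fun t ht => Filter.Eventually.of_forall fun ω => ?_) (integrable_const _)
    (Filter.Eventually.of_forall fun ω => ?_)
  · rw [Real.norm_of_nonneg (tilt_pos _ _ _ _).le]
    refine (tilt_le hℓ0 ht.1 _).trans (Real.exp_le_exp.2 ?_)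
    exact mul_le_mul ht.2 h.le_level h.nonneg hℓ0.le
  · simp only [tilt]
    fun_prop

lemma hasDerivAt_integral_tilt (h : IsModerate P X A B a b ν ℓ z) (ht : t ∈ Set.Ioo 0 ℓ) :
    HasDerivAt (fun t => ∫ ω, tilt ℓ z t (W X ω) ∂P)
      (∫ ω, softMin ℓ z (W X ω) * tilt ℓ z t (W X ω) ∂P) t := by
  have hℓ0 := h.level_pos
  have hsm : Measurable fun ω => softMin ℓ z (W X ω) :=
    (continuous_softMin hℓ0).measurable.comp h.measurable_W
  have htm : ∀ t, Measurable fun ω => tilt ℓ z t (W X ω) := fun t =>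
    (continuous_tilt hℓ0).measurable.comp h.measurable_W
  refine (hasDerivAt_integral_of_dominated_loc_of_deriv_le (s := Set.Ioo 0 ℓ)
    (bound := fun ω => (|W X ω| + 1) * Real.exp (ℓ * ℓ))
    (F' := fun t ω => softMin ℓ z (W X ω) * tilt ℓ z t (W X ω))
    (isOpen_Ioo.mem_nhds ht) (Filter.Eventually.of_forall fun t => (htm t).aestronglyMeasurable)
    (h.integrable (h.controlled_tilt ht.1.le)) (hsm.mul (htm t)).aestronglyMeasurable
    (Filter.Eventually.of_forall fun ω x hx => ?_) ?_
    (Filter.Eventually.of_forall fun ω x _ => ?_)).2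
  · rw [norm_mul, Real.norm_eq_abs, Real.norm_of_nonneg (tilt_pos _ _ _ _).le]
    refine mul_le_mul (abs_softMin_le h.one_le_level h.nonneg _) ?_ (tilt_pos _ _ _ _).le
      (by positivity)
    · refine (tilt_le hℓ0 hx.1.le _).trans (Real.exp_le_exp.2 ?_)
      exact mul_le_mul hx.2.le h.le_level h.nonneg hℓ0.le
  · exact h.integrable ((h.controlled_W.abs.add (Controlled.const 1)).mul
      (Controlled.const (Real.exp (ℓ * ℓ))))
  · have := ((hasDerivAt_id x).mul_const (softMin ℓ z (W X ω))).exp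
    refine this.congr_deriv ?_
    simp only [tilt, id]
    ring

/-- Gaussian bound for the truncated moment generating function. -/
lemma one_add_integral_tilt_le (h : IsModerate P X A B a b ν ℓ z) (ht : 0 ≤ t) (htℓ : t ≤ ℓ) :
    1 + ∫ ω, tilt ℓ z t (W X ω) ∂P ≤ 6 * Real.exp (t ^ 2 / 2) := by
  have hℓ0 := h.level_pos
  set φ : ℝ → ℝ := fun t => ∫ ω, tilt ℓ z t (W X ω) ∂P with hφdef
  have hφ0 : ∀ t, 0 ≤ φ t := fun t => integral_nonneg fun ω => (tilt_pos _ _ _ _).le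
  have hder : ∀ t ∈ Set.Ioo 0 ℓ, HasDerivAt
      (fun t => (1 + φ t) * Real.exp (-(t ^ 2 / 2 + t / ℓ)))
      ((∫ ω, softMin ℓ z (W X ω) * tilt ℓ z t (W X ω) ∂P) * Real.exp (-(t ^ 2 / 2 + t / ℓ)) +
        (1 + φ t) * (Real.exp (-(t ^ 2 / 2 + t / ℓ)) * (-(t + 1 / ℓ)))) t := fun t ht => by
    have h1 : HasDerivAt (fun t : ℝ => -(t ^ 2 / 2 + t / ℓ)) (-(t + 1 / ℓ)) t := by
      have := (((hasDerivAt_id t).pow 2).div_const 2).add ((hasDerivAt_id t).div_const ℓ)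
      refine this.neg.congr_deriv ?_
      simp
    exact ((h.hasDerivAt_integral_tilt ht).const_add 1).mul h1.exp
  -- Since softMin ≤ W, the previous estimate gives φ' ≤ (t + 1/ℓ)(1 + φ), so this product decreases
  -- from its value 2 at t = 0. Undoing the factor exp(t/ℓ) ≤ 3 yields the constant 6.
  have hanti : AntitoneOn (fun t => (1 + φ t) * Real.exp (-(t ^ 2 / 2 + t / ℓ)))
      (Set.Icc 0 ℓ) := by
    refine antitoneOn_of_deriv_nonpos (convex_Icc 0 ℓ) ?_ ?_ ?_
    · exact (continuousOn_const.add h.continuousOn_integral_tilt).mul (by fun_prop)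
    · rw [interior_Icc]
      exact fun t ht => (hder t ht).differentiableAt.differentiableWithinAt
    · rw [interior_Icc]
      intro t ht
      rw [(hder t ht).deriv]
      have h1 := h.integral_W_mul_tilt_le ht.1.le ht.2.le
      have h2 : ∫ ω, softMin ℓ z (W X ω) * tilt ℓ z t (W X ω) ∂P ≤
          ∫ ω, W X ω * tilt ℓ z t (W X ω) ∂P := by
        have hsm : Controlled X B a 1 fun ω => softMin ℓ z (W X ω) :=
          Controlled.of_le ((continuous_softMin hℓ0).measurable.comp h.measurable_W)
            (h.controlled_W.abs.add (Controlled.const 1))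
            fun ω => abs_softMin_le h.one_le_level h.nonneg _
        refine integral_mono (h.integrable (hsm.mul (h.controlled_tilt ht.1.le)))
          (h.integrable (h.controlled_W.mul (h.controlled_tilt ht.1.le))) fun ω => ?_
        exact mul_le_mul_of_nonneg_right (softMin_le_left hℓ0 _) (tilt_pos _ _ _ _).le
      have h3 := Real.exp_pos (-(t ^ 2 / 2 + t / ℓ))
      have h4 : ∫ ω, softMin ℓ z (W X ω) * tilt ℓ z t (W X ω) ∂P - (1 + φ t) * (t + 1 / ℓ) ≤ 0 := by
        have h5 : ∫ ω, tilt ℓ z t (W X ω) ∂P = φ t := rfl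
        rw [h5] at h1
        have := ht.1
        nlinarith
      nlinarith
  have h1 := hanti ⟨le_rfl, hℓ0.le⟩ ⟨ht, htℓ⟩ ht
  simp only at h1
  have h2 : φ 0 = 1 := by simp [hφdef, tilt]
  rw [h2] at h1
  norm_num at h1
  have h3 : t / ℓ ≤ 1 := (div_le_one hℓ0).2 htℓ
  have h4 : Real.exp (t / ℓ) ≤ 3 :=
    (Real.exp_le_exp.2 h3).trans (by linarith [Real.exp_one_lt_d9])
  calc 1 + φ t = (1 + φ t) * Real.exp (-(t / ℓ) + -(t ^ 2 / 2)) *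
        (Real.exp (t ^ 2 / 2) * Real.exp (t / ℓ)) := by
        rw [mul_assoc, ← Real.exp_add, ← Real.exp_add]
        rw [show -(t / ℓ) + -(t ^ 2 / 2) + (t ^ 2 / 2 + t / ℓ) = 0 by ring, Real.exp_zero, mul_one]
    _ ≤ 2 * (Real.exp (t ^ 2 / 2) * 3) := by gcongr
    _ = _ := by ring

end IsModerate

end LocalDep

/-! ### Gaussian weights and concentration near the level -/

namespace LocalDep

section Weights

/-- The Gaussian weight `exp (c² / 2)`, where `c` is `w` clamped to `[0, z]`. -/
noncomputable def gaussWeight (z w : ℝ) : ℝ := Real.exp (max 0 (min w z) ^ 2 / 2)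

/-- The clamp is 1-Lipschitz with values in [0, z], so half its square is Lipschitz with constant z
≤ ℓ. -/
lemma isTest_gaussWeight {ℓ z : ℝ} (hz : 0 ≤ z) (hzℓ : z ≤ ℓ) :
    IsTest ℓ (3 * Real.exp (ℓ ^ 2)) (gaussWeight z) where
  meas := by unfold gaussWeight; fun_prop
  one_le w := Real.one_le_exp (by positivity)
  le w := by
    have h1 : max 0 (min w z) ≤ z := max_le hz (min_le_right _ _)
    have h2 : 0 ≤ max 0 (min w z) := le_max_left _ _
    have h3 : gaussWeight z w ≤ Real.exp (ℓ ^ 2) := Real.exp_le_exp.2 (by nlinarith)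
    linarith [Real.exp_pos (ℓ ^ 2)]
  lip w v := by
    unfold gaussWeight
    rw [← Real.exp_add]
    refine Real.exp_le_exp.2 ?_
    set c := max 0 (min w z)
    set c' := max 0 (min (w + v) z)
    have h1 : c ≤ z := max_le hz (min_le_right _ _)
    have h2 : 0 ≤ c := le_max_left _ _
    have h1' : c' ≤ z := max_le hz (min_le_right _ _)
    have h2' : 0 ≤ c' := le_max_left _ _
    have h3 : c' ≤ c + |v| := by
      refine max_le (by positivity) ?_
      rcases le_total w z with hw | hw
      · have h4 : w ≤ c := (le_min le_rfl hw).trans (le_max_right _ _)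
        exact (min_le_left _ _).trans (add_le_add h4 (le_abs_self v))
      · have h4 : z ≤ c := (le_min hw le_rfl).trans (le_max_right _ _)
        exact (min_le_right _ _).trans (by linarith [abs_nonneg v])
    rcases le_total c' c with h4 | h4
    · have : 0 ≤ ℓ * |v| := mul_nonneg (hz.trans hzℓ) (abs_nonneg v)
      nlinarith
    · nlinarith [mul_le_mul_of_nonneg_right hzℓ (abs_nonneg v)]

lemma exp_two_le : Real.exp 2 ≤ 8 := by
  have h1 : Real.exp 2 = Real.exp 1 * Real.exp 1 := by rw [← Real.exp_add]; norm_num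
  have := Real.exp_one_lt_d9
  have := Real.exp_pos 1
  rw [h1]
  nlinarith

/-- With c the clamped value and k its floor, (c - k)² ≤ 1 gives c²/2 ≤ kc - k²/2 + 1/2, while k ·
softMin ≥ kc - 1. The total loss 3/2 is covered by e² ≤ 8. -/
lemma gaussWeight_le_sum {ℓ z : ℝ} (hz : 0 ≤ z) (hzℓ : z ≤ ℓ) (hℓ : 1 ≤ ℓ) (w : ℝ) :
    gaussWeight z w ≤
      ∑ k ∈ Finset.range (⌊z⌋₊ + 1), 8 * Real.exp (-((k : ℝ) ^ 2 / 2)) * tilt ℓ z k w := by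
  set c := max 0 (min w z) with hc
  have hcz : c ≤ z := max_le hz (min_le_right _ _)
  have hc0 : 0 ≤ c := le_max_left _ _
  set k := ⌊c⌋₊ with hk
  have hk1 : (k : ℝ) ≤ c := Nat.floor_le hc0
  have hk2 : c < k + 1 := Nat.lt_floor_add_one c
  have hmem : k ∈ Finset.range (⌊z⌋₊ + 1) :=
    Finset.mem_range.2 (Nat.lt_succ_of_le (Nat.floor_le_floor hcz))
  have hterm : gaussWeight z w ≤ 8 * Real.exp (-((k : ℝ) ^ 2 / 2)) * tilt ℓ z k w := by
    have h1 : (k : ℝ) * c - 1 ≤ k * softMin ℓ z w := by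
      rcases le_total 0 (min w z) with h | h
      · have h2 : c = min w z := max_eq_right h
        have h3 := min_sub_le_softMin (z := z) (by linarith : 0 < ℓ) w
        have h4 : (k : ℝ) * (1 / ℓ) ≤ 1 := by
          rw [mul_one_div, div_le_one (by linarith)]
          linarith
        rw [← h2] at h3
        have h5 := mul_le_mul_of_nonneg_left h3 (Nat.cast_nonneg k : (0 : ℝ) ≤ k)
        linarith
      · have h2 : c = 0 := max_eq_left h
        have h3 : k = 0 := by rw [hk, h2, Nat.floor_zero]
        rw [h3]
        norm_num
    have h6 : gaussWeight z w ≤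
        Real.exp (2 + (-((k : ℝ) ^ 2 / 2) + k * softMin ℓ z w)) := by
      refine Real.exp_le_exp.2 ?_
      rw [← hc]
      nlinarith
    rw [Real.exp_add, Real.exp_add] at h6
    refine h6.trans ?_
    rw [← mul_assoc, tilt]
    gcongr
    exact exp_two_le
  refine hterm.trans (Finset.single_le_sum
    (f := fun k : ℕ => 8 * Real.exp (-((k : ℝ) ^ 2 / 2)) * tilt ℓ z k w) (fun j _ => ?_) hmem)
  have := tilt_pos ℓ z j w
  positivity

/-- Tilting at t = z is the natural change of measure for the level z: functions dominated by
exp(-z²) times this tilt have expectation of order exp(-z²/2). -/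
lemma exp_mul_min_sub_le {ℓ z : ℝ} (hz : 0 ≤ z) (hzℓ : z ≤ ℓ) (hℓ : 1 ≤ ℓ) (w : ℝ) :
    Real.exp (z * (min w z - z)) ≤ 3 * Real.exp (-z ^ 2) * tilt ℓ z z w := by
  have h3 := min_sub_le_softMin (z := z) (by linarith : 0 < ℓ) w
  have h4 : z * (1 / ℓ) ≤ 1 := by
    rw [mul_one_div, div_le_one (by linarith)]
    exact hzℓ
  have h5 := mul_le_mul_of_nonneg_left h3 hz
  have h6 : Real.exp (z * (min w z - z)) ≤ Real.exp (1 + (-z ^ 2 + z * softMin ℓ z w)) :=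
    Real.exp_le_exp.2 (by nlinarith)
  rw [Real.exp_add, Real.exp_add, ← mul_assoc] at h6
  refine h6.trans ?_
  rw [tilt]
  gcongr
  linarith [Real.exp_one_lt_d9]

/-- The logistic bump of width `s` around `z`. -/
noncomputable def bump (s z w : ℝ) : ℝ :=
  (1 + Real.exp ((w - z) / s))⁻¹ * (1 + Real.exp (-((w - z) / s)))⁻¹

/-- An antiderivative of the logistic bump. -/
noncomputable def bumpInt (s z w : ℝ) : ℝ := s * (1 + Real.exp (-((w - z) / s)))⁻¹

variable {s z : ℝ}

lemma bump_pos (s z w : ℝ) : 0 < bump s z w := by unfold bump; positivity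

lemma continuous_bump (s z : ℝ) : Continuous (bump s z) := by
  unfold bump
  refine Continuous.mul (Continuous.inv₀ (by fun_prop) fun w => ?_)
    (Continuous.inv₀ (by fun_prop) fun w => ?_) <;> positivity

lemma hasDerivAt_bumpInt (hs : 0 < s) (w : ℝ) : HasDerivAt (bumpInt s z) (bump s z w) w := by
  have h1 : HasDerivAt (fun w => -((w - z) / s)) (-(1 / s)) w :=
    (((hasDerivAt_id w).sub_const z).div_const s).neg
  have h2 := ((h1.exp.const_add 1).inv (one_add_exp_pos _).ne').const_mul s
  refine h2.congr_deriv ?_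
  have hp := Real.exp_pos ((w - z) / s)
  have hm : Real.exp (-((w - z) / s)) = (Real.exp ((w - z) / s))⁻¹ := Real.exp_neg _
  rw [bump, hm]
  field_simp
  ring

lemma inv_one_add_exp_add_le (x y : ℝ) :
    (1 + Real.exp x)⁻¹ ≤ Real.exp |x - y| * (1 + Real.exp y)⁻¹ := by
  have h1 := one_add_exp_le y x
  rw [abs_sub_comm] at h1
  rw [inv_le_iff_one_le_mul₀ (one_add_exp_pos _)]
  have := one_add_exp_pos y
  field_simp
  linarith

/-- A logistic bump replaces the indicator of a window because it can serve as the derivative in the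
log-Lipschitz form of Stein's identity, with rate 2/s. -/
lemma bump_add_le (hs : 0 < s) (w v : ℝ) :
    bump s z (w + v) ≤ Real.exp (2 / s * |v|) * bump s z w := by
  have h1 := inv_one_add_exp_add_le ((w + v - z) / s) ((w - z) / s)
  have h2 := inv_one_add_exp_add_le (-((w + v - z) / s)) (-((w - z) / s))
  have e1 : |(w + v - z) / s - (w - z) / s| = |v| / s := by
    rw [← sub_div, abs_div, abs_of_pos hs]; ring_nf
  have e2 : |-((w + v - z) / s) - -((w - z) / s)| = |v| / s := by
    rw [← e1, abs_sub_comm]; ring_nf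
  rw [e1] at h1
  rw [e2] at h2
  unfold bump
  calc _ ≤ (Real.exp (|v| / s) * (1 + Real.exp ((w - z) / s))⁻¹) *
        (Real.exp (|v| / s) * (1 + Real.exp (-((w - z) / s)))⁻¹) := by gcongr
    _ = _ := by
        rw [show 2 / s * |v| = |v| / s + |v| / s by ring, Real.exp_add]; ring

lemma exp_neg_le_bump (hs : 0 < s) (w : ℝ) : Real.exp (-(|w - z| / s)) ≤ 4 * bump s z w := by
  have key : ∀ x : ℝ, Real.exp (-|x|) ≤ 4 * ((1 + Real.exp x)⁻¹ * (1 + Real.exp (-x))⁻¹) := by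
    intro x
    rw [← mul_inv, ← div_eq_mul_inv, le_div_iff₀ (by positivity), mul_comm (1 + Real.exp x)]
    have hx1 : Real.exp (-|x|) * Real.exp x ≤ 1 := by
      rw [← Real.exp_add]; exact Real.exp_le_one_iff.2 (by linarith [le_abs_self x])
    have hx2 : Real.exp (-|x|) * Real.exp (-x) ≤ 1 := by
      rw [← Real.exp_add]; exact Real.exp_le_one_iff.2 (by linarith [neg_abs_le x])
    have hx3 : Real.exp (-|x|) ≤ 1 := Real.exp_le_one_iff.2 (by linarith [abs_nonneg x])
    have hx4 : Real.exp (-x) * Real.exp x = 1 := by rw [← Real.exp_add]; simp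
    calc Real.exp (-|x|) * ((1 + Real.exp (-x)) * (1 + Real.exp x))
        = Real.exp (-|x|) * (1 + Real.exp (-x) * Real.exp x) + Real.exp (-|x|) * Real.exp x +
          Real.exp (-|x|) * Real.exp (-x) := by ring
      _ ≤ 4 := by rw [hx4]; linarith
  have h2 := key ((w - z) / s)
  rwa [abs_div, abs_of_pos hs] at h2

/-- Below the level, the logistic function decays at rate 1/s ≥ z, at least as fast as the
comparison exponential; above it, the bound 1 suffices. -/
lemma inv_one_add_exp_neg_le {ℓ : ℝ} (hz : 0 ≤ z) (hzs : z ≤ 1 / s) (hzℓ : z ≤ ℓ)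
    (hℓ : 1 ≤ ℓ) (w : ℝ) :
    (1 + Real.exp (-((w - z) / s)))⁻¹ ≤ 3 * Real.exp (-z ^ 2) * tilt ℓ z z w := by
  refine le_trans ?_ (exp_mul_min_sub_le hz hzℓ hℓ w)
  rcases le_total w z with h | h
  · rw [min_eq_left h]
    have h1 : (1 + Real.exp (-((w - z) / s)))⁻¹ ≤ (Real.exp (-((w - z) / s)))⁻¹ :=
      inv_anti₀ (Real.exp_pos _) (by linarith)
    rw [← Real.exp_neg, neg_neg] at h1
    refine h1.trans (Real.exp_le_exp.2 ?_)
    rw [div_eq_mul_one_div]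
    nlinarith
  · rw [min_eq_right h, sub_self, mul_zero, Real.exp_zero]
    exact inv_le_one_of_one_le₀ (by linarith [Real.exp_pos (-((w - z) / s))])

lemma bump_le {ℓ : ℝ} (hz : 0 ≤ z) (hzs : z ≤ 1 / s) (hzℓ : z ≤ ℓ)
    (hℓ : 1 ≤ ℓ) (w : ℝ) : bump s z w ≤ 3 * Real.exp (-z ^ 2) * tilt ℓ z z w := by
  refine le_trans ?_ (inv_one_add_exp_neg_le hz hzs hzℓ hℓ w)
  refine mul_le_of_le_one_left (by positivity) ?_
  exact inv_le_one_of_one_le₀ (by linarith [Real.exp_pos ((w - z) / s)])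

lemma bump_le_one (s z w : ℝ) : bump s z w ≤ 1 :=
  mul_le_one₀ (inv_le_one_of_one_le₀ (by linarith [Real.exp_pos ((w - z) / s)])) (by positivity)
    (inv_le_one_of_one_le₀ (by linarith [Real.exp_pos (-((w - z) / s))]))

end Weights

namespace IsModerate

variable {Ω J : Type*} [MeasurableSpace Ω] [Fintype J] {P : Measure Ω}
  {X : J → Ω → ℝ} {A B : J → Finset J} {a b ν ℓ z t : ℝ}

/-- The width of the smoothing window. -/
lemma width_facts (h : IsModerate P X A B a b ν ℓ z) (hν : 1 / 2 ≤ ν) (hκ : (1 : ℝ) ≤ kappa B) :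
    0 < 10 ^ 6 * ν / a ∧ 2 / (10 ^ 6 * ν / a) ≤ a / 32 ∧ z ≤ 1 / (10 ^ 6 * ν / a) := by
  have ha := h.a_pos
  have hℓ := h.one_le_level
  refine ⟨by positivity, ?_, ?_⟩
  · rw [div_div_eq_mul_div, div_le_div_iff₀ (by positivity) (by norm_num)]
    nlinarith
  · rw [one_div_div, le_div_iff₀ (by positivity)]
    have h1 := h.kappa_mul_nu_mul_le
    have h2 : 1 * ν * ℓ ≤ kappa B * ν * ℓ ^ 3 := by
      gcongr
      exact le_self_pow₀ hℓ (by norm_num)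
    have h3 : z * (10 ^ 6 * ν) ≤ ℓ * (10 ^ 6 * ν) := by
      gcongr; exact h.le_level
    nlinarith

variable [IsProbabilityMeasure P]

/-- In each term of the discretised weight exp(-k²/2) cancels the Gaussian bound on the tilt,
leaving 8 · 6 = 48; there are at most ℓ + 1 ≤ 2ℓ terms. -/
lemma integral_gaussWeight_le (h : IsModerate P X A B a b ν ℓ z) :
    ∫ ω, gaussWeight z (W X ω) ∂P ≤ 96 * ℓ := by
  have hg := isTest_gaussWeight h.nonneg h.le_level
  have hc : ∀ k : ℕ, Controlled X B a 0
      (fun ω => 8 * Real.exp (-((k : ℝ) ^ 2 / 2)) * tilt ℓ z k (W X ω)) := fun k =>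
    (h.controlled_tilt (Nat.cast_nonneg k)).const_mul _
  calc ∫ ω, gaussWeight z (W X ω) ∂P
      ≤ ∫ ω, ∑ k ∈ Finset.range (⌊z⌋₊ + 1),
          8 * Real.exp (-((k : ℝ) ^ 2 / 2)) * tilt ℓ z k (W X ω) ∂P :=
        integral_mono (h.integrable (h.controlled_test hg))
          (h.integrable (Controlled.sum _ fun k _ => hc k))
          fun ω => gaussWeight_le_sum h.nonneg h.le_level h.one_le_level _
    _ = ∑ k ∈ Finset.range (⌊z⌋₊ + 1),
          8 * Real.exp (-((k : ℝ) ^ 2 / 2)) * ∫ ω, tilt ℓ z k (W X ω) ∂P := by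
        rw [integral_finsetSum _ fun k _ => h.integrable (hc k)]
        simp only [integral_const_mul]
    _ ≤ ∑ k ∈ Finset.range (⌊z⌋₊ + 1), (48 : ℝ) := by
        refine Finset.sum_le_sum fun k hk => ?_
        have hkz : (k : ℝ) ≤ z := by
          have : k ≤ ⌊z⌋₊ := Nat.lt_succ_iff.1 (Finset.mem_range.1 hk)
          exact (Nat.cast_le.2 this).trans (Nat.floor_le h.nonneg)
        have h1 := h.one_add_integral_tilt_le (Nat.cast_nonneg k) (hkz.trans h.le_level)
        calc 8 * Real.exp (-((k : ℝ) ^ 2 / 2)) * ∫ ω, tilt ℓ z k (W X ω) ∂P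
            ≤ 8 * Real.exp (-((k : ℝ) ^ 2 / 2)) * (6 * Real.exp ((k : ℝ) ^ 2 / 2)) := by
              gcongr; linarith
          _ = 48 * (Real.exp (-((k : ℝ) ^ 2 / 2)) * Real.exp ((k : ℝ) ^ 2 / 2)) := by ring
          _ = 48 := by rw [← Real.exp_add]; simp
    _ = 48 * (⌊z⌋₊ + 1) := by simp; ring
    _ ≤ _ := by
        have := Nat.floor_le h.nonneg
        linarith [h.le_level, h.one_le_level]

/-- Transfers a weighted L¹ bound to functions living near or above z: exp(-z²) times 6 exp(z²/2)
leaves exp(-z²/2), and 18 = 3 · 6. -/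
lemma integral_mul_le_of_le_tilt (h : IsModerate P X A B a b ν ℓ z) {F : Ω → ℝ} {L : ℝ → ℝ}
    {k : ℕ} {C : ℝ} (hk : k ≤ 16) (hF : Controlled X B a k F) (hL : Measurable L)
    (hL0 : ∀ w, 0 ≤ L w)
    (hLt : ∀ w, L w ≤ 3 * Real.exp (-z ^ 2) * tilt ℓ z z w)
    (hC : ∫ ω, |F ω| * (1 + tilt ℓ z z (W X ω)) ∂P ≤
      C * ∫ ω, (1 + tilt ℓ z z (W X ω)) ∂P) (hC0 : 0 ≤ C) :
    ∫ ω, |F ω| * L (W X ω) ∂P ≤ 18 * C * Real.exp (-(z ^ 2 / 2)) := by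
  have ht := h.controlled_tilt h.nonneg
  have hLc : Controlled X B a 0 (fun ω => L (W X ω)) :=
    Controlled.of_le (hL.comp h.measurable_W) (ht.const_mul (3 * Real.exp (-z ^ 2)))
      fun ω => by rw [abs_of_nonneg (hL0 _)]; exact hLt _
  have h1t : Controlled X B a 0 (fun ω => 1 + tilt ℓ z z (W X ω)) := by
    simpa using (Controlled.const 1).add ht
  rw [h.integral_one_add_tilt h.nonneg] at hC
  have h2 := h.one_add_integral_tilt_le h.nonneg h.le_level
  calc ∫ ω, |F ω| * L (W X ω) ∂P
      ≤ ∫ ω, 3 * Real.exp (-z ^ 2) * (|F ω| * (1 + tilt ℓ z z (W X ω))) ∂P := by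
        refine integral_mono (h.integrable (hF.abs.mul hLc) hk)
          (h.integrable ((hF.abs.mul h1t).const_mul _) hk) fun ω => ?_
        have h3 : L (W X ω) ≤ 3 * Real.exp (-z ^ 2) * (1 + tilt ℓ z z (W X ω)) := by
          refine (hLt _).trans ?_
          gcongr
          linarith
        have := mul_le_mul_of_nonneg_left h3 (abs_nonneg (F ω))
        simp only
        linarith
    _ = 3 * Real.exp (-z ^ 2) * ∫ ω, |F ω| * (1 + tilt ℓ z z (W X ω)) ∂P :=
        integral_const_mul _ _
    _ ≤ 3 * Real.exp (-z ^ 2) * (C * (6 * Real.exp (z ^ 2 / 2))) := by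
        gcongr
        exact hC.trans (by gcongr)
    _ = 18 * C * (Real.exp (-z ^ 2) * Real.exp (z ^ 2 / 2)) := by ring
    _ = _ := by rw [← Real.exp_add]; ring_nf

lemma integral_fluct_localProd_mul_le (h : IsModerate P X A B a b ν ℓ z) {L : ℝ → ℝ}
    (hL : Measurable L) (hL0 : ∀ w, 0 ≤ L w)
    (hLt : ∀ w, L w ≤ 3 * Real.exp (-z ^ 2) * tilt ℓ z z w) :
    ∫ ω, |fluct P (localProd X A) ω| * L (W X ω) ∂P ≤
      108000000 * (ℓ * (kappa B * ν / a)) * Real.exp (-(z ^ 2 / 2)) := by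
  have hν := h.half_le_nu
  have ha := h.a_pos
  have hℓ := h.level_pos
  have h1 := h.integral_mul_le_of_le_tilt (k := 2) (by norm_num)
    (controlled_fluct h.controlled_localProd) hL hL0 hLt
    (h.integral_abs_fluct_localProd_le (isTest_tilt h.one_le_level h.le_level h.nonneg h.le_level))
    (by positivity)
  exact h1.trans (le_of_eq (by ring))

lemma integral_sum_wt_mul_le_of_le_tilt (h : IsModerate P X A B a b ν ℓ z) {L : ℝ → ℝ} {K : ℝ}
    (hL : Measurable L) (hL0 : ∀ w, 0 ≤ L w) (hLK : ∀ w, L w ≤ K)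
    (hLt : ∀ w, L w ≤ 3 * Real.exp (-z ^ 2) * tilt ℓ z z w) :
    ∫ ω, (∑ i, wt X a (A i) ω) * L (W X ω) ∂P ≤ ν * a ^ 2 * ∫ ω, L (W X ω) ∂P +
      198000 * (a * ℓ * kappa B * ν) * Real.exp (-(z ^ 2 / 2)) := by
  have hν := h.half_le_nu
  have ha := h.a_pos
  have hℓ := h.level_pos
  have h1 := h.integral_mul_le_of_le_tilt (k := 1) (by norm_num)
    (controlled_fluct h.controlled_wt') hL hL0 hLt
    (h.integral_abs_fluct_wt_le (isTest_tilt h.one_le_level h.le_level h.nonneg h.le_level))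
    (by positivity)
  refine (h.integral_sum_wt_mul_le_add hL hL0 hLK).trans (add_le_add le_rfl (h1.trans ?_))
  exact le_of_eq (by ring)

/-- Concentration of `W` near `z` at scale `ν / a`. -/
lemma integral_bump_le (h : IsModerate P X A B a b ν ℓ z) :
    ∫ ω, bump (10 ^ 6 * ν / a) z (W X ω) ∂P ≤
      4 * 10 ^ 8 * (ℓ * (kappa B * ν / a)) * Real.exp (-(z ^ 2 / 2)) := by
  have hν := h.half_le_nu
  have hκ := h.one_le_kappa
  have ha := h.a_pos
  have hℓ := h.one_le_level
  have hℓ0 := h.level_pos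
  have hz := h.nonneg
  obtain ⟨hs, hs32, hzs⟩ := h.width_facts hν hκ
  set s := 10 ^ 6 * ν / a with hsdef
  have hLt := bump_le hz hzs h.le_level hℓ
  have hLm : Measurable (bump s z) := (continuous_bump s z).measurable
  have h1 := h.abs_integral_stein_le_of_log_lipschitz (f := bumpInt s z) (D := bump s z)
    (Kf := s) (KD := 1) (lam := 2 / s)
    (fun w => by
      rw [bumpInt, abs_of_pos (by positivity)]
      refine mul_le_of_le_one_right hs.le (inv_le_one_of_one_le₀ ?_)
      linarith [Real.exp_pos (-((w - z) / s))])
    hLm (fun w => (bump_pos s z w).le) (bump_le_one s z) (by positivity) hs32 (bump_add_le hs)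
    (hasDerivAt_bumpInt hs)
  -- Read as E bump ≤ E W · bumpInt plus errors. As the antiderivative is at most s, the first term
  -- carries the factor s.
  have h2 := (abs_le.1 h1).1
  have f2 := h.integral_fluct_localProd_mul_le hLm (fun w => (bump_pos s z w).le) hLt
  have f3 := h.integral_sum_wt_mul_le_of_le_tilt hLm (fun w => (bump_pos s z w).le)
    (bump_le_one s z) hLt
  have ht := h.controlled_tilt h.nonneg
  have hfi : Controlled X B a 0 (fun ω => bumpInt s z (W X ω)) :=
    Controlled.of_bounded ((continuous_iff_continuousAt.2
      fun w => (hasDerivAt_bumpInt (z := z) hs w).continuousAt).measurable.comp h.measurable_W) s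
      fun ω => by
        rw [bumpInt, abs_of_pos (by positivity)]
        refine mul_le_of_le_one_right hs.le (inv_le_one_of_one_le₀ ?_)
        linarith [Real.exp_pos (-((W X ω - z) / s))]
  have f1 : ∫ ω, W X ω * bumpInt s z (W X ω) ∂P ≤ 54 * (s * ℓ) * Real.exp (-(z ^ 2 / 2)) := by
    have e1 : ∫ ω, W X ω * bumpInt s z (W X ω) ∂P ≤ 3 * s * Real.exp (-z ^ 2) *
        (∫ ω, W X ω * tilt ℓ z z (W X ω) ∂P + ∫ ω, |W X ω| ∂P) := by
      rw [← integral_add (h.integrable (h.controlled_W.mul ht)) (h.integrable h.controlled_W.abs),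
        ← integral_const_mul]
      refine integral_mono (h.integrable (h.controlled_W.mul hfi)) (h.integrable
        (((h.controlled_W.mul ht).add h.controlled_W.abs).const_mul _)) fun ω => ?_
      set w := W X ω
      have hτ := tilt_pos ℓ z z w
      simp only
      rcases le_total 0 w with hw | hw
      · have e2 := inv_one_add_exp_neg_le hz hzs h.le_level hℓ w
        have e3 : bumpInt s z w ≤ s * (3 * Real.exp (-z ^ 2) * tilt ℓ z z w) :=
          mul_le_mul_of_nonneg_left e2 hs.le
        calc w * bumpInt s z w ≤ w * (s * (3 * Real.exp (-z ^ 2) * tilt ℓ z z w)) := by gcongr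
          _ = 3 * s * Real.exp (-z ^ 2) * (w * tilt ℓ z z w) := by ring
          _ ≤ _ := by gcongr; linarith [abs_nonneg w]
      · have e2 : 0 ≤ bumpInt s z w := by unfold bumpInt; positivity
        have e3 : tilt ℓ z z w ≤ 1 := Real.exp_le_one_iff.2
          (mul_nonpos_of_nonneg_of_nonpos hz ((softMin_le_left hℓ0 w).trans hw))
        have e4 : 0 ≤ w * tilt ℓ z z w + |w| := by
          rw [abs_of_nonpos hw]; nlinarith
        exact (mul_nonpos_of_nonpos_of_nonneg hw e2).trans (by positivity)
    have e2 := h.integral_W_mul_tilt_le hz h.le_level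
    have e3 := h.integral_abs_W_le
    have e4 := h.one_add_integral_tilt_le hz h.le_level
    set φ := ∫ ω, tilt ℓ z z (W X ω) ∂P
    have hφ : 0 ≤ φ := integral_nonneg fun ω => (tilt_pos _ _ _ _).le
    have e5 : ∫ ω, W X ω * tilt ℓ z z (W X ω) ∂P + ∫ ω, |W X ω| ∂P ≤
        3 * ℓ * (6 * Real.exp (z ^ 2 / 2)) := by
      have e6 : 1 / ℓ ≤ 1 := (div_le_one hℓ0).2 hℓ
      have e7 : z * φ ≤ ℓ * (1 + φ) := by nlinarith [h.le_level]
      have e8 : 1 / ℓ * (1 + φ) ≤ 1 * (1 + φ) := by gcongr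
      have e9 : 3 * ℓ * (1 + φ) ≤ 3 * ℓ * (6 * Real.exp (z ^ 2 / 2)) := by gcongr
      nlinarith
    calc _ ≤ _ := e1
      _ ≤ 3 * s * Real.exp (-z ^ 2) * (3 * ℓ * (6 * Real.exp (z ^ 2 / 2))) := by gcongr
      _ = 54 * (s * ℓ) * (Real.exp (-z ^ 2) * Real.exp (z ^ 2 / 2)) := by ring
      _ = _ := by rw [← Real.exp_add]; ring_nf
  set E := Real.exp (-(z ^ 2 / 2)) with hE
  set I := ∫ ω, bump s z (W X ω) ∂P with hI
  have hI0 : 0 ≤ I := integral_nonneg fun ω => (bump_pos _ _ _).le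
  set ε := kappa B * ν / a with hε
  have hε0 : 0 < ε := by positivity
  have hE0 : 0 < E := Real.exp_pos _
  have hsε : s ≤ 10 ^ 6 * ε := by
    rw [hsdef, hε, mul_div_assoc]
    gcongr
    exact le_mul_of_one_le_left (by linarith) hκ
  have g1 : 54 * (s * ℓ) * E ≤ 54 * 10 ^ 6 * (ℓ * ε) * E := by
    calc 54 * (s * ℓ) * E ≤ 54 * (10 ^ 6 * ε * ℓ) * E := by gcongr
      _ = _ := by ring
  -- The remainder contains the unknown I itself, with coefficient 393216/10⁶ < 1/2, so it can be
  -- absorbed on the left. This dictates the constant 10⁶ in the width s.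
  have g3 : 196608 * (2 / s) / a ^ 3 * ∫ ω, (∑ i, wt X a (A i) ω) * bump s z (W X ω) ∂P ≤
      1 / 2 * I + 200000 * (ℓ * ε) * E := by
    calc _ ≤ 196608 * (2 / s) / a ^ 3 *
          (ν * a ^ 2 * I + 198000 * (a * ℓ * kappa B * ν) * E) := by gcongr
      _ = 393216 / 10 ^ 6 * I + 393216 * 198000 / 10 ^ 6 * (1 / ν) * (ℓ * ε) * E := by
          rw [hsdef, hε]; field_simp; ring
      _ ≤ 1 / 2 * I + 393216 * 198000 / 10 ^ 6 * 2 * (ℓ * ε) * E := by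
          have : 1 / ν ≤ 2 := by rw [div_le_iff₀ (by linarith)]; linarith
          refine add_le_add (mul_le_mul_of_nonneg_right (by norm_num) hI0) ?_
          gcongr
      _ ≤ _ := by gcongr; norm_num
  have hX : 0 ≤ (ℓ * ε) * E := by positivity
  nlinarith

end IsModerate

end LocalDep

/-! ### Gaussian tails and Mills' ratio -/

namespace LocalDep

section Gaussian

open Filter Topology

/-- The Gaussian tail integral `∫_w^∞ exp (-x²/2) dx`. -/
noncomputable def gaussTail (w : ℝ) : ℝ := ∫ x in Set.Ioi w, Real.exp (-(x ^ 2 / 2))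

lemma integrable_exp_neg_sq_half : Integrable fun x : ℝ => Real.exp (-(x ^ 2 / 2)) := by
  refine (integrable_exp_neg_mul_sq (b := 1 / 2) (by norm_num)).congr
    (Eventually.of_forall fun x => ?_)
  simp only
  ring_nf

lemma integral_exp_neg_sq_half : ∫ x : ℝ, Real.exp (-(x ^ 2 / 2)) = Real.sqrt (2 * Real.pi) := by
  have h := integral_gaussian (1 / 2)
  rw [show Real.pi / (1 / 2) = 2 * Real.pi by ring] at h
  rw [← h]
  congr 1
  funext x
  ring_nf

lemma gaussTail_eq (w : ℝ) :
    gaussTail w = Real.sqrt (2 * Real.pi) - ∫ x in Set.Iic w, Real.exp (-(x ^ 2 / 2)) := by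
  rw [← integral_exp_neg_sq_half, ← intervalIntegral.integral_Iic_add_Ioi
    integrable_exp_neg_sq_half.integrableOn integrable_exp_neg_sq_half.integrableOn (b := w)]
  simp [gaussTail]

lemma gaussTail_neg (w : ℝ) : gaussTail (-w) = Real.sqrt (2 * Real.pi) - gaussTail w := by
  have h := integral_comp_neg_Ioi (-w) (fun x : ℝ => Real.exp (-(x ^ 2 / 2)))
  simp only [even_two, Even.neg_pow, neg_neg] at h
  have h2 := gaussTail_eq w
  rw [gaussTail, h]
  linarith

lemma gaussTail_nonneg (w : ℝ) : 0 ≤ gaussTail w :=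
  integral_nonneg fun _ => (Real.exp_pos _).le

lemma gaussTail_anti {w v : ℝ} (h : w ≤ v) : gaussTail v ≤ gaussTail w :=
  setIntegral_mono_set integrable_exp_neg_sq_half.integrableOn
    (Eventually.of_forall fun _ => (Real.exp_pos _).le)
    (LE.le.eventuallyLE (Set.Ioi_subset_Ioi h))

lemma sqrt_two_pi_le : Real.sqrt (2 * Real.pi) ≤ 3 := by
  rw [Real.sqrt_le_left (by norm_num)]
  linarith [Real.pi_lt_d2]

lemma sqrt_two_pi_pos : 0 < Real.sqrt (2 * Real.pi) := by positivity

lemma gaussTail_le (w : ℝ) : gaussTail w ≤ 3 := by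
  have h1 := gaussTail_neg w
  have := gaussTail_nonneg (-w)
  linarith [sqrt_two_pi_le]

lemma hasDerivAt_gaussTail (w : ℝ) : HasDerivAt gaussTail (-Real.exp (-(w ^ 2 / 2))) w := by
  have hc : Continuous fun x : ℝ => Real.exp (-(x ^ 2 / 2)) := by fun_prop
  have h1 : gaussTail = fun v => gaussTail 0 - ∫ x in (0 : ℝ)..v, Real.exp (-(x ^ 2 / 2)) := by
    funext v
    rw [← intervalIntegral.integral_Iic_sub_Iic integrable_exp_neg_sq_half.integrableOn
      integrable_exp_neg_sq_half.integrableOn, gaussTail_eq, gaussTail_eq]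
    ring
  rw [h1]
  exact (intervalIntegral.integral_hasDerivAt_right (hc.intervalIntegrable _ _)
    (hc.stronglyMeasurableAtFilter _ _) hc.continuousAt).const_sub _

lemma hasDerivAt_exp_neg_sq_half (x : ℝ) :
    HasDerivAt (fun x : ℝ => Real.exp (-(x ^ 2 / 2))) (-(x * Real.exp (-(x ^ 2 / 2)))) x := by
  have h1 : HasDerivAt (fun x : ℝ => -(x ^ 2 / 2)) (-x) x := by
    refine (((hasDerivAt_id x).pow 2).div_const 2).neg.congr_deriv ?_
    simp
  exact h1.exp.congr_deriv (by ring)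

lemma tendsto_exp_neg_sq_half : Tendsto (fun x : ℝ => Real.exp (-(x ^ 2 / 2))) atTop (𝓝 0) := by
  refine Real.tendsto_exp_atBot.comp (tendsto_neg_atTop_atBot.comp ?_)
  exact (tendsto_pow_atTop (by norm_num)).atTop_div_const (by norm_num)

lemma mul_gaussTail_le {w : ℝ} (hw : 0 ≤ w) : w * gaussTail w ≤ Real.exp (-(w ^ 2 / 2)) := by
  have hd : ∀ x ∈ Set.Ici w, HasDerivAt (fun x : ℝ => -Real.exp (-(x ^ 2 / 2)))
      (x * Real.exp (-(x ^ 2 / 2))) x := fun x _ => by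
    exact (hasDerivAt_exp_neg_sq_half x).neg.congr_deriv (neg_neg _)
  have h0 : ∀ x ∈ Set.Ioi w, 0 ≤ x * Real.exp (-(x ^ 2 / 2)) := fun x hx =>
    mul_nonneg (hw.trans (le_of_lt hx)) (Real.exp_pos _).le
  have ht : Tendsto (fun x : ℝ => -Real.exp (-(x ^ 2 / 2))) atTop (𝓝 0) := by
    simpa using tendsto_exp_neg_sq_half.neg
  have hint := integrableOn_Ioi_deriv_of_nonneg' hd h0 ht
  have heq := integral_Ioi_of_hasDerivAt_of_nonneg' hd h0 ht
  rw [zero_sub, neg_neg] at heq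
  rw [← heq, gaussTail, ← integral_const_mul]
  refine setIntegral_mono_on (integrable_exp_neg_sq_half.integrableOn.const_mul w) hint
    measurableSet_Ioi fun x hx => ?_
  exact mul_le_mul_of_nonneg_right (le_of_lt hx) (Real.exp_pos _).le

/-- The function (1 + 1/x²) exp(-x²/2) is minus the derivative of exp(-x²/2)/x, and on (w, ∞) its
first factor is at most 1 + 1/w². -/
lemma mul_exp_le_gaussTail {w : ℝ} (hw : 0 ≤ w) :
    w * Real.exp (-(w ^ 2 / 2)) ≤ (1 + w ^ 2) * gaussTail w := by
  rcases hw.eq_or_lt with rfl | hw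
  · simpa using gaussTail_nonneg 0
  have hd : ∀ x ∈ Set.Ici w, HasDerivAt (fun x : ℝ => -(Real.exp (-(x ^ 2 / 2)) / x))
      ((1 + 1 / x ^ 2) * Real.exp (-(x ^ 2 / 2))) x := fun x hx => by
    have hx0 : x ≠ 0 := (hw.trans_le hx).ne'
    refine ((hasDerivAt_exp_neg_sq_half x).div (hasDerivAt_id x) hx0).neg.congr_deriv ?_
    simp only [id]
    field_simp
    ring
  have h0 : ∀ x ∈ Set.Ioi w, 0 ≤ (1 + 1 / x ^ 2) * Real.exp (-(x ^ 2 / 2)) := fun x _ => by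
    positivity
  have ht : Tendsto (fun x : ℝ => -(Real.exp (-(x ^ 2 / 2)) / x)) atTop (𝓝 0) := by
    simpa [div_eq_mul_inv] using (tendsto_exp_neg_sq_half.mul tendsto_inv_atTop_zero).neg
  have hint := integrableOn_Ioi_deriv_of_nonneg' hd h0 ht
  have heq := integral_Ioi_of_hasDerivAt_of_nonneg' hd h0 ht
  rw [zero_sub, neg_neg] at heq
  have h1 : Real.exp (-(w ^ 2 / 2)) / w ≤ (1 + 1 / w ^ 2) * gaussTail w := by
    rw [← heq, gaussTail, ← integral_const_mul]
    refine setIntegral_mono_on hint (integrable_exp_neg_sq_half.integrableOn.const_mul _)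
      measurableSet_Ioi fun x hx => ?_
    have hwx : w ≤ x := le_of_lt hx
    gcongr
  calc w * Real.exp (-(w ^ 2 / 2)) = w ^ 2 * (Real.exp (-(w ^ 2 / 2)) / w) := by field_simp
    _ ≤ w ^ 2 * ((1 + 1 / w ^ 2) * gaussTail w) := by gcongr
    _ = _ := by field_simp; ring

lemma exp_le_gaussTail {z : ℝ} (hz : 0 ≤ z) :
    Real.exp (-(z ^ 2 / 2)) ≤ 4 * max 1 z * gaussTail z := by
  have key : ∀ y : ℝ, 1 ≤ y → Real.exp (-(y ^ 2 / 2)) ≤ 2 * y * gaussTail y := fun y hy => by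
    have h1 := mul_exp_le_gaussTail (w := y) (by linarith)
    have h2 := gaussTail_nonneg y
    have h3 : y * Real.exp (-(y ^ 2 / 2)) ≤ y * (2 * y * gaussTail y) := by
      refine h1.trans ?_
      nlinarith [mul_nonneg h2 (by nlinarith : 0 ≤ y ^ 2 - 1)]
    exact le_of_mul_le_mul_left h3 (by linarith)
  have h2 := gaussTail_nonneg z
  rcases le_total 1 z with h | h
  · rw [max_eq_right h]
    have := key z h
    nlinarith
  · rw [max_eq_left h]
    have h3 := key 1 le_rfl
    have h4 := gaussTail_anti h
    have h5 : (1 : ℝ) / 2 ≤ Real.exp (-(1 ^ 2 / 2)) := by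
      have := Real.add_one_le_exp (-(1 ^ 2 / 2 : ℝ))
      norm_num at this ⊢
      linarith
    have h6 : Real.exp (-(z ^ 2 / 2)) ≤ 1 := Real.exp_le_one_iff.2 (by nlinarith)
    linarith

lemma Phi_eq (z : ℝ) : Phi z = gaussTail (-z) / Real.sqrt (2 * Real.pi) := by
  have h1 : gaussTail (-z) = ∫ x in Set.Iic z, Real.exp (-(x ^ 2 / 2)) := by
    have h2 := gaussTail_eq z
    rw [gaussTail_neg]; linarith
  rw [Phi, cdf_eq_real, measureReal_def, gaussianReal_apply_eq_integral _ one_ne_zero,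
    ENNReal.toReal_ofReal (integral_nonneg fun _ => gaussianPDFReal_nonneg _ _ _), h1,
    div_eq_inv_mul, ← integral_const_mul]
  congr 1
  funext x
  simp only [gaussianPDFReal, NNReal.coe_one, mul_one, sub_zero]
  congr 2
  ring

lemma one_sub_Phi_eq (z : ℝ) : 1 - Phi z = gaussTail z / Real.sqrt (2 * Real.pi) := by
  have := sqrt_two_pi_pos
  rw [Phi_eq, gaussTail_neg]
  field_simp
  ring

lemma Phi_nonneg (z : ℝ) : 0 ≤ Phi z := by
  rw [Phi_eq]; exact div_nonneg (gaussTail_nonneg _) sqrt_two_pi_pos.le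

lemma Phi_le_one (z : ℝ) : Phi z ≤ 1 := by
  have h : 0 ≤ 1 - Phi z := by
    rw [one_sub_Phi_eq]; exact div_nonneg (gaussTail_nonneg _) sqrt_two_pi_pos.le
  linarith

lemma exp_le_one_sub_Phi {z : ℝ} (hz : 0 ≤ z) :
    Real.exp (-(z ^ 2 / 2)) ≤ 12 * max 1 z * (1 - Phi z) := by
  have h1 := exp_le_gaussTail hz
  have h2 : gaussTail z ≤ 3 * (1 - Phi z) := by
    rw [one_sub_Phi_eq, mul_div_assoc', le_div_iff₀ sqrt_two_pi_pos]
    nlinarith [sqrt_two_pi_le, gaussTail_nonneg z]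
  have h3 : 0 < max 1 z := by positivity
  nlinarith

lemma one_sub_Phi_pos {z : ℝ} (hz : 0 ≤ z) : 0 < 1 - Phi z := by
  have h1 := exp_le_one_sub_Phi hz
  have h2 := Real.exp_pos (-(z ^ 2 / 2))
  have h3 : 0 < 12 * max 1 z := by positivity
  by_contra! h
  nlinarith

/-- Mills' ratio. -/
noncomputable def mills (w : ℝ) : ℝ := Real.exp (w ^ 2 / 2) * gaussTail w

lemma exp_sq_half_mul (w : ℝ) : Real.exp (w ^ 2 / 2) * Real.exp (-(w ^ 2 / 2)) = 1 := by
  rw [← Real.exp_add]; simp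

lemma mills_nonneg (w : ℝ) : 0 ≤ mills w := mul_nonneg (Real.exp_pos _).le (gaussTail_nonneg _)

lemma hasDerivAt_mills (w : ℝ) : HasDerivAt mills (w * mills w - 1) w := by
  have h1 : HasDerivAt (fun x : ℝ => x ^ 2 / 2) w w := by
    refine (((hasDerivAt_id w).pow 2).div_const 2).congr_deriv ?_
    simp
  refine (h1.exp.mul (hasDerivAt_gaussTail w)).congr_deriv ?_
  have := exp_sq_half_mul w
  simp only [mills]
  linear_combination -this

lemma mul_mills_le_one {w : ℝ} (hw : 0 ≤ w) : w * mills w ≤ 1 := by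
  have h := mul_le_mul_of_nonneg_left (mul_gaussTail_le hw) (Real.exp_pos (w ^ 2 / 2)).le
  rw [exp_sq_half_mul] at h
  rw [mills]
  linarith

lemma le_mul_mills {w : ℝ} (hw : 0 ≤ w) : w ≤ (1 + w ^ 2) * mills w := by
  have h := mul_le_mul_of_nonneg_left (mul_exp_le_gaussTail hw) (Real.exp_pos (w ^ 2 / 2)).le
  have h2 := exp_sq_half_mul w
  rw [mills]
  calc w = Real.exp (w ^ 2 / 2) * (w * Real.exp (-(w ^ 2 / 2))) := by linear_combination -w * h2
    _ ≤ _ := h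
    _ = _ := by ring

lemma mills_le_exp (w : ℝ) : mills w ≤ 3 * Real.exp (w ^ 2 / 2) := by
  have := gaussTail_le w
  have := Real.exp_pos (w ^ 2 / 2)
  rw [mills]
  nlinarith

lemma mills_le {w : ℝ} (hw : 0 ≤ w) : mills w ≤ 6 := by
  rcases le_total 1 w with h | h
  · have := mul_mills_le_one hw
    have := mills_nonneg w
    nlinarith
  · have h1 := mills_le_exp w
    have h2 : Real.exp (w ^ 2 / 2) ≤ 2 := by
      have h3 : Real.exp (w ^ 2 / 2) ≤ Real.exp (1 / 2) := Real.exp_le_exp.2 (by nlinarith)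
      have h4 : Real.exp (1 / 2) * Real.exp (1 / 2) = Real.exp 1 := by
        rw [← Real.exp_add]; norm_num
      nlinarith [Real.exp_one_lt_d9, Real.exp_pos (1 / 2)]
    linarith

/-- A cancellation: since w · mills w ≤ 1, the term w² · mills w is at most w, leaving only mills w
≤ 6; the lower Mills bound makes the difference nonnegative. -/
lemma abs_mul_mills_sub_le {w : ℝ} (hw : 0 ≤ w) : |(1 + w ^ 2) * mills w - w| ≤ 6 := by
  have h1 := mul_mills_le_one hw
  have h2 := le_mul_mills hw
  have h3 := mills_le hw
  rw [abs_le]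
  constructor <;> nlinarith

end Gaussian

end LocalDep

/-! ### The Stein solution of a half line -/

namespace LocalDep

section SteinSolution

open Filter Topology

/-- The Stein solution has a corner at z, so the mean value inequality is stated for right
derivatives, which exist everywhere. -/
lemma abs_sub_le_of_right_deriv {f D : ℝ → ℝ} {C : ℝ} (hf : Continuous f)
    (hD : ∀ y, HasDerivWithinAt f (D y) (Set.Ici y) y) {w w' : ℝ}
    (hC : ∀ y ∈ Set.uIcc w w', |D y| ≤ C) : |f w - f w'| ≤ C * |w - w'| := by
  have key : ∀ u v : ℝ, u ≤ v → (∀ y ∈ Set.Icc u v, |D y| ≤ C) → |f v - f u| ≤ C * |v - u| := by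
    intro u v huv hb
    have h1 := norm_image_sub_le_of_norm_deriv_right_le_segment (f := f) (f' := D) (a := u) (b := v)
      (C := C) hf.continuousOn (fun x _ => hD x) (fun x hx => hb x ⟨hx.1, hx.2.le⟩) v
      ⟨huv, le_rfl⟩
    rwa [Real.norm_eq_abs, ← abs_of_nonneg (sub_nonneg.2 huv)] at h1
  rcases le_total w w' with h | h
  · rw [abs_sub_comm, abs_sub_comm w]
    exact key w w' h (by rwa [Set.uIcc_of_le h] at hC)
  · exact key w' w h (by rwa [Set.uIcc_of_ge h] at hC)

/-- The solution of Stein's equation for the half line `[z, ∞)`. -/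
noncomputable def steinSol (z w : ℝ) : ℝ :=
  if w < z then (1 - Phi z) * mills (-w) else Phi z * mills w

/-- The indicator function of `[z, ∞)`. -/
noncomputable def step (z w : ℝ) : ℝ := if z ≤ w then 1 else 0

/-- The right derivative of `steinSol`. -/
noncomputable def steinDeriv (z w : ℝ) : ℝ := w * steinSol z w + ((1 - Phi z) - step z w)

variable {z : ℝ}

lemma measurable_step (z : ℝ) : Measurable (step z) :=
  Measurable.ite measurableSet_Ici measurable_const measurable_const

lemma step_nonneg (z w : ℝ) : 0 ≤ step z w := by unfold step; split_ifs <;> norm_num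

lemma step_le_one (z w : ℝ) : step z w ≤ 1 := by unfold step; split_ifs <;> norm_num

lemma hasDerivAt_mills_neg (w : ℝ) :
    HasDerivAt (fun w => mills (-w)) (w * mills (-w) + 1) w := by
  refine ((hasDerivAt_mills (-w)).comp w (hasDerivAt_neg w)).congr_deriv ?_
  ring

lemma mills_neg_eq (z : ℝ) : (1 - Phi z) * mills (-z) = Phi z * mills z := by
  rw [one_sub_Phi_eq, Phi_eq, mills, mills, neg_sq]
  ring

lemma continuous_mills : Continuous mills :=
  continuous_iff_continuousAt.2 fun w => (hasDerivAt_mills w).continuousAt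

lemma continuous_steinSol (z : ℝ) : Continuous (steinSol z) := by
  have h : steinSol z = fun w => if z ≤ w then Phi z * mills w else (1 - Phi z) * mills (-w) := by
    funext w
    unfold steinSol
    by_cases hw : w < z
    · rw [if_pos hw, if_neg (not_le.2 hw)]
    · rw [if_neg hw, if_pos (not_lt.1 hw)]
  rw [h]
  refine Continuous.if_le (continuous_const.mul continuous_mills)
    (continuous_const.mul (continuous_mills.comp continuous_neg)) continuous_const continuous_id ?_
  rintro w rfl
  exact (mills_neg_eq _).symm

lemma hasDerivWithinAt_steinSol (z w : ℝ) :
    HasDerivWithinAt (steinSol z) (steinDeriv z w) (Set.Ici w) w := by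
  rcases lt_or_ge w z with hw | hw
  · have h1 := ((hasDerivAt_mills_neg w).const_mul (1 - Phi z))
    have h2 : steinSol z =ᶠ[𝓝 w] fun w => (1 - Phi z) * mills (-w) := by
      filter_upwards [Iio_mem_nhds hw] with y hy
      exact if_pos hy
    refine ((h1.congr_of_eventuallyEq h2).congr_deriv ?_).hasDerivWithinAt
    simp only [steinDeriv, steinSol, step, if_pos hw, if_neg (not_le.2 hw)]
    ring
  · have h1 := ((hasDerivAt_mills w).const_mul (Phi z)).hasDerivWithinAt (s := Set.Ici w)
    have h2 : ∀ y ∈ Set.Ici w, steinSol z y = Phi z * mills y := fun y hy =>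
      if_neg (not_lt.2 (hw.trans hy))
    refine (h1.congr h2 (h2 w Set.self_mem_Ici)).congr_deriv ?_
    simp only [steinDeriv, steinSol, step, if_neg (not_lt.2 hw), if_pos hw]
    ring

lemma one_le_gaussWeight (z w : ℝ) : 1 ≤ gaussWeight z w := Real.one_le_exp (by positivity)

/-- Past z the weight is frozen at exp(z²/2), which compensates the Gaussian tail. Constant bounds
above z can thus be written with the same factor (1 - Φ(z)) · `gaussWeight` as those below z. -/
lemma gaussWeight_of_le {w : ℝ} (hz : 0 ≤ z) (hw : z ≤ w) :
    1 ≤ 12 * max 1 z * (1 - Phi z) * gaussWeight z w := by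
  have h1 := exp_le_one_sub_Phi hz
  have h2 := exp_sq_half_mul z
  have h3 : gaussWeight z w = Real.exp (z ^ 2 / 2) := by
    rw [gaussWeight, min_eq_right hw, max_eq_right hz]
  rw [h3]
  nlinarith [Real.exp_pos (z ^ 2 / 2)]

lemma gaussWeight_of_mem {w : ℝ} (hw0 : 0 ≤ w) (hw : w ≤ z) :
    gaussWeight z w = Real.exp (w ^ 2 / 2) := by
  rw [gaussWeight, min_eq_left hw, max_eq_right hw0]

lemma abs_steinSol_le (hz : 0 ≤ z) (w : ℝ) : |steinSol z w| ≤ 6 + 3 * Real.exp (z ^ 2 / 2) := by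
  have hP0 := Phi_nonneg z
  have hP1 := Phi_le_one z
  have hE := Real.exp_pos (z ^ 2 / 2)
  unfold steinSol
  split_ifs with hw
  · rw [abs_of_nonneg (mul_nonneg (by linarith) (mills_nonneg _))]
    have h0 := mills_nonneg (-w)
    have h2 : mills (-w) ≤ 6 + 3 * Real.exp (z ^ 2 / 2) := by
      rcases le_total w 0 with h | h
      · have := mills_le (w := -w) (by linarith)
        linarith
      · have h3 := mills_le_exp (-w)
        have h4 : Real.exp ((-w) ^ 2 / 2) ≤ Real.exp (z ^ 2 / 2) :=
          Real.exp_le_exp.2 (by nlinarith)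
        linarith
    nlinarith
  · have hw' : 0 ≤ w := hz.trans (not_lt.1 hw)
    rw [abs_of_nonneg (mul_nonneg hP0 (mills_nonneg _))]
    have h0 := mills_nonneg w
    have h2 := mills_le hw'
    nlinarith

lemma abs_mul_steinSol_le (hz : 0 ≤ z) (w : ℝ) :
    |w * steinSol z w| ≤ 12 * max 1 z * (1 - Phi z) * gaussWeight z w := by
  have hP0 := Phi_nonneg z
  have hP1 := Phi_le_one z
  have hg := one_le_gaussWeight z w
  have hq : 0 ≤ 1 - Phi z := by linarith
  have hl : 1 ≤ max 1 z := le_max_left _ _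
  have hm := mills_nonneg w
  have hm' := mills_nonneg (-w)
  rcases lt_or_ge w z with hw | hw
  · rw [steinSol, if_pos hw]
    rcases le_total w 0 with h | h
    · have h1 := mul_mills_le_one (w := -w) (by linarith)
      calc |w * ((1 - Phi z) * mills (-w))| = (1 - Phi z) * (-w * mills (-w)) := by
            rw [abs_mul, abs_of_nonpos h, abs_of_nonneg (mul_nonneg hq hm')]; ring
        _ ≤ (1 - Phi z) * (12 * max 1 z * gaussWeight z w) :=
            mul_le_mul_of_nonneg_left (by nlinarith) hq
        _ = _ := by ring
    · have h1 := mills_le_exp (-w)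
      rw [neg_sq, ← gaussWeight_of_mem h hw.le] at h1
      have h2 : w ≤ max 1 z := hw.le.trans (le_max_right _ _)
      calc |w * ((1 - Phi z) * mills (-w))| = (1 - Phi z) * (w * mills (-w)) := by
            rw [abs_mul, abs_of_nonneg h, abs_of_nonneg (mul_nonneg hq hm')]; ring
        _ ≤ (1 - Phi z) * (max 1 z * (12 * gaussWeight z w)) := by
            gcongr; linarith
        _ = _ := by ring
  · rw [steinSol, if_neg (not_lt.2 hw)]
    have hw0 := hz.trans hw
    have h1 := mul_mills_le_one hw0
    refine le_trans ?_ (gaussWeight_of_le hz hw)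
    rw [abs_of_nonneg (by positivity)]
    nlinarith [mul_nonneg hw0 hm]

/-- The right derivative of `w * steinSol z w`. -/
lemma exists_right_deriv_mul_steinSol (hz : 0 ≤ z) (w : ℝ) :
    ∃ d, HasDerivWithinAt (fun w => w * steinSol z w) d (Set.Ici w) w ∧
      |d| ≤ 72 * max 1 z ^ 2 * (1 - Phi z) * gaussWeight z w := by
  refine ⟨_, (hasDerivWithinAt_id w _).mul (hasDerivWithinAt_steinSol z w), ?_⟩
  simp only [id, one_mul, steinDeriv]
  have hP0 := Phi_nonneg z
  have hP1 := Phi_le_one z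
  have hg := one_le_gaussWeight z w
  have hq : 0 ≤ 1 - Phi z := by linarith
  have hl : 1 ≤ max 1 z := le_max_left _ _
  have hl2 : 1 ≤ max 1 z ^ 2 := one_le_pow₀ hl
  rcases lt_or_ge w z with hw | hw
  · simp only [steinSol, step, if_pos hw, if_neg (not_le.2 hw), sub_zero]
    have e : (1 - Phi z) * mills (-w) + w * (w * ((1 - Phi z) * mills (-w)) + (1 - Phi z)) =
        (1 - Phi z) * ((1 + (-w) ^ 2) * mills (-w) - -w) := by ring
    rw [e, abs_mul, abs_of_nonneg hq]
    have h3 : |(1 + (-w) ^ 2) * mills (-w) - -w| ≤ 72 * max 1 z ^ 2 * gaussWeight z w := by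
      rcases le_total w 0 with h | h
      · refine (abs_mul_mills_sub_le (w := -w) (by linarith)).trans ?_
        nlinarith
      · have h1 := mills_le_exp (-w)
        have h0 := mills_nonneg (-w)
        rw [neg_sq, ← gaussWeight_of_mem h hw.le] at h1
        have h2 : w ≤ max 1 z := hw.le.trans (le_max_right _ _)
        have h4 : w ^ 2 ≤ max 1 z ^ 2 := pow_le_pow_left₀ h h2 2
        rw [abs_of_nonneg (by nlinarith), neg_sq]
        calc (1 + w ^ 2) * mills (-w) - -w
            ≤ (max 1 z ^ 2 + max 1 z ^ 2) * (3 * gaussWeight z w) + max 1 z ^ 2 * gaussWeight z w := by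
              have : w ≤ max 1 z ^ 2 * gaussWeight z w := by nlinarith
              have : (1 + w ^ 2) * mills (-w) ≤
                (max 1 z ^ 2 + max 1 z ^ 2) * (3 * gaussWeight z w) := by gcongr
              linarith
          _ = 7 * (max 1 z ^ 2 * gaussWeight z w) := by ring
          _ ≤ 72 * (max 1 z ^ 2 * gaussWeight z w) := by gcongr; norm_num
          _ = _ := by ring
    calc (1 - Phi z) * |(1 + (-w) ^ 2) * mills (-w) - -w|
        ≤ (1 - Phi z) * (72 * max 1 z ^ 2 * gaussWeight z w) := by gcongr
      _ = _ := by ring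
  · have hw0 := hz.trans hw
    simp only [steinSol, step, if_neg (not_lt.2 hw), if_pos hw]
    have e : Phi z * mills w + w * (w * (Phi z * mills w) + (1 - Phi z - 1)) =
        Phi z * ((1 + w ^ 2) * mills w - w) := by ring
    rw [e, abs_mul, abs_of_nonneg hP0]
    have h1 := abs_mul_mills_sub_le hw0
    have h2 := gaussWeight_of_le hz hw
    have h4 : max 1 z ≤ max 1 z ^ 2 := le_self_pow₀ hl (by norm_num)
    have h5 := abs_nonneg ((1 + w ^ 2) * mills w - w)
    calc Phi z * |(1 + w ^ 2) * mills w - w| ≤ 1 * 6 := by gcongr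
      _ ≤ 6 * (12 * max 1 z * (1 - Phi z) * gaussWeight z w) := by linarith
      _ ≤ 6 * (12 * max 1 z ^ 2 * (1 - Phi z) * gaussWeight z w) := by gcongr
      _ = _ := by ring

lemma abs_mul_steinSol_sub_le (hz : 0 ≤ z) (w w' : ℝ) :
    |w * steinSol z w - w' * steinSol z w'| ≤
      72 * max 1 z ^ 2 * (1 - Phi z) * (|w - w'| * Real.exp (max 1 z * |w - w'|)) *
        gaussWeight z w := by
  have hT := isTest_gaussWeight hz (le_max_right 1 z)
  choose d hd hdb using exists_right_deriv_mul_steinSol hz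
  have hq : 0 ≤ 1 - Phi z := by linarith [Phi_le_one z]
  have h1 := abs_sub_le_of_right_deriv (w := w) (w' := w')
    (C := 72 * max 1 z ^ 2 * (1 - Phi z) * (Real.exp (max 1 z * |w - w'|) * gaussWeight z w))
    (continuous_id.mul (continuous_steinSol z)) hd fun y hy => by
      refine (hdb y).trans ?_
      gcongr
      refine (hT.lip' w y).trans ?_
      have h2 : |y - w| ≤ |w - w'| := by
        have := Set.abs_sub_left_of_mem_uIcc hy
        rwa [abs_sub_comm w w']
      have := hT.pos w
      gcongr
  exact h1.trans (le_of_eq (by ring))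

/-- The step changes only if y and w lie on different sides of z, which forces |w - z| ≤ d and makes
the right side at least 1. The jump becomes a factor comparable with the bump. -/
lemma abs_step_sub_le {s w y d : ℝ} (hs : 0 < s) (hy : |y - w| ≤ d) :
    |step z y - step z w| ≤ Real.exp (d / s) * Real.exp (-(|w - z| / s)) := by
  have hpos : 0 ≤ Real.exp (d / s) * Real.exp (-(|w - z| / s)) := by positivity
  have key : |w - z| ≤ |y - w| → 1 ≤ Real.exp (d / s) * Real.exp (-(|w - z| / s)) := fun h => by
    rw [← Real.exp_add]
    refine Real.one_le_exp ?_
    rw [← sub_eq_add_neg, ← sub_div]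
    exact div_nonneg (by linarith) hs.le
  unfold step
  split_ifs with h1 h2 h2
  · simpa using hpos
  · simp only [sub_zero, abs_one]
    refine key ?_
    rw [abs_of_nonpos (by linarith), abs_of_nonneg (by linarith)]
    linarith
  · simp only [zero_sub, abs_neg, abs_one]
    refine key ?_
    rw [abs_of_nonneg (by linarith), abs_of_nonpos (by linarith)]
    linarith
  · simpa using hpos

/-- First-order Taylor bound for the Stein solution. -/
lemma taylor_steinSol_le (hz : 0 ≤ z) {s : ℝ} (hs : 0 < s) (w w' : ℝ) :
    |steinSol z w - steinSol z w' - (w - w') * steinDeriv z w| ≤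
      72 * max 1 z ^ 2 * (1 - Phi z) *
        (|w - w'| ^ 2 * Real.exp (max 1 z * |w - w'|)) * gaussWeight z w +
      |w - w'| * Real.exp (|w - w'| / s) * Real.exp (-(|w - z| / s)) := by
  have hq : 0 ≤ 1 - Phi z := by linarith [Phi_le_one z]
  have hg := one_le_gaussWeight z w
  have h1 := abs_sub_le_of_right_deriv (w := w) (w' := w')
    (f := fun y => steinSol z y - y * steinDeriv z w)
    (D := fun y => steinDeriv z y - steinDeriv z w)
    (C := 72 * max 1 z ^ 2 * (1 - Phi z) * (|w - w'| * Real.exp (max 1 z * |w - w'|)) *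
        gaussWeight z w + Real.exp (|w - w'| / s) * Real.exp (-(|w - z| / s)))
    ((continuous_steinSol z).sub (continuous_id.mul continuous_const))
    (fun y => by
      have := (hasDerivWithinAt_steinSol z y).sub
        ((hasDerivWithinAt_id y (Set.Ici y)).mul_const (steinDeriv z w))
      exact this.congr_deriv (by simp))
    (fun y hy => by
      have h2 : |y - w| ≤ |w - w'| := by
        have := Set.abs_sub_left_of_mem_uIcc hy
        rwa [abs_sub_comm w w']
      have h3 := abs_mul_steinSol_sub_le hz w y
      rw [abs_sub_comm w y] at h3
      have h4 := abs_step_sub_le (z := z) hs h2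
      -- Stein's equation splits the derivative into the continuous part w f(w), with increments
      -- governed by the Gaussian weight, and a jump governed by the distance to z.
      have e : steinDeriv z y - steinDeriv z w =
          (y * steinSol z y - w * steinSol z w) - (step z y - step z w) := by
        unfold steinDeriv; ring
      rw [e]
      refine (abs_sub _ _).trans (add_le_add ?_ h4)
      rw [abs_sub_comm]
      refine h3.trans ?_
      gcongr)
  calc _ = |steinSol z w - w * steinDeriv z w - (steinSol z w' - w' * steinDeriv z w)| := by
        ring_nf
    _ ≤ _ := h1
    _ = _ := by ring

end SteinSolution

end LocalDep

/-! ### Comparison of the tail of W with the Gaussian tail -/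

namespace LocalDep

lemma abs_steinDeriv_le {z : ℝ} (hz : 0 ≤ z) (w : ℝ) :
    |steinDeriv z w| ≤ 13 * max 1 z * (1 - Phi z) * gaussWeight z w + step z w := by
  have h1 := abs_mul_steinSol_le hz w
  have h2 := one_le_gaussWeight z w
  have h3 : 1 ≤ max 1 z := le_max_left _ _
  have h4 := (one_sub_Phi_pos hz).le
  have h5 := step_nonneg z w
  have h6 : (1 - Phi z) ≤ max 1 z * (1 - Phi z) * gaussWeight z w := by
    calc 1 - Phi z = 1 * (1 - Phi z) * 1 := by ring
      _ ≤ _ := by gcongr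
  have h7 : |(1 - Phi z) - step z w| ≤ (1 - Phi z) + step z w := by
    rw [abs_le]; constructor <;> linarith
  calc |steinDeriv z w| ≤ |w * steinSol z w| + |(1 - Phi z) - step z w| := abs_add_le _ _
    _ ≤ _ := by linarith

lemma step_le_tilt {ℓ z : ℝ} (hz : 0 ≤ z) (hzℓ : z ≤ ℓ) (hℓ : 1 ≤ ℓ) (w : ℝ) :
    step z w ≤ 3 * Real.exp (-z ^ 2) * tilt ℓ z z w := by
  refine le_trans ?_ (exp_mul_min_sub_le hz hzℓ hℓ w)
  unfold step
  split_ifs with h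
  · simp [min_eq_right h]
  · positivity

namespace IsModerate

variable {Ω J : Type*} [MeasurableSpace Ω] [Fintype J] {P : Measure Ω}
  {X : J → Ω → ℝ} {A B : J → Finset J} {a b ν ℓ z t : ℝ}

lemma sq_absSum_mul_exp_le (h : IsModerate P X A B a b ν ℓ z) {lam : ℝ} (hlam : lam ≤ a / 32)
    (s : Finset J) (ω : Ω) :
    absSum X s ω ^ 2 * Real.exp (lam * absSum X s ω) ≤ 2048 / a ^ 2 * wt X a s ω := by
  have ha := h.a_pos
  have hS := absSum_nonneg X s ω
  have h1 := sq_le_mul_exp (x := a * absSum X s ω) (by positivity)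
  have h2 : Real.exp (lam * absSum X s ω) ≤ Real.exp (a * absSum X s ω / 32) := by
    refine Real.exp_le_exp.2 ?_
    nlinarith
  have h3 : wt X a s ω =
      Real.exp (a * absSum X s ω / 32) * Real.exp (a * absSum X s ω / 32) := by
    rw [wt, ← Real.exp_add]; congr 1; ring
  rw [div_mul_eq_mul_div, le_div_iff₀ (by positivity), h3]
  calc absSum X s ω ^ 2 * Real.exp (lam * absSum X s ω) * a ^ 2
      = (a * absSum X s ω) ^ 2 * Real.exp (lam * absSum X s ω) := by ring
    _ ≤ (2048 * Real.exp (a * absSum X s ω / 32)) * Real.exp (a * absSum X s ω / 32) := by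
        gcongr
    _ = _ := by ring

lemma exp_le_level (h : IsModerate P X A B a b ν ℓ z) :
    Real.exp (-(z ^ 2 / 2)) ≤ 12 * ℓ * (1 - Phi z) := by
  rw [h.eq_max]; exact exp_le_one_sub_Phi h.nonneg

variable [IsProbabilityMeasure P]

/-- The regular part of the derivative is tested with the Gaussian weight: one factor ℓ each comes
from the derivative, the fluctuation and E `gaussWeight`. The step is tested with the tilt at z, and
exp(-z²/2) ≤ 12 ℓ (1 - Φ(z)) restores the Gaussian tail. -/
lemma integral_fluct_mul_steinDeriv_le (h : IsModerate P X A B a b ν ℓ z) :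
    |∫ ω, steinDeriv z (W X ω) * fluct P (localProd X A) ω ∂P| ≤
      10 ^ 10 * (ℓ ^ 3 * (kappa B * ν / a)) * (1 - Phi z) := by
  have hℓ := h.one_le_level
  have hz := h.nonneg
  have hν := h.half_le_nu
  have ha := h.a_pos
  have hq := (one_sub_Phi_pos hz).le
  have hfl : Controlled X B a 2 (fluct P (localProd X A)) := controlled_fluct h.controlled_localProd
  have hT := isTest_gaussWeight hz h.le_level
  have hm := h.controlled_test hT
  have hst : Controlled X B a 0 (fun ω => step z (W X ω)) :=
    Controlled.of_bounded ((measurable_step z).comp h.measurable_W) 1 fun ω => by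
      rw [abs_of_nonneg (step_nonneg _ _)]; exact step_le_one _ _
  have hDm : Measurable (steinDeriv z) := by
    have := (continuous_steinSol z).measurable
    exact (measurable_id.mul this).add (measurable_const.sub (measurable_step z))
  have hbd : ∀ ω, |steinDeriv z (W X ω)| ≤
      13 * ℓ * (1 - Phi z) * gaussWeight z (W X ω) + step z (W X ω) := fun ω => by
    rw [h.eq_max]; exact abs_steinDeriv_le hz _
  have hD : Controlled X B a 0 (fun ω => steinDeriv z (W X ω)) :=
    Controlled.of_le (hDm.comp h.measurable_W) ((hm.const_mul _).add hst) hbd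
  have f1 := h.integral_abs_fluct_localProd_le hT
  have f2 := h.integral_gaussWeight_le
  have f3 := h.integral_fluct_localProd_mul_le (measurable_step z) (step_nonneg z)
    (step_le_tilt hz h.le_level hℓ)
  have f4 := h.exp_le_level
  set ε := kappa B * ν / a with hε
  have hε0 : 0 ≤ ε := by positivity
  have i1 := h.integrable ((hfl.abs.mul hm).const_mul (13 * ℓ * (1 - Phi z)))
  have i2 := h.integrable (hfl.abs.mul hst)
  calc |∫ ω, steinDeriv z (W X ω) * fluct P (localProd X A) ω ∂P|
      ≤ ∫ ω, |steinDeriv z (W X ω) * fluct P (localProd X A) ω| ∂P := abs_integral_le_integral_abs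
    _ ≤ ∫ ω, (13 * ℓ * (1 - Phi z) * (|fluct P (localProd X A) ω| * gaussWeight z (W X ω)) +
        |fluct P (localProd X A) ω| * step z (W X ω)) ∂P := by
        refine integral_mono (h.integrable (hD.mul hfl).abs) (i1.add i2) fun ω => ?_
        simp only [abs_mul]
        have := mul_le_mul_of_nonneg_right (hbd ω) (abs_nonneg (fluct P (localProd X A) ω))
        linarith
    _ = 13 * ℓ * (1 - Phi z) * ∫ ω, |fluct P (localProd X A) ω| * gaussWeight z (W X ω) ∂P +
        ∫ ω, |fluct P (localProd X A) ω| * step z (W X ω) ∂P := by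
        rw [integral_add i1 i2, integral_const_mul]
    _ ≤ 13 * ℓ * (1 - Phi z) * (6000000 * (ℓ * ε) * (96 * ℓ)) +
        108000000 * (ℓ * ε) * (12 * ℓ * (1 - Phi z)) := by
        refine add_le_add (mul_le_mul_of_nonneg_left (f1.trans ?_) (by positivity))
          (f3.trans (by gcongr))
        gcongr
    _ = 7488000000 * (ℓ ^ 3 * ε) * (1 - Phi z) + 1296000000 * (ℓ ^ 2 * ε) * (1 - Phi z) := by ring
    _ ≤ 7488000000 * (ℓ ^ 3 * ε) * (1 - Phi z) + 1296000000 * (ℓ ^ 3 * ε) * (1 - Phi z) := by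
        have : ℓ ^ 2 ≤ ℓ ^ 3 := pow_le_pow_right₀ hℓ (by norm_num)
        gcongr
    _ ≤ _ := by
        have : 0 ≤ (ℓ ^ 3 * ε) * (1 - Phi z) := by positivity
        nlinarith

/-- Comparison of `P (W ≥ z)` with the Gaussian tail. -/
lemma abs_integral_step_sub_le (h : IsModerate P X A B a b ν ℓ z) :
    |∫ ω, step z (W X ω) ∂P - (1 - Phi z)| ≤
      5 * 10 ^ 13 * (ℓ ^ 3 * (kappa B * ν / a) * ν) * (1 - Phi z) := by
  have hℓ := h.one_le_level
  have hℓ0 := h.level_pos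
  have hz := h.nonneg
  have hν := h.half_le_nu
  have hκ := h.one_le_kappa
  have ha := h.a_pos
  have hq := (one_sub_Phi_pos hz).le
  have hT := isTest_gaussWeight hz h.le_level
  have hm := h.controlled_test hT
  obtain ⟨hs, hs32, hzs⟩ := h.width_facts hν hκ
  have hbint := h.integral_bump_le
  set s := 10 ^ 6 * ν / a with hsdef
  have hLt := bump_le hz hzs h.le_level hℓ
  have hLm : Measurable (bump s z) := (continuous_bump s z).measurable
  have hbc : Controlled X B a 0 (fun ω => bump s z (W X ω)) :=
    Controlled.of_bounded (hLm.comp h.measurable_W) 1 fun ω => by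
      rw [abs_of_pos (bump_pos _ _ _)]; exact bump_le_one _ _ _
  have hfm := (continuous_steinSol z).measurable
  have hst : Controlled X B a 0 (fun ω => step z (W X ω)) :=
    Controlled.of_bounded ((measurable_step z).comp h.measurable_W) 1 fun ω => by
      rw [abs_of_nonneg (step_nonneg _ _)]; exact step_le_one _ _
  have hfc : Controlled X B a 0 (fun ω => steinSol z (W X ω)) :=
    Controlled.of_bounded (hfm.comp h.measurable_W) _ fun ω => abs_steinSol_le hz _
  have hDm : Measurable (steinDeriv z) :=
    (measurable_id.mul hfm).add (measurable_const.sub (measurable_step z))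
  have hDK : ∀ w, |steinDeriv z w| ≤
      13 * max 1 z * (1 - Phi z) * (3 * Real.exp (ℓ ^ 2)) + 1 := fun w => by
    refine (abs_steinDeriv_le hz w).trans (add_le_add ?_ (step_le_one _ _))
    have := hT.le w
    gcongr
  set r : J → Ω → ℝ := fun i ω =>
    72 * ℓ ^ 2 * (1 - Phi z) * (196608 / a ^ 3) * (wt X a (A i) ω * gaussWeight z (W X ω)) +
      8192 / a ^ 2 * (wt X a (A i) ω * bump s z (W X ω)) with hr
  have hr1 : ∀ i, Integrable (fun ω => 72 * ℓ ^ 2 * (1 - Phi z) * (196608 / a ^ 3) *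
      (wt X a (A i) ω * gaussWeight z (W X ω))) P := fun i =>
    h.integrable (((h.controlled_wt' i).mul hm).const_mul _)
  have hr2 : ∀ i, Integrable (fun ω => 8192 / a ^ 2 * (wt X a (A i) ω * bump s z (W X ω))) P :=
    fun i => h.integrable (((h.controlled_wt' i).mul hbc).const_mul _)
  have h1 := h.abs_integral_stein_le hfm (abs_steinSol_le hz) hDm hDK (r := r)
    (fun i => (hr1 i).add (hr2 i)) (fun i ω => by
      have h2 := taylor_steinSol_le hz hs (W X ω) (far X A i ω)
      rw [← h.eq_max] at h2
      have h3 := W_sub_far X A i ω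
      have hS := absSum_nonneg X (A i) ω
      have h4 := h.cube_absSum_mul_exp_le (lam := ℓ) (by linarith [h.level_le]) (A i) ω
      have h5 := h.sq_absSum_mul_exp_le (lam := 1 / s)
        (by
          have : 1 / s ≤ 2 / s := by gcongr; norm_num
          linarith) (A i) ω
      have h6 := exp_neg_le_bump (z := z) hs (W X ω)
      have hgw := (hT.pos (W X ω)).le
      have hwt := (wt_pos X a (A i) ω).le
      calc absSum X (A i) ω * |steinSol z (W X ω) - steinSol z (far X A i ω) -
            (W X ω - far X A i ω) * steinDeriv z (W X ω)|
          ≤ absSum X (A i) ω * (72 * ℓ ^ 2 * (1 - Phi z) *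
            (absSum X (A i) ω ^ 2 * Real.exp (ℓ * absSum X (A i) ω)) * gaussWeight z (W X ω) +
            absSum X (A i) ω * Real.exp (absSum X (A i) ω / s) * (4 * bump s z (W X ω))) := by
            refine mul_le_mul_of_nonneg_left (h2.trans ?_) hS
            gcongr
        _ = 72 * ℓ ^ 2 * (1 - Phi z) *
            (absSum X (A i) ω ^ 3 * Real.exp (ℓ * absSum X (A i) ω)) * gaussWeight z (W X ω) +
            (absSum X (A i) ω ^ 2 * Real.exp (1 / s * absSum X (A i) ω)) *
              (4 * bump s z (W X ω)) := by
            rw [one_div_mul_eq_div]; ring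
        _ ≤ 72 * ℓ ^ 2 * (1 - Phi z) * (196608 / a ^ 3 * wt X a (A i) ω) *
              gaussWeight z (W X ω) +
            (2048 / a ^ 2 * wt X a (A i) ω) * (4 * bump s z (W X ω)) := by
            have := (bump_pos s z (W X ω)).le
            gcongr
        _ = _ := by simp only [hr]; ring)
  have e1 : ∫ ω, W X ω * steinSol z (W X ω) ∂P - ∫ ω, steinDeriv z (W X ω) ∂P =
      ∫ ω, step z (W X ω) ∂P - (1 - Phi z) := by
    have i1 := h.integrable (h.controlled_W.mul hfc)
    have i2 : Integrable (fun ω => (1 - Phi z) - step z (W X ω)) P :=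
      (integrable_const _).sub (h.integrable hst)
    simp only [steinDeriv]
    rw [integral_add i1 i2, integral_sub (integrable_const _) (h.integrable hst)]
    simp
  rw [e1] at h1
  have e2 : ∑ i, ∫ ω, r i ω ∂P = 72 * ℓ ^ 2 * (1 - Phi z) * (196608 / a ^ 3) *
      ∫ ω, (∑ i, wt X a (A i) ω) * gaussWeight z (W X ω) ∂P +
      8192 / a ^ 2 * ∫ ω, (∑ i, wt X a (A i) ω) * bump s z (W X ω) ∂P := by
    simp only [Finset.sum_mul]
    rw [integral_finsetSum _ fun i _ => h.integrable ((h.controlled_wt' i).mul hm),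
      integral_finsetSum _ fun i _ => h.integrable ((h.controlled_wt' i).mul hbc),
      Finset.mul_sum, Finset.mul_sum, ← Finset.sum_add_distrib]
    refine Finset.sum_congr rfl fun i _ => ?_
    rw [integral_add (hr1 i) (hr2 i), integral_const_mul, integral_const_mul]
  have f1 := h.integral_fluct_mul_steinDeriv_le
  have f2 := h.integral_sum_wt_mul_le hT
  have f3 := h.integral_gaussWeight_le
  have f4 := h.integral_sum_wt_mul_le_of_le_tilt hLm (fun w => (bump_pos s z w).le)
    (bump_le_one s z) hLt
  have f5 := h.exp_le_level
  set ε := kappa B * ν / a with hε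
  have hε0 : 0 ≤ ε := by positivity
  have hνa : ν / a ≤ ε := by
    rw [hε]; gcongr
    exact le_mul_of_one_le_left (by linarith) hκ
  set q := 1 - Phi z with hqdef
  have hℓ23 : ℓ ^ 2 ≤ ℓ ^ 3 := pow_le_pow_right₀ hℓ (by norm_num)
  have g1 : 72 * ℓ ^ 2 * q * (196608 / a ^ 3) *
      ∫ ω, (∑ i, wt X a (A i) ω) * gaussWeight z (W X ω) ∂P ≤ 8 * 10 ^ 10 * (ℓ ^ 3 * ε) * q := by
    calc _ ≤ 72 * ℓ ^ 2 * q * (196608 / a ^ 3) * (57 * (ν * a ^ 2) * (96 * ℓ)) := by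
          refine mul_le_mul_of_nonneg_left (f2.trans ?_) (by positivity)
          gcongr
      _ = 77460406272 * (ℓ ^ 3 * (ν / a)) * q := by field_simp; ring
      _ ≤ _ := by gcongr; norm_num
  -- The jump contribution: the weights have total mean at most ν a², so the concentration bound is
  -- multiplied by ν. This is the source of the extra factor ν, hence of θ⁴ in the error.
  have g2 : 8192 / a ^ 2 * ∫ ω, (∑ i, wt X a (A i) ω) * bump s z (W X ω) ∂P ≤
      4 * 10 ^ 13 * (ℓ ^ 3 * ε * ν) * q + 2 * 10 ^ 10 * (ℓ ^ 3 * ε) * q := by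
    calc _ ≤ 8192 / a ^ 2 * (ν * a ^ 2 * (4 * 10 ^ 8 * (ℓ * ε) * (12 * ℓ * q)) +
          198000 * (a * ℓ * kappa B * ν) * (12 * ℓ * q)) := by
          refine mul_le_mul_of_nonneg_left (f4.trans (add_le_add ?_ ?_)) (by positivity)
          · refine mul_le_mul_of_nonneg_left (hbint.trans ?_) (by positivity)
            gcongr
          · gcongr
      _ = 39321600000000 * (ℓ ^ 2 * ε * ν) * q + 19464192000 * (ℓ ^ 2 * ε) * q := by
          rw [hε]; field_simp; ring
      _ ≤ _ := by gcongr <;> norm_num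
  have hX : 0 ≤ ℓ ^ 3 * ε * q := by positivity
  have hXν : ℓ ^ 3 * ε * q ≤ 2 * (ℓ ^ 3 * ε * ν * q) := by nlinarith
  rw [e2] at h1
  nlinarith

/-- Moderate deviation estimate for `P (W > z)`. -/
theorem abs_tail_sub_le (h : IsModerate P X A B a b ν ℓ z) :
    |P.real {ω | z < W X ω} - (1 - Phi z)| ≤
      10 ^ 14 * (ℓ ^ 3 * (kappa B * ν / a) * ν) * (1 - Phi z) := by
  have hℓ := h.one_le_level
  have hz := h.nonneg
  have hν := h.half_le_nu
  have hκ := h.one_le_kappa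
  have ha := h.a_pos
  have hq := (one_sub_Phi_pos hz).le
  obtain ⟨hs, -, -⟩ := h.width_facts hν hκ
  have h1 := h.abs_integral_step_sub_le
  have h2 := h.integral_bump_le
  have h3 := h.exp_le_level
  set s := 10 ^ 6 * ν / a with hsdef
  have hms : MeasurableSet {ω | z < W X ω} := measurableSet_lt measurable_const h.measurable_W
  have hst : Controlled X B a 0 (fun ω => step z (W X ω)) :=
    Controlled.of_bounded ((measurable_step z).comp h.measurable_W) 1 fun ω => by
      rw [abs_of_nonneg (step_nonneg _ _)]; exact step_le_one _ _
  have hbc : Controlled X B a 0 (fun ω => bump s z (W X ω)) :=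
    Controlled.of_bounded ((continuous_bump s z).measurable.comp h.measurable_W) 1 fun ω => by
      rw [abs_of_pos (bump_pos _ _ _)]; exact bump_le_one _ _ _
  have hind : Integrable ({ω | z < W X ω}.indicator (1 : Ω → ℝ)) P :=
    (integrable_const (1 : ℝ)).indicator hms
  have e1 : P.real {ω | z < W X ω} = ∫ ω, {ω | z < W X ω}.indicator (1 : Ω → ℝ) ω ∂P :=
    (integral_indicator_one hms).symm
  have e2 : P.real {ω | z < W X ω} ≤ ∫ ω, step z (W X ω) ∂P := by
    rw [e1]
    refine integral_mono hind (h.integrable hst) fun ω => ?_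
    refine Set.indicator_le' (fun ω hω => ?_) (fun ω _ => step_nonneg _ _) ω
    have hω' : z ≤ W X ω := le_of_lt (show z < W X ω from hω)
    simp [step, if_pos hω']
  -- The events W ≥ z and W > z differ by the atom at z, where the bump equals 1/4.
  have e3 : ∫ ω, step z (W X ω) ∂P ≤
      P.real {ω | z < W X ω} + 4 * ∫ ω, bump s z (W X ω) ∂P := by
    rw [e1, ← integral_const_mul, ← integral_add hind (h.integrable (hbc.const_mul 4))]
    refine integral_mono (h.integrable hst) (hind.add (h.integrable (hbc.const_mul 4)))
      fun ω => ?_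
    have hb := bump_pos s z (W X ω)
    simp only [step]
    split_ifs with hw
    · rcases hw.eq_or_lt with hw | hw
      · have h4 := exp_neg_le_bump (z := z) hs (W X ω)
        rw [← hw] at h4 ⊢
        simp only [sub_self, abs_zero, zero_div, neg_zero, Real.exp_zero] at h4
        have : 0 ≤ {ω | z < W X ω}.indicator (1 : Ω → ℝ) ω :=
          Set.indicator_nonneg (fun _ _ => zero_le_one) _
        linarith
      · rw [Set.indicator_of_mem (by exact hw), Pi.one_apply]
        linarith
    · have : 0 ≤ {ω | z < W X ω}.indicator (1 : Ω → ℝ) ω :=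
        Set.indicator_nonneg (fun _ _ => zero_le_one) _
      linarith
  set ε := kappa B * ν / a with hε
  have hε0 : 0 ≤ ε := by positivity
  set q := 1 - Phi z with hqdef
  have h4 : ∫ ω, bump s z (W X ω) ∂P ≤ 10 ^ 10 * (ℓ ^ 3 * ε * ν) * q := by
    calc _ ≤ 4 * 10 ^ 8 * (ℓ * ε) * (12 * ℓ * q) := h2.trans (by gcongr)
      _ = 48 * 10 ^ 8 * (ℓ ^ 2 * ε * 1) * q := by ring
      _ ≤ 48 * 10 ^ 8 * (ℓ ^ 3 * ε * (2 * ν)) * q := by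
          have : ℓ ^ 2 ≤ ℓ ^ 3 := pow_le_pow_right₀ hℓ (by norm_num)
          gcongr
          linarith
      _ = 96 * 10 ^ 8 * (ℓ ^ 3 * ε * ν) * q := by ring
      _ ≤ _ := by gcongr; norm_num
  have hX : 0 ≤ ℓ ^ 3 * ε * ν * q := by positivity
  rw [abs_le] at h1 ⊢
  constructor <;> nlinarith [h1.1, h1.2]

end IsModerate

end LocalDep

/-! ### Reduction to X_i = 0 for i ∉ A_i, and final assembly -/

namespace LocalDep

open Classical in
/-- The family `X` with `X_i` replaced by `0` whenever `i ∉ A_i`. -/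
noncomputable def truncated {Ω J : Type*} (X : J → Ω → ℝ) (A : J → Finset J) : J → Ω → ℝ :=
  fun i ω => if i ∈ A i then X i ω else 0

section Truncated

variable {Ω J : Type*} [MeasurableSpace Ω] {P : Measure Ω} {X : J → Ω → ℝ} {A B : J → Finset J}

/-- A centred square integrable variable that is independent of itself vanishes almost surely. -/
lemma ae_eq_zero_of_indepFun_self {Y : Ω → ℝ} (hY : MemLp Y 2 P) (h0 : ∫ ω, Y ω ∂P = 0)
    (hind : IndepFun Y Y P) : Y =ᵐ[P] 0 := by
  have h1 : ∫ ω, Y ω * Y ω ∂P = 0 := by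
    rw [hind.integral_fun_mul_eq_mul_integral hY.1 hY.1, h0, zero_mul]
  have h2 := (integral_eq_zero_iff_of_nonneg (fun ω => mul_self_nonneg (Y ω))
    (hY.integrable_mul hY)).1 h1
  filter_upwards [h2] with ω hω
  simpa using hω

/-- If i ∉ A_i, then X_i is itself a coordinate of X_{A_i^c}, and (LD1) makes it independent of
itself. -/
lemma ae_eq_zero_of_notMem (hX : ∀ i, MemLp (X i) 2 P) (h0 : ∀ i, ∫ ω, X i ω ∂P = 0)
    (h1 : LD1 P X A) {i : J} (hi : i ∉ A i) : X i =ᵐ[P] 0 := by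
  refine ae_eq_zero_of_indepFun_self (hX i) (h0 i) ?_
  exact (h1 i).comp measurable_id
    (measurable_pi_apply (⟨i, by simpa using hi⟩ : ((A i : Set J)ᶜ : Set J)))

variable [Fintype J]

lemma ae_truncated_eq (hX : ∀ i, MemLp (X i) 2 P) (h0 : ∀ i, ∫ ω, X i ω ∂P = 0)
    (h1 : LD1 P X A) : ∀ᵐ ω ∂P, ∀ i, X i ω = truncated X A i ω := by
  refine ae_all_iff.2 fun i => ?_
  by_cases hi : i ∈ A i
  · simp [truncated, hi]
  · filter_upwards [ae_eq_zero_of_notMem hX h0 h1 hi] with ω hω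
    simpa [truncated, hi] using hω

lemma isLocalSystem_truncated {a b : ℝ} (hm : ∀ i, Measurable (X i))
    (hX : ∀ i, MemLp (X i) 2 P) (h0 : ∀ i, ∫ ω, X i ω ∂P = 0) (hv : variance (W X) P = 1)
    (h1 : LD1 P X A) (h2 : LD2 P X A B) (ha : 1 ≤ a) (hb : 1 ≤ b)
    (he : ∀ i, Integrable (fun ω => Real.exp (a * ∑ j ∈ B i, |X j ω|)) P ∧
      ∫ ω, Real.exp (a * ∑ j ∈ B i, |X j ω|) ∂P ≤ b) :
    IsLocalSystem P (truncated X A) A B a b := by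
  have hae := ae_truncated_eq hX h0 h1
  have hi : ∀ i, X i =ᵐ[P] truncated X A i := fun i => by
    filter_upwards [hae] with ω hω using hω i
  have hsub : ∀ S : Set J, sub X S =ᵐ[P] sub (truncated X A) S := fun S => by
    filter_upwards [hae] with ω hω
    funext j
    exact hω j
  have hW : W X =ᵐ[P] W (truncated X A) := by
    filter_upwards [hae] with ω hω
    exact Finset.sum_congr rfl fun i _ => hω i
  have hE : ∀ i, (fun ω => Real.exp (a * ∑ j ∈ B i, |X j ω|)) =ᵐ[P]
      fun ω => Real.exp (a * absSum (truncated X A) (B i) ω) := fun i => by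
    filter_upwards [hae] with ω hω
    simp only [absSum, hω]
  exact
    { meas := fun i => by
        unfold truncated
        split_ifs with h
        · exact hm i
        · exact measurable_const
      memLp := fun i => (memLp_congr_ae (hi i)).1 (hX i)
      mean := fun i => by rw [← integral_congr_ae (hi i), h0 i]
      var := by rw [← variance_congr hW, hv]
      ld1 := fun i => (h1 i).congr (hi i) (hsub _)
      ld2 := fun i => ⟨(h2 i).1, (h2 i).2.congr (hsub _) (hsub _)⟩
      one_le_a := ha
      one_le_b := hb
      integrable_exp := fun i => (he i).1.congr (hE i)
      integral_exp_le := fun i => by rw [← integral_congr_ae (hE i)]; exact (he i).2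
      eq_zero := fun i h ω => by simp [truncated, h] }

lemma measureReal_truncated (hX : ∀ i, MemLp (X i) 2 P) (h0 : ∀ i, ∫ ω, X i ω ∂P = 0)
    (h1 : LD1 P X A) (z : ℝ) :
    P.real {ω | z < W X ω} = P.real {ω | z < W (truncated X A) ω} := by
  refine measureReal_congr ?_
  filter_upwards [ae_truncated_eq hX h0 h1] with ω hω
  have : W X ω = W (truncated X A) ω := Finset.sum_congr rfl fun i _ => hω i
  exact propext (by change z < W X ω ↔ z < W (truncated X A) ω; rw [this])

end Truncated

lemma theta_nonneg (n : ℕ) {a b : ℝ} (ha : 0 ≤ a) (hb : 0 ≤ b) : 0 ≤ theta n a b := by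
  unfold theta
  positivity

lemma card_mul_eq_theta_sq (n : ℕ) {a b : ℝ} (ha : 0 < a) (hb : 0 ≤ b) :
    n * b = theta n a b ^ 2 * a ^ 2 := by
  unfold theta
  rw [← Real.sqrt_eq_rpow, ← Real.sqrt_eq_rpow, mul_pow, mul_pow, Real.sq_sqrt hb,
    Real.sq_sqrt n.cast_nonneg]
  field_simp

lemma cube_le_of_le_rpow {a κ θ c z : ℝ} (ha : 0 < a) (hκ : 0 < κ) (hθ : 0 ≤ θ) (hz : 0 ≤ z)
    (h : z ≤ c * a ^ (1 / 3 : ℝ) * (κ ^ (-(1 / 3) : ℝ) * (1 + θ) ^ (-(2 / 3) : ℝ))) :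
    z ^ 3 ≤ c ^ 3 * a / (κ * (1 + θ) ^ 2) := by
  have hθ1 : 0 < 1 + θ := by positivity
  have e1 : (a ^ (1 / 3 : ℝ)) ^ 3 = a := by
    rw [← Real.rpow_natCast, ← Real.rpow_mul ha.le]; norm_num
  have e2 : (κ ^ (-(1 / 3) : ℝ)) ^ 3 = κ⁻¹ := by
    rw [← Real.rpow_natCast, ← Real.rpow_mul hκ.le, ← Real.rpow_neg_one]; norm_num
  have e3 : ((1 + θ) ^ (-(2 / 3) : ℝ)) ^ 3 = ((1 + θ) ^ 2)⁻¹ := by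
    rw [← Real.rpow_natCast, ← Real.rpow_mul hθ1.le, ← Real.rpow_natCast (1 + θ) 2,
      ← Real.rpow_neg hθ1.le]
    norm_num
  calc z ^ 3 ≤ (c * a ^ (1 / 3 : ℝ) * (κ ^ (-(1 / 3) : ℝ) * (1 + θ) ^ (-(2 / 3) : ℝ))) ^ 3 := by
        gcongr
    _ = c ^ 3 * a * (κ⁻¹ * ((1 + θ) ^ 2)⁻¹) := by rw [mul_pow, mul_pow, mul_pow, e1, e2, e3]
    _ = _ := by rw [← mul_inv, div_eq_mul_inv]

lemma abs_div_sub_one_le {p q r : ℝ} (hq : 0 < q) (h : |p - q| ≤ r * q) : |p / q - 1| ≤ r := by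
  have : p / q - 1 = (p - q) / q := by field_simp
  rwa [this, abs_div, abs_of_pos hq, div_le_iff₀ hq]

lemma one_le_mul_one_sub_Phi {z : ℝ} (hz : 0 ≤ z) (hz1 : z ≤ 1) : 1 ≤ 24 * (1 - Phi z) := by
  have h1 := exp_le_one_sub_Phi hz
  have h2 := Real.add_one_le_exp (-(z ^ 2 / 2))
  rw [max_eq_left hz1] at h1
  nlinarith

/-- Under the smallness condition the moderate estimate applies with ν = θ², and κ θ⁴ ≤ κ² (1 + θ⁶).
Otherwise z ≤ 1, so 1 - Φ(z) ≥ 1/24 and the relative error is at most 24, while δ_n exceeds 10⁻⁸. -/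
lemma IsLocalSystem.abs_tail_div_sub_one_le {Ω J : Type*} [MeasurableSpace Ω] [Fintype J]
    {P : Measure Ω} [IsProbabilityMeasure P] {X : J → Ω → ℝ} {A B : J → Finset J} {a b z : ℝ}
    (h : IsLocalSystem P X A B a b) (hz : 0 ≤ z)
    (hzle : z ≤ 1 / 1000 * a ^ (1 / 3 : ℝ) *
      min 1 ((kappa B : ℝ) ^ (-(1 / 3) : ℝ) *
        (1 + theta (Fintype.card J) a b) ^ (-(2 / 3) : ℝ))) :
    |P.real {ω | z < W X ω} / (1 - Phi z) - 1| ≤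
      10 ^ 14 * delta (Fintype.card J) (kappa B) a b * (1 + z ^ 3) := by
  have ha := h.a_pos
  have hκ := h.one_le_kappa
  have hθ := theta_nonneg (Fintype.card J) ha.le (zero_le_one.trans h.one_le_b)
  have hcard := card_mul_eq_theta_sq (Fintype.card J) ha (zero_le_one.trans h.one_le_b)
  have hcube := cube_le_of_le_rpow ha (zero_lt_one.trans_le hκ) hθ hz
    (hzle.trans (mul_le_mul_of_nonneg_left (min_le_right _ _) (by positivity)))
  have hq := one_sub_Phi_pos hz
  unfold delta
  set θ := theta (Fintype.card J) a b
  set κ : ℝ := (kappa B : ℝ) with hκdef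
  have hκ2 : κ ≤ κ ^ 2 := by nlinarith
  have hθ2 : θ ^ 2 ≤ 1 + θ ^ 6 := by
    nlinarith [sq_nonneg (θ ^ 2 - 1), sq_nonneg (θ ^ 3 - θ), sq_nonneg θ, sq_nonneg (θ ^ 2)]
  have hθ4 : θ ^ 4 ≤ 1 + θ ^ 6 := by
    nlinarith [mul_nonneg (sq_nonneg (θ ^ 2 - 1)) (sq_nonneg θ), sq_nonneg (θ ^ 2 - 1),
      sq_nonneg θ]
  by_cases hsmall : κ * θ ^ 2 / a * max 1 z ^ 3 ≤ 1 / 10 ^ 8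
  · have hM : IsModerate P X A B a b (θ ^ 2) (max 1 z) z :=
      { h with card_mul := hcard, nonneg := hz, eq_max := rfl, small := hsmall }
    have hℓ : max 1 z ^ 3 ≤ 1 + z ^ 3 := by
      have := pow_nonneg hz 3
      rcases max_cases 1 z with ⟨e, _⟩ | ⟨e, _⟩ <;> rw [e] <;> linarith
    refine (abs_div_sub_one_le hq hM.abs_tail_sub_le).trans ?_
    calc 10 ^ 14 * (max 1 z ^ 3 * (κ * θ ^ 2 / a) * θ ^ 2)
        = 10 ^ 14 * (κ * a⁻¹ * θ ^ 4) * max 1 z ^ 3 := by rw [div_eq_mul_inv]; ring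
      _ ≤ _ := by gcongr
  -- For z > 1 the admissible range gives κ θ² z³ / a ≤ (1/1000)³ = 10⁻⁹, so smallness would hold;
  -- this is why c = 1/1000 is small enough.
  · have hz1 : z ≤ 1 := by
      by_contra! hz1
      refine hsmall ?_
      rw [max_eq_right hz1.le]
      calc κ * θ ^ 2 / a * z ^ 3
          ≤ κ * (1 + θ) ^ 2 / a * ((1 / 1000) ^ 3 * a / (κ * (1 + θ) ^ 2)) := by
            gcongr
            linarith
        _ = (1 / 1000) ^ 3 := by
            have : κ ≠ 0 := by positivity
            have : 1 + θ ≠ 0 := by positivity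
            field_simp
        _ ≤ _ := by norm_num
    rw [max_eq_left hz1, one_pow, mul_one, not_le] at hsmall
    have hδ : κ * θ ^ 2 / a ≤ κ ^ 2 * a⁻¹ * (1 + θ ^ 6) := by
      calc κ * θ ^ 2 / a = κ * a⁻¹ * θ ^ 2 := by rw [div_eq_mul_inv]; ring
        _ ≤ _ := by gcongr
    have hp0 : 0 ≤ P.real {ω | z < W X ω} := measureReal_nonneg
    have hp1 : P.real {ω | z < W X ω} ≤ 1 := measureReal_le_one
    have hq1 := one_le_mul_one_sub_Phi hz hz1
    have hΦ := Phi_nonneg z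
    have h24 : |P.real {ω | z < W X ω} / (1 - Phi z) - 1| ≤ 24 := by
      refine abs_div_sub_one_le hq ?_
      rw [abs_le]
      constructor <;> linarith
    have hz3 := pow_nonneg hz 3
    calc _ ≤ (24 : ℝ) := h24
      _ ≤ 10 ^ 14 * (1 / 10 ^ 8) * 1 := by norm_num
      _ ≤ _ := by gcongr <;> linarith

end LocalDep

theorem theorem2p1 :
    ∃ C c : ℝ, 0 < C ∧ 0 < c ∧
      ∀ (Ω : Type*) [MeasurableSpace Ω] (P : Measure Ω) [IsProbabilityMeasure P]
        (J : Type*) [Fintype J] (X : J → Ω → ℝ) (A B : J → Finset J) (a b : ℝ),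
        (∀ i, Measurable (X i)) →
        (∀ i, MemLp (X i) 2 P) →
        (∀ i, ∫ ω, X i ω ∂P = 0) →
        variance (LocalDep.W X) P = 1 →
        LocalDep.LD1 P X A →
        LocalDep.LD2 P X A B →
        1 ≤ a → 1 ≤ b →
        (∀ i, Integrable (fun ω => Real.exp (a * ∑ j ∈ B i, |X j ω|)) P ∧
          ∫ ω, Real.exp (a * ∑ j ∈ B i, |X j ω|) ∂P ≤ b) →
        ∀ z : ℝ, 0 ≤ z →
          z ≤ c * a ^ (1 / 3 : ℝ) *
            min 1 ((LocalDep.kappa B : ℝ) ^ (-(1 / 3) : ℝ) *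
              (1 + LocalDep.theta (Fintype.card J) a b) ^ (-(2 / 3) : ℝ)) →
          |P.real {ω | z < LocalDep.W X ω} / (1 - LocalDep.Phi z) - 1| ≤
            C * LocalDep.delta (Fintype.card J) (LocalDep.kappa B) a b * (1 + z ^ 3) := by
  refine ⟨10 ^ 14, 1 / 1000, by norm_num, by norm_num, ?_⟩
  intro Ω _ P _ J _ X A B a b hm hX h0 hv h1 h2 ha hb he z hz hzle
  rw [LocalDep.measureReal_truncated hX h0 h1 z]
  exact (LocalDep.isLocalSystem_truncated hm hX h0 hv h1 h2 ha hb he).abs_tail_div_sub_one_le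
    hz hzle
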